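/- **Gameboards and pieces.** A gameboard $B$ is a grid of $m\ge 1$ rows (numbered from the bottom) and $n\ge 1$ columns (numbered from the left) whose gridsquares are filled or unfilled; $|B|=mn$; gridsquares outside the grid count as filled. It is *legal* if no row is completely filled and no completely empty row lies below a filled gridsquare. A *piece state* consists of one of the seven Tetris piece types $\mathsf{Sq},\mathsf{LG},\mathsf{RG},\mathsf{LS},\mathsf{RS},\mathsf{I},\mathsf{T}$, an orientation in $\{0^\circ,90^\circ,180^\circ,270^\circ\}$, the position of the gridsquare containing the piece's center (of the upper-left gridsquare for $\mathsf{Sq}$), and a flag fixed/unfixed. The initial state of a piece is unfixed, in base orientation, with its highest gridsquares in row $m$ and its center in column $\lfloor n/2\rfloor$. **Rotation models.** A *rotation model* $R$ maps a piece state $P$, an angle $\theta=\pm 90^\circ$ and a gameboard $B$ to a piece state $P'$. If the rotation is legal, $P'$ has the type and flag of $P$, its orientation is that of $P$ turned by $\theta$, and $P'$ occupies no filled gridsquare of $B$; if it is illegal, $P'=P$. For some constant $d$, the legality of the rotation and the displacement of the position depend only on $\theta$, the type, orientation and flag of $P$, and on which gridsquares within distance $d$ of the position of $P$ are filled, and the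 rotation is legal if none of these is filled. (Turning the piece about its center whenever the turned piece occupies no filled gridsquare is an example.) **Play.** For an unfixed piece the moves are: rotation by $\pm90^\circ$ according to $R$; translation by one column to the left or right, or by one row down, if the translated piece occupies no filled gridsquare; and fixing the piece, if some gridsquare below it is filled. No move is legal for a fixed piece. A *trajectory* of a piece on $B$ is a sequence of legal moves from its initial state that ends with a fix; its result is the gameboard obtained by filling the piece's gridsquares, removing all full rows, moving the rows above them down, and adding empty rows on top. A *game* $\mathcal G=\langle B_0,P_1,\dots,P_p\rangle$ is a legal gameboard and a sequence of pieces. A *trajectory sequence* $\Sigma=B_0,\sigma_1,B_1,\dots,\sigma_q,B_q$ of $\mathcal G$ consists of trajectories $\sigma_i$ of $P_i$ on $B_{i-1}$ with result $B_i$; it ends when $q=p$, or at the first $q<p$ at which the initial state of $P_{q+1}$ is blocked in $B_q$ (a loss). It is *acyclic* if no piece state occurs twice in one of its trajectories. Games and trajectory sequences are written as strings over a finite alphabet with their gameboards written out square by square, pieces and moves one symbol each; $|\mathcal G|$ and $|\Sigma|$ are the lengths of these strings. **Objectives.** An objective $\Phi$ assigns a truth value $\Phi(\mathcal G,\Sigma)$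 to every game $\mathcal G$ and trajectory sequence $\Sigma$ of $\mathcal G$. It is *checkable* if, given $\mathcal G$ and $\Sigma$, a Turing machine computes $\Phi(\mathcal G,\Sigma)$ in time polynomial in $|\mathcal G|+|\Sigma|$. It is *acyclic* if every game that has a trajectory sequence satisfying $\Phi$ has an acyclic trajectory sequence satisfying $\Phi$. $\mathrm{Tetris}[\Phi]$ is the problem of deciding, given a game $\mathcal G$, whether it has a trajectory sequence $\Sigma$ for which $\Phi(\mathcal G,\Sigma)$ holds. **Theorem.** Let $R$ be a rotation model and let $\Phi$ be a checkable and acyclic objective. Then $\mathrm{Tetris}[\Phi]\in\mathsf{NP}$. Moreover, in every acyclic trajectory sequence $\Sigma$ of a game $\mathcal G$ with initial gameboard $B_0$, each trajectory passes through at most $4|B_0|+1$ piece states (the initial and the final one included), and there is a polynomial $q$ with $|\Sigma|\le q(|\mathcal G|)$ for all games $\mathcal G$ and all acyclic trajectory sequences $\Sigma$ of $\mathcal G$. -/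

import Mathlib

/-! ### Polynomial time and NP

Running times are those of Mathlib's multi-stack Turing machines `Turing.FinTM2`. -/

/-- The pair `(x, w)` as one string: the symbols of `x`, tagged, followed by those of `w`. -/
def pairEncode {Γ Δ : Type} (x : List Γ) (w : List Δ) : List (Γ ⊕ Δ) :=
  x.map Sum.inl ++ w.map Sum.inr

/-- The predicate `f` on `α`, with inputs written as strings by `enc`, is computed by a Turing
machine whose running time is polynomial in the length of the input string. -/
def PolyTimeDecidable {α Γ : Type} (enc : α → List Γ) (f : α → Prop) : Prop :=
  open Classical in
  Nonempty (Turing.TM2ComputableInPolyTime enc Computability.encodeBool fun a => decide (f a))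

/-- The complexity class NP: membership in `L` is witnessed by certificates of polynomial length
that a polynomial-time verifier checks. The verifier has to handle all strings. -/
def InNP {Γ : Type} (L : Language Γ) : Prop :=
  ∃ (Δ : Type) (_ : Fintype Δ) (V : List Γ → List Δ → Prop) (q : Polynomial ℕ),
    PolyTimeDecidable (fun z : List Γ × List Δ => pairEncode z.1 z.2) (fun z => V z.1 z.2) ∧
    ∀ x : List Γ, x ∈ L ↔ ∃ w : List Δ, w.length ≤ q.eval x.length ∧ V x w

namespace Tetris

/-! ### Gameboards -/

/-- A grid of `rows.length` rows, listed from bottom to top, each listing its `width` gridsquares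
from left to right; `true` means filled. -/
@[ext]
structure Gameboard where
  width : ℕ
  rows : List (List Bool)
  width_pos : 0 < width
  rows_ne_nil : rows ≠ []
  length_of_mem : ∀ r ∈ rows, r.length = width

/-- The number of rows. -/
def Gameboard.height (B : Gameboard) : ℕ := B.rows.length

/-- The number of gridsquares `|B|`. -/
def Gameboard.size (B : Gameboard) : ℕ := B.height * B.width

/-- Gridsquare `(i, j)` (row `i` from the bottom, column `j` from the left, both counted from `1`)
is filled. Gridsquares outside the gameboard count as filled. -/
def Gameboard.Filled (B : Gameboard) (s : ℤ × ℤ) : Prop :=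
  s.1 < 1 ∨ s.2 < 1 ∨
    (B.rows[(s.1 - 1).toNat]?).bind (fun r => r[(s.2 - 1).toNat]?) ≠ some false

/-- No row is completely filled, and no completely empty row lies below a filled gridsquare. -/
def Gameboard.Legal (B : Gameboard) : Prop :=
  (∀ r ∈ B.rows, false ∈ r) ∧ B.rows.Pairwise fun lower upper => true ∈ upper → true ∈ lower

/-- The gameboard `B` with the gridsquares in `S` filled. -/
def Gameboard.fill (B : Gameboard) (S : List (ℤ × ℤ)) : Gameboard where
  width := B.width
  rows := B.rows.mapIdx fun i r => r.mapIdx fun j b =>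
    b || decide (((i : ℤ) + 1, (j : ℤ) + 1) ∈ S)
  width_pos := B.width_pos
  rows_ne_nil := by simpa using B.rows_ne_nil
  length_of_mem := by
    intro r hr
    obtain ⟨i, hi, rfl⟩ := List.mem_mapIdx.1 hr
    simpa using B.length_of_mem _ (List.getElem_mem hi)

/-- Clearing: full rows disappear, the rows above them move down, and empty rows enter on top. -/
def Gameboard.clear (B : Gameboard) : Gameboard where
  width := B.width
  rows := B.rows.filter (fun r => decide (false ∈ r)) ++
    List.replicate (B.rows.countP fun r => decide (false ∉ r)) (List.replicate B.width false)
  width_pos := B.width_pos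
  rows_ne_nil := by
    obtain ⟨r, hr⟩ := List.exists_mem_of_ne_nil _ B.rows_ne_nil
    by_cases h : false ∈ r
    · exact List.append_ne_nil_of_left_ne_nil
        (List.ne_nil_of_mem (List.mem_filter.2 ⟨hr, by simpa using h⟩)) _
    · refine List.append_ne_nil_of_right_ne_nil _ ?_
      have : 0 < B.rows.countP fun r => decide (false ∉ r) :=
        List.countP_pos_iff.2 ⟨r, hr, by simpa using h⟩
      simp only [ne_eq, List.replicate_eq_nil_iff]
      omega
  length_of_mem := by
    intro r hr
    rcases List.mem_append.1 hr with h | h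
    · exact B.length_of_mem _ (List.mem_filter.1 h).1
    · rw [(List.mem_replicate.1 h).2, List.length_replicate]

/-! ### Pieces -/

inductive PieceType
  | Sq | LG | RG | LS | RS | I | T
  deriving DecidableEq

/-- The gridsquares of a piece in its base orientation, as offsets (rows upwards, columns to the
right) from its position. The position is the gridsquare that contains the center of the piece,
and the upper-left gridsquare for `Sq`.
`LG` and `RG` are upright, with a foot at the bottom left and at the bottom right;
`LS` and `RS` are upright, with the lower half in the left and in the right column;
`I` is horizontal, with its center in the second gridsquare; `T` points down. -/
def PieceType.base : PieceType → List (ℤ × ℤ)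
  | Sq => [(0, 0), (0, 1), (-1, 0), (-1, 1)]
  | LG => [(1, 0), (0, 0), (-1, 0), (-1, -1)]
  | RG => [(1, 0), (0, 0), (-1, 0), (-1, 1)]
  | LS => [(1, 0), (0, 0), (0, -1), (-1, -1)]
  | RS => [(1, -1), (0, -1), (0, 0), (-1, 0)]
  | I => [(0, -1), (0, 0), (0, 1), (0, 2)]
  | T => [(0, -1), (0, 0), (0, 1), (-1, 0)]

/-- The row offset of the highest gridsquares in the base orientation. -/
def PieceType.top : PieceType → ℤ
  | Sq => 0
  | LG => 1
  | RG => 1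
  | LS => 1
  | RS => 1
  | I => 0
  | T => 0

/-- Clockwise quarter turn of an offset `(row, column)`. -/
def quarterTurn (v : ℤ × ℤ) : ℤ × ℤ := (-v.2, v.1)

/-- The gridsquares, relative to the position, of a piece turned clockwise by `o` quarter turns from
its base orientation. -/
def PieceType.offsets (t : PieceType) (o : ZMod 4) : List (ℤ × ℤ) :=
  if t = Sq then t.base else t.base.map quarterTurn^[o.val]

/-- A piece state; the orientation is the number of clockwise quarter turns from the base
orientation. -/
@[ext]
structure PieceState where
  type : PieceType
  orientation : ZMod 4
  position : ℤ × ℤ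
  fixed : Bool
  deriving DecidableEq

/-- The gridsquares that a piece occupies. -/
def PieceState.squares (P : PieceState) : List (ℤ × ℤ) :=
  (P.type.offsets P.orientation).map fun v => P.position + v

/-- The piece translated by `v`. -/
def PieceState.shift (P : PieceState) (v : ℤ × ℤ) : PieceState :=
  { P with position := P.position + v }

/-- The piece does not occupy any filled gridsquare. -/
def Gameboard.Fits (B : Gameboard) (P : PieceState) : Prop :=
  ∀ s ∈ P.squares, ¬ B.Filled s

/-- Base orientation, highest gridsquares in the top row, center in column `⌊n / 2⌋`, unfixed. -/
def initialState (B : Gameboard) (t : PieceType) : PieceState where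
  type := t
  orientation := 0
  position := ((B.height : ℤ) - t.top, ((B.width / 2 : ℕ) : ℤ))
  fixed := false

/-! ### Rotation models -/

/-- The rotation angle `90°` (clockwise) or `-90°` (counterclockwise). -/
inductive Rotation
  | cw | ccw
  deriving DecidableEq

/-- The angle in clockwise quarter turns. -/
def Rotation.angle : Rotation → ZMod 4
  | cw => 1
  | ccw => -1

/-- `v` is the offset of a gridsquare at distance at most `d`. -/
def Near (d : ℕ) (v : ℤ × ℤ) : Prop := |v.1| ≤ d ∧ |v.2| ≤ d

/-- A rotation model `(P, θ, B) ↦ P'`. A legal rotation changes the orientation, so that a rotation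
is legal exactly when `P' ≠ P`. -/
structure RotationModel where
  rotate : PieceState → Rotation → Gameboard → PieceState
  /-- A legal rotation turns the piece by `θ`, possibly moving it, and keeps its other data; an
  illegal one does nothing. -/
  legal_or_eq : ∀ P θ B, rotate P θ B = P ∨
    ((rotate P θ B).type = P.type ∧ (rotate P θ B).orientation = P.orientation + θ.angle ∧
      (rotate P θ B).fixed = P.fixed)
  /-- For some constant `d`, the effect of a rotation, relative to the position of the piece, is
  determined by which gridsquares within distance `d` of that position are filled, and the rotation
  is legal when none of them is. -/
  isLocal : ∃ d : ℕ,
    (∀ (P Q : PieceState) (θ : Rotation) (B C : Gameboard),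
      P.type = Q.type → P.orientation = Q.orientation → P.fixed = Q.fixed →
      (∀ v, Near d v → (B.Filled (P.position + v) ↔ C.Filled (Q.position + v))) →
      (rotate P θ B = P ↔ rotate Q θ C = Q) ∧
        (rotate P θ B).position - P.position = (rotate Q θ C).position - Q.position) ∧
    (∀ (P : PieceState) (θ : Rotation) (B : Gameboard),
      (∀ v, Near d v → ¬ B.Filled (P.position + v)) → rotate P θ B ≠ P)
  /-- After a legal rotation the piece does not occupy a filled gridsquare. -/
  fits : ∀ P θ B, rotate P θ B ≠ P → B.Fits (rotate P θ B)

theorem offsets_near (t : PieceType) (o : ZMod 4) : ∀ v ∈ t.offsets o, Near 2 v := by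
  unfold Near
  revert o
  cases t <;> decide

theorem add_angle_ne (o : ZMod 4) (θ : Rotation) : o + θ.angle ≠ o := by
  revert o
  cases θ <;> decide

open Classical in
/-- The instantaneous rotation model: the piece turns around its center, and the rotation is illegal
only if the turned piece would occupy a filled gridsquare. -/
noncomputable def RotationModel.instantaneous : RotationModel where
  rotate P θ B :=
    if B.Fits { P with orientation := P.orientation + θ.angle } then
      { P with orientation := P.orientation + θ.angle } else P
  legal_or_eq P θ B := by
    split_ifs
    · exact Or.inr ⟨rfl, rfl, rfl⟩
    · exact Or.inl rfl
  isLocal := by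
    have ne : ∀ (P : PieceState) (θ : Rotation),
        ({ P with orientation := P.orientation + θ.angle } : PieceState) ≠ P := fun P θ h =>
      add_angle_ne P.orientation θ (congrArg PieceState.orientation h)
    refine ⟨2, ?_, ?_⟩
    · intro P Q θ B C ht ho hf hv
      have key : B.Fits { P with orientation := P.orientation + θ.angle } ↔
          C.Fits { Q with orientation := Q.orientation + θ.angle } := by
        simp only [Gameboard.Fits, PieceState.squares, List.forall_mem_map, ht, ho]
        exact forall₂_congr fun v hm => not_congr (hv v (offsets_near _ _ v hm))
      by_cases h : B.Fits { P with orientation := P.orientation + θ.angle }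
      · simp [h, key.1 h, ne]
      · have h' := mt key.2 h
        rw [if_neg h, if_neg h']
        simp
    · intro P θ B hv
      have h : B.Fits { P with orientation := P.orientation + θ.angle } := by
        simp only [Gameboard.Fits, PieceState.squares, List.forall_mem_map]
        exact fun v hm => hv v (offsets_near _ _ v hm)
      simp [h, ne]
  fits P θ B h := by
    split_ifs at h ⊢ with h'
    · exact h'
    · exact absurd rfl h

/-! ### Playing the game -/

inductive Move
  | rotate (θ : Rotation)
  | left
  | right
  | drop
  | fix
  deriving DecidableEq

/-- The move is legal for the piece state `P` on the gameboard `B`. (Attempting a rotation is always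
allowed; an illegal rotation leaves the piece state unchanged.) -/
def LegalMove (B : Gameboard) (P : PieceState) : Move → Prop
  | .rotate _ => P.fixed = false
  | .left => P.fixed = false ∧ B.Fits (P.shift (0, -1))
  | .right => P.fixed = false ∧ B.Fits (P.shift (0, 1))
  | .drop => P.fixed = false ∧ B.Fits (P.shift (-1, 0))
  | .fix => P.fixed = false ∧ ¬ B.Fits (P.shift (-1, 0))

/-- The piece state after a move. -/
def nextState (R : RotationModel) (B : Gameboard) (P : PieceState) : Move → PieceState
  | .rotate θ => R.rotate P θ B
  | .left => P.shift (0, -1)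
  | .right => P.shift (0, 1)
  | .drop => P.shift (-1, 0)
  | .fix => { P with fixed := true }

/-- The moves in the list are legal when they are made one after the other from `P`. -/
def LegalFrom (R : RotationModel) (B : Gameboard) : PieceState → List Move → Prop
  | _, [] => True
  | P, μ :: μs => LegalMove B P μ ∧ LegalFrom R B (nextState R B P μ) μs

/-- A trajectory of the piece `t` on `B`: a sequence of legal moves from the initial state that ends
with a fix move. -/
def IsTrajectory (R : RotationModel) (B : Gameboard) (t : PieceType) (σ : List Move) : Prop :=
  LegalFrom R B (initialState B t) σ ∧ σ.getLast? = some Move.fix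

/-- All piece states along a trajectory, from the initial state to the fixed one. -/
def trajectoryStates (R : RotationModel) (B : Gameboard) (t : PieceType) (σ : List Move) :
    List PieceState :=
  σ.scanl (nextState R B) (initialState B t)

/-- The gameboard that results from a trajectory. -/
def result (R : RotationModel) (B : Gameboard) (t : PieceType) (σ : List Move) : Gameboard :=
  (B.fill (σ.foldl (nextState R B) (initialState B t)).squares).clear

/-- A game: a legal initial gameboard and a sequence of pieces. -/
@[ext]
structure Game where
  board : Gameboard
  legal : board.Legal
  pieces : List PieceType

/-- `[(σ₁, B₁), …, (σ_q, B_q)]` is a correct course of play from gameboard `B` with the given pieces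
still to come: each trajectory results in the gameboard next to it, and play ends when there are no
more pieces, or with a loss, that is, when the initial state of the next piece is blocked. -/
def IsPlay (R : RotationModel) : Gameboard → List PieceType → List (List Move × Gameboard) → Prop
  | _, [], S => S = []
  | B, t :: _, [] => ¬ B.Fits (initialState B t)
  | B, t :: ts, (σ, B') :: S =>
    B.Fits (initialState B t) ∧ IsTrajectory R B t σ ∧ B' = result R B t σ ∧ IsPlay R B' ts S

/-- A trajectory sequence `B₀, σ₁, B₁, …, σ_q, B_q` of the game `G`, where `B₀` is the gameboard
of `G`. -/
def TrajectorySequence (R : RotationModel) (G : Game) : Type :=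
  { S : List (List Move × Gameboard) // IsPlay R G.board G.pieces S }

/-- The lists of piece states along the trajectories of a course of play. -/
def playStates (R : RotationModel) :
    Gameboard → List PieceType → List (List Move × Gameboard) → List (List PieceState)
  | B, t :: ts, (σ, B') :: S => trajectoryStates R B t σ :: playStates R B' ts S
  | _, _, _ => []

/-- The lists of piece states along the trajectories of a trajectory sequence. -/
def TrajectorySequence.states {R : RotationModel} {G : Game} (S : TrajectorySequence R G) :
    List (List PieceState) :=
  playStates R G.board G.pieces S.1

/-- No trajectory repeats a piece state. -/
def TrajectorySequence.Acyclic {R : RotationModel} {G : Game} (S : TrajectorySequence R G) : Prop :=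
  ∀ s ∈ S.states, s.Nodup

/-! ### Encodings as strings -/

/-- The finite alphabet in which games and trajectory sequences are written. -/
inductive Symbol
  | square (filled : Bool)
  | endOfRow
  | piece (t : PieceType)
  | move (μ : Move)
  deriving DecidableEq

/-- The gridsquares row by row, with a mark at the end of each row. -/
def Gameboard.encode (B : Gameboard) : List Symbol :=
  B.rows.flatMap fun r => r.map Symbol.square ++ [Symbol.endOfRow]

/-- The initial gameboard followed by the pieces. -/
def Game.encode (G : Game) : List Symbol :=
  G.board.encode ++ G.pieces.map Symbol.piece

/-- The moves of `σ₁`, the gameboard `B₁`, the moves of `σ₂`, and so on. -/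
def TrajectorySequence.encode {R : RotationModel} {G : Game} (S : TrajectorySequence R G) :
    List Symbol :=
  S.1.flatMap fun p => p.1.map Symbol.move ++ p.2.encode

/-! ### Objectives and the decision problem -/

/-- An objective function. -/
def Objective (R : RotationModel) : Type :=
  (G : Game) → TrajectorySequence R G → Prop

/-- If a game has a trajectory sequence that meets the objective, then it has one without repeated
piece states. -/
def Objective.Acyclic {R : RotationModel} (Φ : Objective R) : Prop :=
  ∀ G : Game, (∃ S : TrajectorySequence R G, Φ G S) →
    ∃ S : TrajectorySequence R G, Φ G S ∧ S.Acyclic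

/-- Given a game and a trajectory sequence of it, the truth value of the objective can be computed in
time polynomial in the sizes of both. -/
def Objective.Checkable {R : RotationModel} (Φ : Objective R) : Prop :=
  PolyTimeDecidable
    (fun z : (G : Game) × TrajectorySequence R G => pairEncode z.1.encode z.2.encode)
    (fun z => Φ z.1 z.2)

/-- The decision problem of the objective: the encodings of the games that have a trajectory sequence
meeting the objective. -/
def decisionProblem {R : RotationModel} (Φ : Objective R) : Language Symbol :=
  { x | ∃ G : Game, G.encode = x ∧ ∃ S : TrajectorySequence R G, Φ G S }

end Tetris

/-! Counting. A fitting unfixed piece of a given type is determined by its orientation and its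
position, and the position is itself an occupied gridsquare (`Gameboard.Fits.inside`). So there are
at most `4|B|` such states (`length_le_of_fits`). A trajectory stays unfixed until its last move, so
an acyclic one has at most one state more. Filling and clearing preserve the dimensions of the
board, so the bound in terms of `B₀` serves for every trajectory. An acyclic trajectory sequence
thus consists of at most `|G|` blocks, each with at most `4|G|` moves and a board of length at most
`|G|`, which gives `5|G|^2`.

Membership in NP. If the objective can be met, an acyclic sequence meets it, and its length is
polynomial. What remains is a polynomial-time machine that checks such a sequence. It is not written
down as a transition table. A certificate is taken to be a word of elementary stack actions, each of
which may fail, and the allowed words form a regular language `P`. One generic verifier runs a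
finite automaton for `P` while it carries out the actions on its stacks; it accepts if the automaton
accepts and no action failed. By `inNP_of_stackProgram` it then suffices to give a regular `P` such
that a successful word exists exactly for the instances in the language, and some successful word
has polynomial length.

Regular expressions over actions are nondeterministic programs: product is composition, supremum is
a guess, star is a loop that ends whenever it likes. `Sem` is the relation computed by a program and
`Exec` adds a bound on the number of actions. Loops are made to run the right number of times by
unary counters that are tested for emptiness afterwards (`forWidth`, `overRow`, `newRow`). `Steady`
and `Linear` keep track of lengths along the structure of the programs.

The program for Tetris has three phases. `readBoard` guesses the width and parses a legal board;
`play` guesses the moves, checks them, clears rows and writes the trajectory sequence on the stack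
`out`; `evaluate` runs the machine for the objective on the game and that sequence. The last machine
is only guaranteed to be correct on genuine pairs of a game and a trajectory sequence, which the
first two phases ensure. The board lies on two stacks as a tape with enough border that every local
inspection stays on it (`Gameboard.Near.exists_cell`). A rotation model depends on a bounded
neighbourhood only, so it becomes a finite table (`RotationModel.outcome`). -/

open Turing Computability

/-! ### Closure properties of regular languages -/

namespace Language

variable {α : Type*}

/-- The Myhill–Nerode criterion in the form used for the closure properties: each of them names a
finite set that contains all left quotients. -/
theorem isRegular_of_leftQuotient_mem {L : Language α} {T : Set (Language α)} (hT : T.Finite)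
    (h : ∀ x, L.leftQuotient x ∈ T) : L.IsRegular :=
  .of_finite_range_leftQuotient (hT.subset (Set.range_subset_iff.2 h))

/-- A word of `L * M` that begins with `x` is cut either after `x` or inside it. The first case
contributes the quotient of `L` by `x`, times `M`; the second a union of quotients of `M` by
suffixes of `x`. There are finitely many such unions because `M` has finitely many quotients. -/
theorem IsRegular.mul {L M : Language α} (hL : L.IsRegular) (hM : M.IsRegular) :
    (L * M).IsRegular := by
  refine isRegular_of_leftQuotient_mem
    ((hL.finite_range_leftQuotient.prod hM.finite_range_leftQuotient.finite_subsets).image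
      fun z : Language α × Set (Language α) => z.1 * M + sSup z.2) fun x => ?_
  refine ⟨(L.leftQuotient x, {N | ∃ u ∈ L, ∃ v, u ++ v = x ∧ N = M.leftQuotient v}),
    ⟨⟨x, rfl⟩, ?_⟩, ?_⟩
  · rintro N ⟨u, -, v, -, rfl⟩
    exact ⟨v, rfl⟩
  · ext y
    simp only [mem_leftQuotient, mem_mul, mem_add]
    constructor
    · rintro (⟨a, ha, b, hb, rfl⟩ | ⟨N, ⟨u, hu, v, rfl, rfl⟩, hy⟩)
      · exact ⟨x ++ a, ha, b, hb, by simp⟩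
      · exact ⟨u, hu, v ++ y, hy, by simp⟩
    · rintro ⟨a, ha, b, hb, h⟩
      rcases List.append_eq_append_iff.1 h with ⟨c, rfl, rfl⟩ | ⟨c, rfl, rfl⟩
      · exact Or.inr ⟨_, ⟨a, ha, c, rfl, rfl⟩, hb⟩
      · exact Or.inl ⟨c, ha, b, hb, rfl⟩

theorem append_mem_kstar {L : Language α} {u v : List α} (hu : u ∈ L∗) (hv : v ∈ L∗) :
    u ++ v ∈ L∗ := by
  have h : u ++ v ∈ L∗ * L∗ := append_mem_mul hu hv
  rwa [kstar_mul_kstar] at h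

theorem mem_kstar_of_mem {L : Language α} {u : List α} (hu : u ∈ L) : u ∈ L∗ :=
  le_kstar (a := L) hu

/-- For nonempty `x`, the factor of `L` in which `x` ends starts at some suffix `v` of `x` whose
complement lies in `L∗`. The quotient is therefore a union of quotients of `L`, times `L∗`. The
empty word is set apart, since the formula would give `L * L∗`, which may lack `[]`. -/
theorem IsRegular.kstar {L : Language α} (hL : L.IsRegular) : (L∗).IsRegular := by
  refine isRegular_of_leftQuotient_mem
    ((hL.finite_range_leftQuotient.finite_subsets.image
      fun z : Set (Language α) => sSup z * L∗).union (Set.finite_singleton L∗)) fun x => ?_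
  rcases eq_or_ne x [] with rfl | hx
  · exact Or.inr rfl
  refine Or.inl ⟨{N | ∃ u ∈ L∗, ∃ v, u ++ v = x ∧ N = L.leftQuotient v}, ?_, ?_⟩
  · rintro N ⟨u, -, v, -, rfl⟩
    exact ⟨v, rfl⟩
  · ext y
    simp only [mem_leftQuotient, mem_mul]
    constructor
    · rintro ⟨a, ⟨N, ⟨u, hu, v, rfl, rfl⟩, ha⟩, b, hb, rfl⟩
      rw [List.append_assoc, ← List.append_assoc v]
      exact append_mem_kstar hu (append_mem_kstar (mem_kstar_of_mem ha) hb)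
    · intro h
      obtain ⟨S, hS, hSL⟩ := mem_kstar.1 h
      clear h
      induction S generalizing x with
      | nil => simp_all
      | cons l S ih =>
        rw [List.forall_mem_cons] at hSL
        rcases List.append_eq_append_iff.1 hS with ⟨c, rfl, rfl⟩ | ⟨c, rfl, hc⟩
        · exact ⟨c, ⟨_, ⟨[], nil_mem_kstar _, x, rfl, rfl⟩, hSL.1⟩, _,
            join_mem_kstar hSL.2, rfl⟩
        -- If a factor ends exactly where `x` ends, the induction hypothesis does not apply, as it
        -- wants a nonempty remainder; the factor itself then serves as `v`, with `[]` left over.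
        · rcases eq_or_ne c [] with rfl | hc'
          · exact ⟨[], ⟨_, ⟨[], nil_mem_kstar _, l, by simp, rfl⟩, by
              change l ++ [] ∈ L; rw [List.append_nil]; exact hSL.1⟩, _,
              join_mem_kstar hSL.2, by simpa using hc⟩
          · obtain ⟨a, ⟨N, ⟨u, hu, v, rfl, rfl⟩, ha⟩, b, hb, rfl⟩ := ih c hc' hc.symm hSL.2
            refine ⟨a, ⟨_, ⟨l ++ u, ?_, v, by simp, rfl⟩, ha⟩, b, hb, rfl⟩
            exact append_mem_kstar (mem_kstar_of_mem hSL.1) hu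

theorem IsRegular.iSup {ι : Type*} [Finite ι] {L : ι → Language α} (h : ∀ i, (L i).IsRegular) :
    (⨆ i, L i).IsRegular := by
  refine isRegular_of_leftQuotient_mem
    ((Set.Finite.pi' fun i => (h i).finite_range_leftQuotient).image fun f => ⨆ i, f i) fun x => ?_
  refine ⟨fun i => (L i).leftQuotient x, fun i => ⟨x, rfl⟩, ?_⟩
  ext y
  simp [mem_iSup]

/-- The only quotients are the empty language and the singletons of suffixes of `w`. -/
theorem isRegular_singleton (w : List α) : IsRegular ({w} : Language α) := by
  refine isRegular_of_leftQuotient_mem (T := insert 0 ((fun n => {w.drop n}) '' Set.Iic w.length))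
    (((Set.finite_Iic _).image _).insert _) fun x => ?_
  by_cases hx : x <+: w
  · obtain ⟨v, rfl⟩ := hx
    refine Or.inr ⟨x.length, by simp, ?_⟩
    ext y
    change y = _ ↔ x ++ y = x ++ v
    simp
  · refine Or.inl ?_
    ext y
    exact ⟨fun h => hx ⟨y, h⟩, False.elim⟩

theorem isRegular_one : IsRegular (1 : Language α) := isRegular_singleton []

theorem IsRegular.pow {L : Language α} (h : L.IsRegular) (n : ℕ) : (L ^ n).IsRegular := by
  induction n with
  | zero => exact isRegular_one
  | succ n ih => rw [pow_succ]; exact ih.mul h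

theorem IsRegular.list_prod {ι : Type*} {L : ι → Language α} (h : ∀ i, (L i).IsRegular)
    (l : List ι) : (l.map L).prod.IsRegular := by
  induction l with
  | nil => exact isRegular_one
  | cons i l ih => rw [List.map_cons, List.prod_cons]; exact (h i).mul ih

end Language

/-! ### Nondeterministic stack programs

A program is a regular language of elementary actions on finitely many stacks and on the
configuration of one deterministic machine `tm`. -/

section Actions

variable (tm : FinTM2) {K : Type} (Γ : K → Type)

/-- Elementary actions: `pop` and `empty` fail unless the stack has the given symbol on top, or is
empty; `feed` puts a symbol on the input stack of the simulated machine, `step` lets it make a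
step, and `accept` asks that it has halted with output `true`. -/
inductive StackAction
  | push (k : K) (a : Γ k)
  | pop (k : K) (a : Γ k)
  | empty (k : K)
  | feed (a : tm.Γ tm.k₀)
  | step
  | accept

instance [Finite K] [∀ k, Finite (Γ k)] : Finite (StackAction tm Γ) := by
  have := tm.Γk₀Fin
  let f : ((Σ k, Γ k) ⊕ (Σ k, Γ k)) ⊕ (K ⊕ tm.Γ tm.k₀) ⊕ Bool → StackAction tm Γ
    | .inl (.inl z) => .push z.1 z.2
    | .inl (.inr z) => .pop z.1 z.2
    | .inr (.inl (.inl k)) => .empty k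
    | .inr (.inl (.inr a)) => .feed a
    | .inr (.inr true) => .step
    | .inr (.inr false) => .accept
  refine Finite.of_surjective f ?_
  rintro (⟨k, a⟩ | ⟨k, a⟩ | k | a | _ | _)
  exacts [⟨.inl (.inl ⟨k, a⟩), rfl⟩, ⟨.inl (.inr ⟨k, a⟩), rfl⟩, ⟨.inr (.inl (.inl k)), rfl⟩,
    ⟨.inr (.inl (.inr a)), rfl⟩, ⟨.inr (.inr true), rfl⟩, ⟨.inr (.inr false), rfl⟩]

/-- The contents of the stacks and the configuration of the simulated machine. -/
structure StackStore where
  stk : ∀ k, List (Γ k)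
  cfg : tm.Cfg

variable {tm Γ} [DecidableEq K]

open Classical in
/-- The effect of an action; `yes` is the symbol that the simulated machine writes for `true`. -/
noncomputable def StackAction.exec (yes : tm.Γ tm.k₁) :
    StackAction tm Γ → StackStore tm Γ → Option (StackStore tm Γ)
  | push k a, s => some { s with stk := Function.update s.stk k (a :: s.stk k) }
  | pop k a, s =>
    if (s.stk k).head? = some a then
      some { s with stk := Function.update s.stk k (s.stk k).tail } else none
  | empty k, s => if (s.stk k).head? = none then some s else none
  | feed a, s =>
    some { s with cfg := ⟨s.cfg.l, s.cfg.var,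
      Function.update s.cfg.stk tm.k₀ (a :: s.cfg.stk tm.k₀)⟩ }
  | step, s => (tm.step s.cfg).map fun c => { s with cfg := c }
  | accept, s =>
    if s.cfg.l = none ∧ (s.cfg.stk tm.k₁).head? = some yes then some s else none

/-- The effect of a sequence of actions. -/
noncomputable def StackAction.run (yes : tm.Γ tm.k₁) (w : List (StackAction tm Γ))
    (s : Option (StackStore tm Γ)) : Option (StackStore tm Γ) :=
  w.foldl (fun s a => s.bind (a.exec yes)) s

end Actions

/-! ### The verifier -/

namespace Verifier

variable (tm : FinTM2) {K : Type} (Γ : K → Type) (A Q : Type)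

/-- The stacks of the verifier: input (`inl true`), output (`inl false`), the stacks of the program,
and those of the simulated machine. -/
abbrev Idx (K : Type) : Type := Bool ⊕ (K ⊕ tm.K)

/-- The stack alphabets. -/
abbrev Alph : Idx tm K → Type
  | .inl true => A
  | .inl false => Bool
  | .inr (.inl k) => Γ k
  | .inr (.inr k) => tm.Γ k

/-- The internal memory: the state of the automaton that reads the certificate, whether all actions
succeeded so far, the control state of the simulated machine, the symbol read last, and whether a
nonempty stack was seen. -/
structure Var where
  dfa : Q
  ok : Bool
  lbl : Option tm.Λ
  var : tm.σ
  sym : Option A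
  more : Bool

instance [Finite Q] [Finite A] : Finite (Var tm A Q) := by
  have := tm.ΛFin
  have := tm.σFin
  refine Finite.of_injective
    (fun v : Var tm A Q => ((v.dfa, v.ok, v.lbl), (v.var, v.sym, v.more))) ?_
  rintro ⟨⟩ ⟨⟩ h
  simp_all

/-- The labels: the main loop, simulation of a step, and emptying the stacks. -/
inductive Lbl
  | main
  | sim (l : tm.Λ)
  | clean

instance : Finite (Lbl tm) := by
  have := tm.ΛFin
  refine Finite.of_surjective
    (fun | none => .main | some none => .clean | some (some l) => .sim l :
      Option (Option tm.Λ) → Lbl tm) ?_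
  rintro (_ | l | _)
  exacts [⟨none, rfl⟩, ⟨some (some l), rfl⟩, ⟨some none, rfl⟩]

variable {tm Γ A Q}

abbrev VStmt (tm : FinTM2) {K : Type} (Γ : K → Type) (A Q : Type) : Type :=
  TM2.Stmt (Alph tm Γ A) (Lbl tm) (Var tm A Q)

/-- The contents of all stacks. -/
def contents (I : List A) (O : List Bool) (S : ∀ k, List (Γ k)) (T : ∀ k, List (tm.Γ k)) :
    ∀ k, List (Alph tm Γ A k)
  | .inl true => I
  | .inl false => O
  | .inr (.inl k) => S k
  | .inr (.inr k) => T k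

section

variable [DecidableEq K]

theorem update_contents_input (I I' : List A) (O : List Bool) (S : ∀ k, List (Γ k))
    (T : ∀ k, List (tm.Γ k)) :
    Function.update (contents I O S T) (.inl true) I' = contents I' O S T := by
  funext k
  rcases k with (_ | _) | k | k <;> simp [Function.update, contents]

theorem update_contents_game (I : List A) (O : List Bool) (S : ∀ k, List (Γ k))
    (T : ∀ k, List (tm.Γ k)) (k : K) (l : List (Γ k)) :
    Function.update (contents I O S T) (.inr (.inl k)) l =
      contents I O (Function.update S k l) T := by
  funext j
  rcases j with (_ | _) | j | j
  · simp [Function.update, contents]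
  · simp [Function.update, contents]
  · by_cases h : j = k
    · subst h; simp [contents]
    · simp [Function.update, contents, h]
  · simp [Function.update, contents]

theorem update_contents_sim (I : List A) (O : List Bool) (S : ∀ k, List (Γ k))
    (T : ∀ k, List (tm.Γ k)) (k : tm.K) (l : List (tm.Γ k)) :
    Function.update (contents I O S T) (.inr (.inr k)) l =
      contents I O S (Function.update T k l) := by
  funext j
  rcases j with (_ | _) | j | j
  · simp [Function.update, contents]
  · simp [Function.update, contents]
  · simp [Function.update, contents]
  · by_cases h : j = k
    · subst h; simp [contents]
    · simp [Function.update, contents, h]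

end

/-- Simulation of one statement of the machine. -/
def simulate : TM2.Stmt tm.Γ tm.Λ tm.σ → VStmt tm Γ A Q
  | .push k f q => .push (.inr (.inr k)) (fun v => f v.var) (simulate q)
  | .peek k f q => .peek (.inr (.inr k)) (fun v o => { v with var := f v.var o }) (simulate q)
  | .pop k f q => .pop (.inr (.inr k)) (fun v o => { v with var := f v.var o }) (simulate q)
  | .load f q => .load (fun v => { v with var := f v.var }) (simulate q)
  | .branch f q₁ q₂ => .branch (fun v => f v.var) (simulate q₁) (simulate q₂)
  | .goto f => .load (fun v => { v with lbl := some (f v.var) }) (.goto fun _ => .main)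
  | .halt => .load (fun v => { v with lbl := none }) (.goto fun _ => .main)

/-- A jump of the simulated machine only changes the stored label, and control returns to the main
loop. Hence a simulated step costs a single step, and the certificate decides how many of them are
made. -/
theorem stepAux_simulate [DecidableEq K] (q : TM2.Stmt tm.Γ tm.Λ tm.σ) (v : Var tm A Q)
    (I : List A) (O : List Bool) (S : ∀ k, List (Γ k)) (T : ∀ k, List (tm.Γ k)) :
    TM2.stepAux (simulate q) v (contents I O S T) =
      ⟨some .main, { v with lbl := (TM2.stepAux q v.var T).l, var := (TM2.stepAux q v.var T).var },
        contents I O S (TM2.stepAux q v.var T).stk⟩ := by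
  induction q generalizing v T with
  | push k f q ih =>
    simp only [simulate, TM2.stepAux]
    erw [update_contents_sim, ih]
    rfl
  | peek k f q ih =>
    simp only [simulate, TM2.stepAux]
    erw [ih]
    rfl
  | pop k f q ih =>
    simp only [simulate, TM2.stepAux]
    erw [update_contents_sim, ih]
    rfl
  | load f q ih => simp only [simulate, TM2.stepAux, ih]
  | branch f q₁ q₂ ih₁ ih₂ =>
    simp only [simulate, TM2.stepAux, ih₁, ih₂]
    cases f v.var <;> rfl
  | goto f => rfl
  | halt => rfl

/-- A bound on the number of symbols that a statement pushes. -/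
def pushes : TM2.Stmt tm.Γ tm.Λ tm.σ → ℕ
  | .push _ _ q => pushes q + 1
  | .peek _ _ q => pushes q
  | .pop _ _ q => pushes q
  | .load _ q => pushes q
  | .branch _ q₁ q₂ => pushes q₁ + pushes q₂
  | .goto _ => 0
  | .halt => 0

/-- Needed for the running time: emptying the stacks at the end takes as long as the tallest stack
is high. -/
theorem length_stepAux_le (q : TM2.Stmt tm.Γ tm.Λ tm.σ) (v : tm.σ) (T : ∀ k, List (tm.Γ k)) (n : ℕ)
    (h : ∀ k, (T k).length ≤ n) (k : tm.K) :
    ((TM2.stepAux q v T).stk k).length ≤ n + pushes q := by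
  induction q generalizing v T n with
  | push j f q ih =>
    simp only [TM2.stepAux, pushes]
    rw [add_comm (pushes q), ← add_assoc]
    refine ih _ _ _ fun i => ?_
    by_cases hi : i = j
    · subst hi; simpa using h i
    · rw [Function.update_of_ne hi]; exact (h i).trans (by omega)
  | peek j f q ih => exact ih _ _ _ h
  | pop j f q ih =>
    refine ih _ _ _ fun i => ?_
    by_cases hi : i = j
    · subst hi; simpa using (h i).trans (by omega)
    · rw [Function.update_of_ne hi]; exact h i
  | load f q ih => exact ih _ _ _ h
  | branch f q₁ q₂ ih₁ ih₂ =>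
    simp only [TM2.stepAux, pushes]
    cases f v
    · exact (ih₂ _ _ _ h).trans (by omega)
    · exact (ih₁ _ _ _ h).trans (by omega)
  | goto f => exact h k
  | halt => exact h k

end Verifier

/-! ### Runs of bounded length -/

/-- The transition function leads from `a` to `b` in at most `n` steps. -/
def ReachesWithin {C : Type*} (f : C → Option C) (n : ℕ) (a b : C) : Prop :=
  ∃ k ≤ n, (flip bind f)^[k] (some a) = some b

namespace ReachesWithin

variable {C : Type*} {f : C → Option C} {m n : ℕ} {a b c : C}

theorem refl (a : C) : ReachesWithin f 0 a a := ⟨0, le_rfl, rfl⟩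

theorem single (h : f a = some b) : ReachesWithin f 1 a b := ⟨1, le_rfl, h⟩

theorem trans (h : ReachesWithin f m a b) (h' : ReachesWithin f n b c) :
    ReachesWithin f (m + n) a c := by
  obtain ⟨k, hk, e⟩ := h
  obtain ⟨l, hl, e'⟩ := h'
  refine ⟨l + k, by omega, ?_⟩
  rw [Function.iterate_add_apply, e, e']

theorem mono (h : ReachesWithin f m a b) (hmn : m ≤ n) : ReachesWithin f n a b :=
  let ⟨k, hk, e⟩ := h
  ⟨k, hk.trans hmn, e⟩

end ReachesWithin

namespace Verifier

variable {tm : FinTM2} {K : Type} {Γ : K → Type} {A Q : Type}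

/-! ### Emptying the stacks -/

/-- Pop all the stacks in the list, and record whether one of them was nonempty. -/
def popAll (l : List (Idx tm K)) (q : VStmt tm Γ A Q) : VStmt tm Γ A Q :=
  l.foldr (fun k q => .pop k (fun v o => { v with more := v.more || o.isSome }) q) q

-- One statement pops every listed stack, all within one step of the machine. Without repetitions in
-- the list, each stack is popped in its original state, so the flag tells whether any of them was
-- nonempty before.
open Classical in
theorem stepAux_popAll [DecidableEq K] (l : List (Idx tm K)) (hl : l.Nodup) (q : VStmt tm Γ A Q)
    (v : Var tm A Q) (S : ∀ k, List (Alph tm Γ A k)) :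
    ∃ b : Bool, (b = false ↔ v.more = false ∧ ∀ k ∈ l, S k = []) ∧
      TM2.stepAux (popAll l q) v S = TM2.stepAux q { v with more := b }
        (fun k : Idx tm K => if k ∈ l then (S k).tail else S k) := by
  induction l generalizing v S with
  | nil => exact ⟨v.more, by simp, by simp [popAll]⟩
  | cons k l ih =>
    rw [List.nodup_cons] at hl
    obtain ⟨b, hb, e⟩ := ih hl.2 { v with more := v.more || (S k).head?.isSome }
      (Function.update S k (S k).tail)
    refine ⟨b, ?_, ?_⟩
    · rw [hb]
      simp only [Bool.or_eq_false_iff, List.forall_mem_cons, and_assoc]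
      refine and_congr_right fun _ => and_congr (by simp) ?_
      refine forall₂_congr fun j hj => ?_
      rw [Function.update_of_ne (fun h => hl.1 (by rw [← h]; exact hj))]
    · refine Eq.trans ?_ (e.trans ?_)
      · rfl
      · congr 1
        funext j
        by_cases hj : j = k
        · subst hj; simp [hl.1]
        · simp [hj]

/-- Write the result and halt, unless a nonempty stack was seen. -/
def finish (res : Var tm A Q → Bool) (v₀ : Var tm A Q) : VStmt tm Γ A Q :=
  .branch (fun v => v.more) (.goto fun _ => .clean) <|
    .push (.inl false) res <| .load (fun _ => v₀) .halt

instance (tm : FinTM2) : Fintype tm.K := tm.kFin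

variable (tm Γ) in
/-- Empty all stacks, write the result and halt. -/
noncomputable def cleanUp [Fintype K] (res : Var tm A Q → Bool) (v₀ : Var tm A Q) :
    VStmt tm Γ A Q :=
  .load (fun v => { v with more := false }) <|
    popAll (Finset.univ : Finset (Idx tm K)).toList (finish res v₀)

theorem step_clean [Fintype K] [DecidableEq K] (m : Lbl tm → VStmt tm Γ A Q)
    (res : Var tm A Q → Bool) (v₀ : Var tm A Q) (hm : m .clean = cleanUp tm Γ res v₀)
    (v : Var tm A Q) (S : ∀ k, List (Alph tm Γ A k)) :
    ∃ b : Bool, (b = false ↔ ∀ k, S k = []) ∧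
      TM2.step m ⟨some .clean, v, S⟩ = some (TM2.stepAux (finish res v₀) { v with more := b }
        fun k => (S k).tail) := by
  obtain ⟨b, hb, e⟩ := stepAux_popAll (Finset.univ : Finset (Idx tm K)).toList
    (Finset.nodup_toList _) (finish res v₀) { v with more := false } S
  simp only [Finset.mem_toList, Finset.mem_univ, if_true, true_and, forall_const] at hb e
  refine ⟨b, hb, ?_⟩
  rw [← e, TM2.step, hm]
  rfl

/-- The output convention `haltList` demands the initial memory and empty stacks apart from the
output. Each pass shortens all stacks by one symbol, and the extra step is the pass that finds them
all empty. By `hres` the verdict ignores the flag that the passes change. -/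
theorem reaches_of_clean [Fintype K] [DecidableEq K] (m : Lbl tm → VStmt tm Γ A Q)
    (res : Var tm A Q → Bool) (v₀ : Var tm A Q)
    (hm : m .clean = cleanUp tm Γ res v₀) (hres : ∀ v b, res { v with more := b } = res v) (n : ℕ)
    (v : Var tm A Q) (S : ∀ k, List (Alph tm Γ A k)) (hS : ∀ k, (S k).length ≤ n) :
    ReachesWithin (TM2.step m) (n + 1) ⟨some .clean, v, S⟩
      ⟨none, v₀, contents [] [res v] (fun _ => []) fun _ => []⟩ := by
  have hfin : ∀ v : Var tm A Q, (∀ k, S k = []) →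
      TM2.stepAux (finish res v₀) { v with more := false } (fun k => (S k).tail) =
        ⟨none, v₀, contents [] [res v] (fun _ => []) fun _ => []⟩ := by
    intro v h0
    simp only [finish, TM2.stepAux, cond_false]
    congr 1
    funext k
    rcases k with (_ | _) | k | k <;> simp [contents, h0, hres]
  induction n generalizing v S with
  | zero =>
    have h0 : ∀ k, S k = [] := fun k => List.length_eq_zero_iff.1 (Nat.le_zero.1 (hS k))
    obtain ⟨b, hb, e⟩ := step_clean m res v₀ hm v S
    rw [hb.2 h0, hfin v h0] at e
    exact .single e
  | succ n ih =>
    obtain ⟨b, hb, e⟩ := step_clean m res v₀ hm v S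
    cases b
    · rw [hfin v (hb.1 rfl)] at e
      exact (ReachesWithin.single e).mono (by omega)
    · have h := ih { v with more := true } (fun k => (S k).tail)
        (fun k => by have := hS k; rw [List.length_tail]; omega) ?_
      · rw [hres] at h
        exact ((ReachesWithin.single e).trans h).mono (by omega)
      · intro v h0
        simp only [finish, TM2.stepAux, cond_false]
        congr 1
        funext k
        have := h0 k
        rcases k with (_ | _) | k | k <;> simp_all [contents]

end Verifier

theorem StackAction.run_append {tm : FinTM2} {K : Type} {Γ : K → Type} [DecidableEq K]
    (yes : tm.Γ tm.k₁) (u w : List (StackAction tm Γ)) (s : Option (StackStore tm Γ)) :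
    run yes (u ++ w) s = run yes w (run yes u s) :=
  List.foldl_append

/-! ### The main loop of the verifier and its running time -/

namespace Verifier

variable {tm : FinTM2} {K : Type} {Γ : K → Type} {Γ₀ Q : Type}

/-- Input symbols: those of the instance are put on the stack `kin`, those of the certificate are
actions. -/
def letter (kin : K) (ι : Γ₀ → Γ kin) : Γ₀ ⊕ StackAction tm Γ → StackAction tm Γ
  | .inl g => .push kin (ι g)
  | .inr a => a

open Classical in
/-- Perform an action and return to the main loop. -/
noncomputable def perform {A : Type} (yes : tm.Γ tm.k₁) : StackAction tm Γ → VStmt tm Γ A Q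
  | .push k a => .push (.inr (.inl k)) (fun _ => a) (.goto fun _ => .main)
  | .pop k a => .pop (.inr (.inl k)) (fun v o => { v with ok := v.ok && decide (o = some a) })
      (.goto fun _ => .main)
  | .empty k => .peek (.inr (.inl k)) (fun v o => { v with ok := v.ok && decide (o = none) })
      (.goto fun _ => .main)
  | .feed a => .push (.inr (.inr tm.k₀)) (fun _ => a) (.goto fun _ => .main)
  | .step => .branch (fun v => v.lbl.isSome) (.goto fun v => .sim (v.lbl.getD tm.main))
      (.load (fun v => { v with ok := false }) (.goto fun _ => .main))
  | .accept => .peek (.inr (.inr tm.k₁))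
      (fun v o => { v with ok := v.ok && decide (v.lbl = none ∧ o = some yes) })
      (.goto fun _ => .main)

/-- The automaton reads the symbols of the certificate. -/
def advance (M : DFA (StackAction tm Γ) Q) (q : Q) : Option (Γ₀ ⊕ StackAction tm Γ) → Q
  | some (.inr a) => M.step q a
  | _ => q

open Classical in
/-- Perform the action that belongs to the symbol read last, if it is in the list. -/
noncomputable def dispatch (kin : K) (ι : Γ₀ → Γ kin) (yes : tm.Γ tm.k₁)
    (l : List (Γ₀ ⊕ StackAction tm Γ)) : VStmt tm Γ (Γ₀ ⊕ StackAction tm Γ) Q :=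
  l.foldr (fun a q => .branch (fun v => decide (v.sym = some a)) (perform yes (letter kin ι a)) q)
    (.goto fun _ => .clean)

open Classical in
/-- The program of the verifier. -/
noncomputable def program [Fintype K] [Fintype (Γ₀ ⊕ StackAction tm Γ)]
    (M : DFA (StackAction tm Γ) Q) (kin : K)
    (ι : Γ₀ → Γ kin) (yes : tm.Γ tm.k₁) (v₀ : Var tm (Γ₀ ⊕ StackAction tm Γ) Q) :
    Lbl tm → VStmt tm Γ (Γ₀ ⊕ StackAction tm Γ) Q
  | .main => .pop (.inl true) (fun v o => { v with sym := o, dfa := advance M v.dfa o })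
      (dispatch kin ι yes Finset.univ.toList)
  | .sim l => simulate (tm.m l)
  | .clean => cleanUp tm Γ (fun v => v.ok && decide (v.dfa ∈ M.accept)) v₀

/-- The automaton skips the symbols of the instance, so it judges the certificate alone. -/
theorem foldl_advance (M : DFA (StackAction tm Γ) Q) (x : List Γ₀) (w : List (StackAction tm Γ))
    (q : Q) : (pairEncode x w).foldl (fun q a => advance M q (some a)) q = M.evalFrom q w := by
  rw [pairEncode, List.foldl_append, List.foldl_map, List.foldl_map]
  congr 1
  induction x with
  | nil => rfl
  | cons g x ih => exact ih

section

variable [DecidableEq K] (kin : K) (ι : Γ₀ → Γ kin) (yes : tm.Γ tm.k₁)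

theorem stepAux_dispatch_some (l : List (Γ₀ ⊕ StackAction tm Γ)) (a : Γ₀ ⊕ StackAction tm Γ)
    (ha : a ∈ l) (v : Var tm (Γ₀ ⊕ StackAction tm Γ) Q) (hv : v.sym = some a)
    (S : ∀ k, List (Alph tm Γ (Γ₀ ⊕ StackAction tm Γ) k)) :
    TM2.stepAux (dispatch kin ι yes l) v S =
      TM2.stepAux (perform yes (letter kin ι a)) v S := by
  induction l with
  | nil => simp at ha
  | cons b l ih =>
    by_cases hb : b = a
    · subst hb
      simp [dispatch, hv]
    · have hba : a ≠ b := fun h => hb h.symm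
      have := ih ((List.mem_cons.1 ha).resolve_left hba)
      simpa [dispatch, hv, hba] using this

theorem stepAux_dispatch_none (l : List (Γ₀ ⊕ StackAction tm Γ))
    (v : Var tm (Γ₀ ⊕ StackAction tm Γ) Q) (hv : v.sym = none)
    (S : ∀ k, List (Alph tm Γ (Γ₀ ⊕ StackAction tm Γ) k)) :
    TM2.stepAux (dispatch kin ι yes l) v S = ⟨some .clean, v, S⟩ := by
  induction l with
  | nil => rfl
  | cons b l ih => simpa [dispatch, hv] using ih

/-- The memory and the stacks of the verifier agree with the outcome of the actions so far. -/
structure Represents {A : Type} (o : Option (StackStore tm Γ)) (v : Var tm A Q)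
    (S : ∀ k, List (Γ k)) (T : ∀ k, List (tm.Γ k)) : Prop where
  ok : v.ok = o.isSome
  eq : ∀ s ∈ o, s = ⟨S, ⟨v.lbl, v.var, T⟩⟩

instance (tm : FinTM2) : Fintype tm.Λ := tm.ΛFin

/-- A bound on the number of symbols that an action puts on a stack. -/
def growth (tm : FinTM2) : ℕ :=
  1 + ∑ l : tm.Λ, pushes (tm.m l)

theorem pushes_le_growth (l : tm.Λ) : pushes (tm.m l) ≤ growth tm := by
  have h := Finset.single_le_sum (f := fun l => pushes (tm.m l)) (fun _ _ => Nat.zero_le _)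
    (Finset.mem_univ l)
  exact h.trans (Nat.le_add_left _ 1)

theorem one_le_growth : 1 ≤ growth tm := by
  exact Nat.le_add_right _ _

theorem length_update_cons_le {J : Type*} [DecidableEq J] {B : J → Type*} (S : ∀ j, List (B j))
    (k : J) (a : B k) {n g : ℕ} (hg : 1 ≤ g) (h : ∀ j, (S j).length ≤ n) (j : J) :
    (Function.update S k (a :: S k) j).length ≤ n + g := by
  by_cases hj : j = k
  · subst hj; simpa using Nat.add_le_add (h j) hg
  · rw [Function.update_of_ne hj]; exact (h j).trans (by omega)

theorem length_update_tail_le {J : Type*} [DecidableEq J] {B : J → Type*} (S : ∀ j, List (B j))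
    (k : J) {n g : ℕ} (h : ∀ j, (S j).length ≤ n) (j : J) :
    (Function.update S k (S k).tail j).length ≤ n + g := by
  by_cases hj : j = k
  · subst hj; simpa using (h j).trans (by omega)
  · rw [Function.update_of_ne hj]; exact (h j).trans (by omega)

/-- A failed action clears the flag `ok` instead of stopping the machine, so the input is always
read to its end. After a failure the stacks are unconstrained, as `Represents` says nothing about
them when the outcome is `none`. The one step allowed here is used by the action `step`, which
passes through a label of the simulated program. -/
theorem reaches_of_perform {A : Type} (m : Lbl tm → VStmt tm Γ A Q)
    (hm : ∀ l, m (.sim l) = simulate (tm.m l)) (a : StackAction tm Γ)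
    (o : Option (StackStore tm Γ)) (v : Var tm A Q) (I : List A) (S : ∀ k, List (Γ k))
    (T : ∀ k, List (tm.Γ k)) (n : ℕ) (hr : Represents o v S T) (hS : ∀ k, (S k).length ≤ n)
    (hT : ∀ k, (T k).length ≤ n) :
    ∃ v' S' T', ReachesWithin (TM2.step m) 1
        (TM2.stepAux (perform yes a) v (contents I [] S T)) ⟨some .main, v', contents I [] S' T'⟩ ∧
      Represents (o.bind (a.exec yes)) v' S' T' ∧ v'.dfa = v.dfa ∧
      (∀ k, (S' k).length ≤ n + growth tm) ∧ ∀ k, (T' k).length ≤ n + growth tm := by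
  classical
  have hS' : ∀ k, (S k).length ≤ n + growth tm := fun k => (hS k).trans (by omega)
  have hT' : ∀ k, (T k).length ≤ n + growth tm := fun k => (hT k).trans (by omega)
  obtain ⟨hok, heq⟩ := hr
  have done : ∀ c : TM2.Cfg (Alph tm Γ A) (Lbl tm) (Var tm A Q),
      ReachesWithin (TM2.step m) 1 c c := fun c => (ReachesWithin.refl c).mono (by omega)
  cases a with
  | push k a =>
    refine ⟨v, Function.update S k (a :: S k), T, ?_, ⟨?_, ?_⟩, rfl,
      length_update_cons_le S k a one_le_growth hS, hT'⟩
    · simp only [perform, TM2.stepAux]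
      erw [update_contents_game]
      exact done _
    · cases o <;> simpa [StackAction.exec] using hok
    · intro s hs
      obtain ⟨s', hs', e⟩ := Option.mem_bind_iff.1 hs
      rw [heq s' hs'] at e
      simpa [StackAction.exec, eq_comm] using e
  | pop k a =>
    refine ⟨{ v with ok := v.ok && decide ((S k).head? = some a) },
      Function.update S k (S k).tail, T, ?_, ⟨?_, ?_⟩, rfl, length_update_tail_le S k hS, hT'⟩
    · simp only [perform, TM2.stepAux]
      erw [update_contents_game]
      exact done _
    · cases o with
      | none => simp [show v.ok = false from hok]
      | some s =>
        cases heq s rfl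
        simp only [StackAction.exec, Option.bind_some, hok, Option.isSome_some, Bool.true_and]
        split_ifs with h <;> simp [h]
    · intro s hs
      obtain ⟨s', hs', e⟩ := Option.mem_bind_iff.1 hs
      rw [heq s' hs'] at e
      simp only [StackAction.exec] at e
      split_ifs at e with h
      · simpa [eq_comm] using e
      · simp at e
  | empty k =>
    refine ⟨{ v with ok := v.ok && decide ((S k).head? = none) }, S, T, done _, ⟨?_, ?_⟩, rfl,
      hS', hT'⟩
    · cases o with
      | none => simp [show v.ok = false from hok]
      | some s =>
        cases heq s rfl
        simp only [StackAction.exec, Option.bind_some, hok, Option.isSome_some, Bool.true_and]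
        split_ifs with h <;> simp [h]
    · intro s hs
      obtain ⟨s', hs', e⟩ := Option.mem_bind_iff.1 hs
      rw [heq s' hs'] at e
      simp only [StackAction.exec] at e
      split_ifs at e with h
      · simpa [eq_comm] using e
      · simp at e
  | feed a =>
    refine ⟨v, S, Function.update T tm.k₀ (a :: T tm.k₀), ?_, ⟨?_, ?_⟩, rfl, hS',
      length_update_cons_le T tm.k₀ a one_le_growth hT⟩
    · simp only [perform, TM2.stepAux]
      erw [update_contents_sim]
      exact done _
    · cases o <;> simpa [StackAction.exec] using hok
    · intro s hs
      obtain ⟨s', hs', e⟩ := Option.mem_bind_iff.1 hs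
      rw [heq s' hs'] at e
      simpa [StackAction.exec, eq_comm] using e
  | step =>
    cases hl : v.lbl with
    | none =>
      refine ⟨{ v with ok := false }, S, T, ?_, ⟨?_, ?_⟩, rfl, hS', hT'⟩
      · simp only [perform, TM2.stepAux, hl]
        exact done _
      · cases o with
        | none => rfl
        | some s =>
          cases heq s rfl
          simp only [StackAction.exec, hl, FinTM2.step, TM2.step]
          rfl
      · intro s hs
        obtain ⟨s', hs', e⟩ := Option.mem_bind_iff.1 hs
        rw [heq s' hs'] at e
        simp only [StackAction.exec, hl, FinTM2.step, TM2.step] at e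
        cases e
    | some l =>
      refine ⟨{ v with
          lbl := (TM2.stepAux (tm.m l) v.var T).l, var := (TM2.stepAux (tm.m l) v.var T).var }, S,
        (TM2.stepAux (tm.m l) v.var T).stk, .single ?_, ⟨?_, ?_⟩, rfl, hS', ?_⟩
      · simp only [perform, TM2.stepAux, hl, Option.isSome_some, cond_true, Option.getD_some,
          TM2.step, hm, stepAux_simulate]
      · cases o with
        | none => exact hok
        | some s =>
          cases heq s rfl
          simp only [StackAction.exec, hl, Option.bind_some]
          exact hok
      · intro s hs
        obtain ⟨s', hs', e⟩ := Option.mem_bind_iff.1 hs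
        rw [heq s' hs'] at e
        simp only [StackAction.exec, hl] at e
        exact (Option.some.inj e).symm
      · exact fun k => (length_stepAux_le _ _ _ n hT k).trans
          (Nat.add_le_add_left (pushes_le_growth l) n)
  | accept =>
    refine ⟨{ v with ok := v.ok && decide (v.lbl = none ∧ (T tm.k₁).head? = some yes) }, S, T,
      done _, ⟨?_, ?_⟩, rfl, hS', hT'⟩
    · cases o with
      | none => simp [show v.ok = false from hok]
      | some s =>
        cases heq s rfl
        simp only [StackAction.exec, Option.bind_some, hok, Option.isSome_some, Bool.true_and]
        split_ifs with h <;> simp [h]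
    · intro s hs
      obtain ⟨s', hs', e⟩ := Option.mem_bind_iff.1 hs
      rw [heq s' hs'] at e
      simp only [StackAction.exec] at e
      split_ifs at e with h
      · simpa [eq_comm] using e
      · simp at e

/-- Two steps per symbol suffice: one to read and dispatch it, one for a possible simulation. The
last step finds the input empty. -/
theorem reaches_of_main [Fintype K] [Fintype (Γ₀ ⊕ StackAction tm Γ)]
    (M : DFA (StackAction tm Γ) Q) (v₀ : Var tm (Γ₀ ⊕ StackAction tm Γ) Q)
    (I : List (Γ₀ ⊕ StackAction tm Γ)) (o : Option (StackStore tm Γ))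
    (v : Var tm (Γ₀ ⊕ StackAction tm Γ) Q) (S : ∀ k, List (Γ k)) (T : ∀ k, List (tm.Γ k)) (n : ℕ)
    (hr : Represents o v S T) (hS : ∀ k, (S k).length ≤ n) (hT : ∀ k, (T k).length ≤ n) :
    ∃ v' S' T', ReachesWithin (TM2.step (program M kin ι yes v₀)) (2 * I.length + 1)
        ⟨some .main, v, contents I [] S T⟩ ⟨some .clean, v', contents [] [] S' T'⟩ ∧
      Represents (StackAction.run yes (I.map (letter kin ι)) o) v' S' T' ∧
      v'.dfa = I.foldl (fun q a => advance M q (some a)) v.dfa ∧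
      (∀ k, (S' k).length ≤ n + growth tm * I.length) ∧
      ∀ k, (T' k).length ≤ n + growth tm * I.length := by
  induction I generalizing o v S T n with
  | nil =>
    refine ⟨{ v with sym := none }, S, T, .single ?_, ⟨hr.ok, hr.eq⟩, rfl, hS, hT⟩
    simp only [TM2.step, program, TM2.stepAux]
    erw [update_contents_input, stepAux_dispatch_none]
    · rfl
    · rfl
  | cons a I ih =>
    obtain ⟨v₁, S₁, T₁, h₁, hr₁, hd₁, hS₁, hT₁⟩ := reaches_of_perform yes
      (program M kin ι yes v₀) (fun _ => rfl) (letter kin ι a) o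
      { v with sym := some a, dfa := advance M v.dfa (some a) } I S T n ⟨hr.ok, hr.eq⟩ hS hT
    obtain ⟨v₂, S₂, T₂, h₂, hr₂, hd₂, hS₂, hT₂⟩ := ih _ v₁ S₁ T₁ _ hr₁ hS₁ hT₁
    refine ⟨v₂, S₂, T₂, ?_, hr₂, ?_, fun k => (hS₂ k).trans (le_of_eq ?_),
      fun k => (hT₂ k).trans (le_of_eq ?_)⟩
    · refine (((ReachesWithin.single ?_).trans h₁).trans h₂).mono
        (by rw [List.length_cons]; omega)
      simp only [TM2.step, program, TM2.stepAux]
      erw [update_contents_input, stepAux_dispatch_some _ _ _ _ a]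
      · rfl
      · simp
      · rfl
    · rw [hd₂, hd₁]; rfl
    · rw [List.length_cons]; ring
    · rw [List.length_cons]; ring

/-- Symbols of the instance act as pushes, so the instance ends up on the stack `kin` in reversed
order before the certificate begins. -/
theorem run_letters (x : List Γ₀) (w : List (StackAction tm Γ)) (c : tm.Cfg) :
    StackAction.run yes ((pairEncode x w).map (letter kin ι)) (some ⟨fun _ => [], c⟩) =
      StackAction.run yes w (some ⟨Function.update (fun _ => []) kin (x.map ι).reverse, c⟩) := by
  have hx : StackAction.run yes (x.map fun g => .push kin (ι g)) (some ⟨fun _ => [], c⟩) =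
      some ⟨Function.update (fun _ => []) kin (x.map ι).reverse, c⟩ := by
    induction x using List.reverseRecOn with
    | nil => simp [StackAction.run]
    | append_singleton x g ih =>
      rw [List.map_append, StackAction.run_append, ih]
      simp [StackAction.run, StackAction.exec]
  rw [pairEncode, List.map_append, List.map_map, List.map_map, StackAction.run_append]
  erw [hx]
  congr 1
  exact List.map_id _

theorem reaches_verdict [Fintype K] [Fintype (Γ₀ ⊕ StackAction tm Γ)]
    (M : DFA (StackAction tm Γ) Q) (x : List Γ₀) (w : List (StackAction tm Γ)) (b : Bool)
    (hb : b = true ↔ w ∈ M.accepts ∧ (StackAction.run yes w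
        (some ⟨Function.update (fun _ => []) kin (x.map ι).reverse,
          ⟨some tm.main, tm.initialState, fun _ => []⟩⟩)).isSome) :
    let v₀ : Var tm (Γ₀ ⊕ StackAction tm Γ) Q :=
      ⟨M.start, true, some tm.main, tm.initialState, none, false⟩
    ReachesWithin (TM2.step (program M kin ι yes v₀)) ((2 + growth tm) * (pairEncode x w).length + 2)
      ⟨some .main, v₀, contents (pairEncode x w) [] (fun _ => []) fun _ => []⟩
      ⟨none, v₀, contents [] [b] (fun _ => []) fun _ => []⟩ := by
  classical
  intro v₀
  obtain ⟨v, S, T, h, hr, hd, hS, hT⟩ := reaches_of_main kin ι yes M v₀ (pairEncode x w)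
    (some ⟨fun _ => [], ⟨some tm.main, tm.initialState, fun _ => []⟩⟩) v₀ (fun _ => [])
    (fun _ => []) 0 ⟨rfl, fun s hs => (Option.some.inj hs).symm⟩ (by simp) (by simp)
  -- Starting from empty stacks, every stack is at most `growth tm` times as high as the input is
  -- long; this bounds the number of cleaning passes.
  have h' := h.trans (reaches_of_clean (program M kin ι yes v₀) _ _ rfl
    (fun _ _ => rfl) (0 + growth tm * (pairEncode x w).length) v (contents [] [] S T) (by
      rintro ((_ | _) | k | k)
      · exact Nat.zero_le _
      · exact Nat.zero_le _
      · exact hS k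
      · exact hT k))
  have hok := hr.ok
  erw [run_letters] at hok
  rw [foldl_advance] at hd
  rw [hok, hd] at h'
  convert h'.mono (le_of_eq _) using 5
  · rw [Bool.eq_iff_iff, hb, Bool.and_eq_true, decide_eq_true_iff, and_comm]
    rfl
  · ring

end

end Verifier

/-! ### From nondeterministic stack programs to NP -/

/-- A run of bounded length, as data. -/
noncomputable def ReachesWithin.evalsToInTime {C : Type*} {f : C → Option C} {n : ℕ} {a b : C}
    (h : ReachesWithin f n a b) : StateTransition.EvalsToInTime f a (some b) n where
  steps := h.choose
  evals_in_steps := h.choose_spec.2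
  steps_le_m := h.choose_spec.1

/-- A language belongs to NP if membership of `x` is equivalent to the existence of a sequence of
actions in a regular language that succeeds when `x` is on the stack `kin`, and if there is such a
sequence of polynomial length. -/
theorem inNP_of_stackProgram {Γ₀ : Type} [Finite Γ₀] (tm : FinTM2) {K : Type} [Finite K]
    [DecidableEq K] {Γ : K → Type} [∀ k, Finite (Γ k)] (kin : K) (ι : Γ₀ → Γ kin)
    (yes : tm.Γ tm.k₁) {P : Language (StackAction tm Γ)} (hP : P.IsRegular) (L : Language Γ₀)
    (q : Polynomial ℕ)
    (hL : ∀ x w, w ∈ P →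
      (StackAction.run yes w (some ⟨Function.update (fun _ => []) kin (x.map ι).reverse,
        ⟨some tm.main, tm.initialState, fun _ => []⟩⟩)).isSome → x ∈ L)
    (hq : ∀ x ∈ L, ∃ w ∈ P, w.length ≤ q.eval x.length ∧
      (StackAction.run yes w (some ⟨Function.update (fun _ => []) kin (x.map ι).reverse,
        ⟨some tm.main, tm.initialState, fun _ => []⟩⟩)).isSome) :
    InNP L := by
  classical
  obtain ⟨Q, hQ, M, rfl⟩ := hP
  have := Fintype.ofFinite K
  have := Fintype.ofFinite (StackAction tm Γ)
  have := Fintype.ofFinite Γ₀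
  have := Fintype.ofFinite (Verifier.Lbl tm)
  have := Fintype.ofFinite (Verifier.Var tm (Γ₀ ⊕ StackAction tm Γ) Q)
  have : Fintype (Verifier.Alph tm Γ (Γ₀ ⊕ StackAction tm Γ) (.inl true)) :=
    inferInstanceAs (Fintype (Γ₀ ⊕ StackAction tm Γ))
  let v₀ : Verifier.Var tm (Γ₀ ⊕ StackAction tm Γ) Q :=
    ⟨M.start, true, some tm.main, tm.initialState, none, false⟩
  let V : FinTM2 := {
    K := Verifier.Idx tm K
    k₀ := .inl true
    k₁ := .inl false
    Γ := Verifier.Alph tm Γ (Γ₀ ⊕ StackAction tm Γ)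
    Λ := Verifier.Lbl tm
    main := .main
    σ := Verifier.Var tm (Γ₀ ⊕ StackAction tm Γ) Q
    initialState := v₀
    m := Verifier.program M kin ι yes v₀ }
  have hinit : ∀ I : List (Γ₀ ⊕ StackAction tm Γ), initList V I =
      ⟨some .main, v₀, Verifier.contents I [] (fun _ => []) fun _ => []⟩ := by
    intro I
    simp only [initList]
    congr 1
    funext k
    rcases k with (_ | _) | k | k <;> rfl
  have hhalt : ∀ b : Bool, haltList V [b] =
      ⟨none, v₀, Verifier.contents [] [b] (fun _ => []) fun _ => []⟩ := by
    intro b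
    simp only [haltList]
    congr 1
    funext k
    rcases k with (_ | _) | k | k <;> rfl
  -- The certificate alphabet is the finite set of actions. The verifier's predicate makes sense for
  -- arbitrary words, so no well-formedness has to be assumed.
  refine ⟨StackAction tm Γ, inferInstance, fun x w => w ∈ M.accepts ∧
    (StackAction.run yes w (some ⟨Function.update (fun _ => []) kin (x.map ι).reverse,
        ⟨some tm.main, tm.initialState, fun _ => []⟩⟩)).isSome, q, ?_, fun x => ⟨fun hx => ?_, ?_⟩⟩
  · refine ⟨{
      tm := V
      inputAlphabet := Equiv.refl _
      outputAlphabet := Equiv.refl _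
      time := Polynomial.C (2 + Verifier.growth tm) * Polynomial.X + Polynomial.C 2
      outputsFun := fun z => ReachesWithin.evalsToInTime ?_ }⟩
    have h := Verifier.reaches_verdict kin ι yes M z.1 z.2 _
      (@decide_eq_true_iff _ (Classical.propDecidable _))
    have h1 : (pairEncode z.1 z.2).map (Equiv.refl (Γ₀ ⊕ StackAction tm Γ)).invFun =
      pairEncode z.1 z.2 := List.map_id _
    erw [h1, hinit, hhalt]
    have e (n : ℕ) : (Polynomial.C (2 + Verifier.growth tm) * Polynomial.X +
        Polynomial.C 2).eval n = (2 + Verifier.growth tm) * n + 2 := by simp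
    exact h.mono (e _).ge
  · obtain ⟨w, hw, hle, h⟩ := hq x hx
    exact ⟨w, hle, hw, h⟩
  · rintro ⟨w, -, hw, h⟩
    exact hL x w hw h

/-! ### Finiteness of the Tetris alphabets -/

namespace Tetris

instance : Finite PieceType :=
  Finite.of_surjective
    (![.Sq, .LG, .RG, .LS, .RS, .I, .T] : Fin 7 → PieceType) (by
      rintro (_ | _ | _ | _ | _ | _ | _)
      exacts [⟨0, rfl⟩, ⟨1, rfl⟩, ⟨2, rfl⟩, ⟨3, rfl⟩, ⟨4, rfl⟩, ⟨5, rfl⟩, ⟨6, rfl⟩])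

instance : Finite Rotation :=
  Finite.of_surjective (fun b => cond b .cw .ccw : Bool → Rotation) (by
    rintro (_ | _)
    exacts [⟨true, rfl⟩, ⟨false, rfl⟩])

instance : Finite Move :=
  Finite.of_surjective
    (Sum.elim Move.rotate ![.left, .right, .drop, .fix] : Rotation ⊕ Fin 4 → Move) (by
      rintro (θ | _ | _ | _ | _)
      exacts [⟨.inl θ, rfl⟩, ⟨.inr 0, rfl⟩, ⟨.inr 1, rfl⟩, ⟨.inr 2, rfl⟩, ⟨.inr 3, rfl⟩])

instance : Finite Symbol :=
  Finite.of_surjective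
    (Sum.elim (Sum.elim Symbol.square fun _ => .endOfRow) (Sum.elim Symbol.piece Symbol.move) :
      (Bool ⊕ Unit) ⊕ (PieceType ⊕ Move) → Symbol) (by
      rintro (b | _ | t | μ)
      exacts [⟨.inl (.inl b), rfl⟩, ⟨.inl (.inr ()), rfl⟩, ⟨.inr (.inl t), rfl⟩,
        ⟨.inr (.inr μ), rfl⟩])

/-! ### The store of the verifier -/

/-- The stacks: `inp` holds the part of the game that is still to be read, `rev` what was read,
reversed, and `out` the trajectory sequence, reversed; the gameboard lies on `left` and `right`,
with the current gridsquare on top of `right`; `width` and `aux` count columns, `full` counts full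
rows, and `ori` holds the orientation of the piece. -/
inductive Reg
  | inp | rev | out | left | right | width | aux | full | ori
  deriving DecidableEq

instance : Finite Reg :=
  Finite.of_surjective
    (![.inp, .rev, .out, .left, .right, .width, .aux, .full, .ori] : Fin 9 → Reg) (by
      rintro (_ | _ | _ | _ | _ | _ | _ | _ | _)
      exacts [⟨0, rfl⟩, ⟨1, rfl⟩, ⟨2, rfl⟩, ⟨3, rfl⟩, ⟨4, rfl⟩, ⟨5, rfl⟩, ⟨6, rfl⟩, ⟨7, rfl⟩,
        ⟨8, rfl⟩])

/-- The stack alphabets; `none` is the border of the gameboard. -/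
abbrev Reg.Alph : Reg → Type
  | inp => Symbol
  | rev => Symbol
  | out => Symbol
  | left => Option Bool
  | right => Option Bool
  | width => Unit
  | aux => Unit
  | full => Unit
  | ori => ZMod 4

instance : ∀ k : Reg, Finite k.Alph
  | .inp => inferInstanceAs (Finite Symbol)
  | .rev => inferInstanceAs (Finite Symbol)
  | .out => inferInstanceAs (Finite Symbol)
  | .left => inferInstanceAs (Finite (Option Bool))
  | .right => inferInstanceAs (Finite (Option Bool))
  | .width => inferInstanceAs (Finite Unit)
  | .aux => inferInstanceAs (Finite Unit)
  | .full => inferInstanceAs (Finite Unit)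
  | .ori => inferInstanceAs (Finite (ZMod 4))

/-- The contents of the stacks and the configuration of the simulated machine. -/
@[ext]
structure St (tm : FinTM2) where
  inp : List Symbol
  rev : List Symbol
  out : List Symbol
  left : List (Option Bool)
  right : List (Option Bool)
  width : ℕ
  aux : ℕ
  full : ℕ
  ori : List (ZMod 4)
  cfg : tm.Cfg

namespace St

variable {tm : FinTM2}

/-- The contents of a stack. -/
def get (s : St tm) : ∀ k : Reg, List k.Alph
  | .inp => s.inp
  | .rev => s.rev
  | .out => s.out
  | .left => s.left
  | .right => s.right
  | .width => List.replicate s.width ()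
  | .aux => List.replicate s.aux ()
  | .full => List.replicate s.full ()
  | .ori => s.ori

/-- Replace the contents of a stack. -/
def set (s : St tm) : ∀ k : Reg, List k.Alph → St tm
  | .inp, l => { s with inp := l }
  | .rev, l => { s with rev := l }
  | .out, l => { s with out := l }
  | .left, l => { s with left := l }
  | .right, l => { s with right := l }
  | .width, l => { s with width := l.length }
  | .aux, l => { s with aux := l.length }
  | .full, l => { s with full := l.length }
  | .ori, l => { s with ori := l }

/-- The store, as a family of stacks. -/
def toStore (s : St tm) : StackStore tm Reg.Alph := ⟨s.get, s.cfg⟩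

theorem replicate_unit (l : List Unit) : List.replicate l.length () = l :=
  List.ext_getElem (by simp) (by simp)

theorem get_set (s : St tm) (k : Reg) (l : List k.Alph) :
    (s.set k l).get = Function.update s.get k l := by
  funext j
  cases k <;> cases j <;> simp [get, set, Function.update, replicate_unit]

theorem toStore_set (s : St tm) (k : Reg) (l : List k.Alph) :
    (s.set k l).toStore = ⟨Function.update s.get k l, s.cfg⟩ := by
  rw [toStore, get_set]
  cases k <;> rfl

theorem toStore_injective : Function.Injective (toStore (tm := tm)) := by
  intro s t h
  have hg : s.get = t.get := congrArg StackStore.stk h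
  have hc : s.cfg = t.cfg := congrArg StackStore.cfg h
  have h' := fun k => congrFun hg k
  have hw := congrArg List.length (h' .width)
  have ha := congrArg List.length (h' .aux)
  have hf := congrArg List.length (h' .full)
  simp only [get, List.length_replicate] at hw ha hf
  exact St.ext (h' .inp) (h' .rev) (h' .out) (h' .left) (h' .right) hw ha hf (h' .ori) hc

/-- Together with injectivity, this allows intermediate states of a run to be named as records with
numerical counters instead of dependent families of stacks. -/
theorem toStore_surjective : Function.Surjective (toStore (tm := tm)) := by
  rintro ⟨S, c⟩
  refine ⟨⟨S .inp, S .rev, S .out, S .left, S .right, (S .width).length, (S .aux).length,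
    (S .full).length, S .ori, c⟩, ?_⟩
  simp only [toStore, StackStore.mk.injEq, and_true]
  funext k
  cases k <;> first | rfl | exact replicate_unit _

end St

/-! ### Programs and their meaning -/

variable {tm : FinTM2} (yes : tm.Γ tm.k₁)

/-- A nondeterministic program: a set of sequences of actions. -/
abbrev Prog (tm : FinTM2) : Type := Language (StackAction tm Reg.Alph)

/-- The program `p` leads from `s` to `t` with at most `n` actions. -/
def Exec (p : Prog tm) (n : ℕ) (s t : St tm) : Prop :=
  ∃ w ∈ p, w.length ≤ n ∧ StackAction.run yes w (some s.toStore) = some t.toStore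

/-- The program `p` leads from `s` to `t`. -/
def Sem (p : Prog tm) (s t : St tm) : Prop :=
  ∃ w ∈ p, StackAction.run yes w (some s.toStore) = some t.toStore

variable {yes} {p q : Prog tm} {m n : ℕ} {s t u : St tm}

theorem Exec.sem (h : Exec yes p n s t) : Sem yes p s t :=
  let ⟨w, hw, _, e⟩ := h
  ⟨w, hw, e⟩

theorem Sem.exec (h : Sem yes p s t) : ∃ n, Exec yes p n s t :=
  let ⟨w, hw, e⟩ := h
  ⟨w.length, w, hw, le_rfl, e⟩

theorem Exec.mono (h : Exec yes p m s t) (hmn : m ≤ n) : Exec yes p n s t :=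
  let ⟨w, hw, hl, e⟩ := h
  ⟨w, hw, hl.trans hmn, e⟩

theorem Exec.le (h : Exec yes p n s t) (hpq : p ≤ q) : Exec yes q n s t :=
  let ⟨w, hw, hl, e⟩ := h
  ⟨w, hpq hw, hl, e⟩

theorem Exec.mul (h : Exec yes p m s t) (h' : Exec yes q n t u) :
    Exec yes (p * q) (m + n) s u := by
  obtain ⟨w, hw, hl, e⟩ := h
  obtain ⟨w', hw', hl', e'⟩ := h'
  refine ⟨w ++ w', Language.append_mem_mul hw hw', ?_, ?_⟩
  · rw [List.length_append]; omega
  · rw [StackAction.run_append, e, e']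

theorem run_none (w : List (StackAction tm Reg.Alph)) : StackAction.run yes w none = none := by
  induction w with
  | nil => rfl
  | cons a w ih => exact ih

/-- A run of a concatenation passes through an intermediate store, because a failed prefix cannot
recover (`run_none`). With `sem_add`, `sem_iSup` and `sem_kstar` this turns regular expressions into
relations between stores. -/
theorem sem_mul : Sem yes (p * q) s u ↔ ∃ t, Sem yes p s t ∧ Sem yes q t u := by
  constructor
  · rintro ⟨w, hw, e⟩
    obtain ⟨a, ha, b, hb, rfl⟩ := Language.mem_mul.1 hw
    rw [StackAction.run_append] at e
    cases h : StackAction.run yes a (some s.toStore) with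
    | none => rw [h, run_none] at e; cases e
    | some c =>
      obtain ⟨t, rfl⟩ := St.toStore_surjective c
      exact ⟨t, ⟨a, ha, h⟩, b, hb, by rw [← e, h]⟩
  · rintro ⟨t, h, h'⟩
    obtain ⟨m, h⟩ := h.exec
    obtain ⟨n, h'⟩ := h'.exec
    exact (h.mul h').sem

theorem sem_add : Sem yes (p + q) s t ↔ Sem yes p s t ∨ Sem yes q s t := by
  constructor
  · rintro ⟨w, hw | hw, e⟩
    exacts [Or.inl ⟨w, hw, e⟩, Or.inr ⟨w, hw, e⟩]
  · rintro (⟨w, hw, e⟩ | ⟨w, hw, e⟩)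
    exacts [⟨w, Or.inl hw, e⟩, ⟨w, Or.inr hw, e⟩]

theorem sem_iSup {ι : Sort*} {p : ι → Prog tm} :
    Sem yes (⨆ i, p i) s t ↔ ∃ i, Sem yes (p i) s t := by
  simp only [Sem, Language.mem_iSup]
  tauto

theorem sem_one : Sem yes 1 s t ↔ t = s := by
  constructor
  · rintro ⟨_, rfl, e⟩
    exact (St.toStore_injective (Option.some.inj e)).symm
  · rintro rfl
    exact ⟨[], rfl, rfl⟩

theorem exec_one : Exec yes 1 0 s s := ⟨[], rfl, le_rfl, rfl⟩

theorem sem_kstar : Sem yes p∗ s t ↔ ∃ k, Sem yes (p ^ k) s t := by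
  rw [Language.kstar_eq_iSup_pow, sem_iSup]

theorem Exec.kstar {k : ℕ} (h : Exec yes (p ^ k) n s t) : Exec yes p∗ n s t :=
  h.le (by rw [Language.kstar_eq_iSup_pow]; exact le_iSup (fun i => p ^ i) k)

theorem sem_pow_zero : Sem yes (p ^ 0) s t ↔ t = s := by rw [pow_zero, sem_one]

theorem sem_pow_succ {k : ℕ} :
    Sem yes (p ^ (k + 1)) s u ↔ ∃ t, Sem yes p s t ∧ Sem yes (p ^ k) t u := by
  rw [pow_succ', sem_mul]

/-- The program that consists of one action. -/
def act (a : StackAction tm Reg.Alph) : Prog tm := {[a]}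

theorem isRegular_act (a : StackAction tm Reg.Alph) : (act a).IsRegular :=
  Language.isRegular_singleton _

theorem sem_act {a : StackAction tm Reg.Alph} :
    Sem yes (act a) s t ↔ a.exec yes s.toStore = some t.toStore := by
  constructor
  · rintro ⟨w, rfl, e⟩
    exact e
  · intro e
    exact ⟨[a], rfl, e⟩

theorem Sem.exec_act {a : StackAction tm Reg.Alph} (h : Sem yes (act a) s t) :
    Exec yes (act a) 1 s t :=
  let ⟨w, hw, e⟩ := h
  ⟨w, hw, by rw [show w = [a] from hw]; rfl, e⟩

/-- Put a symbol on a stack. -/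
abbrev push (k : Reg) (a : k.Alph) : Prog tm := act (.push k a)

/-- Remove the given symbol from a stack. -/
abbrev pop (k : Reg) (a : k.Alph) : Prog tm := act (.pop k a)

/-- Test whether a stack is empty. -/
abbrev empty (k : Reg) : Prog tm := act (.empty k)

theorem sem_push {k : Reg} {a : k.Alph} :
    Sem yes (push k a) s t ↔ t = s.set k (a :: s.get k) := by
  rw [sem_act, StackAction.exec, Option.some_inj]
  refine Iff.trans ?_ (St.toStore_injective.eq_iff (a := t))
  rw [St.toStore_set, eq_comm]
  rfl

theorem sem_pop {k : Reg} {a : k.Alph} :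
    Sem yes (pop k a) s t ↔ ∃ l, s.get k = a :: l ∧ t = s.set k l := by
  rw [sem_act, StackAction.exec]
  have h : (∃ l, s.get k = a :: l ∧ t = s.set k l) ↔
      (s.get k).head? = some a ∧ t = s.set k (s.get k).tail := by
    cases s.get k <;> simp
  rw [h, ← St.toStore_injective.eq_iff (a := t), St.toStore_set]
  split_ifs with h'
  · rw [Option.some_inj, eq_comm, and_iff_right (show (s.get k).head? = some a from h')]
    rfl
  · simp only [false_iff, not_and]
    exact fun h => absurd h h'

theorem sem_empty {k : Reg} : Sem yes (empty k) s t ↔ s.get k = [] ∧ t = s := by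
  rw [← List.head?_eq_none_iff, sem_act, StackAction.exec]
  split_ifs with h
  · rw [Option.some_inj, St.toStore_injective.eq_iff, eq_comm]
    exact (and_iff_right (show (s.get k).head? = none from h)).symm
  · simp only [false_iff, not_and]
    exact fun h' => absurd h' h

end Tetris

namespace Tetris

variable {tm : FinTM2} (yes : tm.Γ tm.k₁)

/-! ### Lengths of executions, and loops over the columns -/

/-- Whatever the program does, it can do with `c` actions. -/
def Short (p : Prog tm) (c : ℕ) : Prop := ∀ s t, Sem yes p s t → Exec yes p c s t

/-- The program does not use the counters of columns. -/
def Uncounted (p : Prog tm) : Prop :=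
  ∀ s t, Sem yes p s t → t.width = s.width ∧ t.aux = s.aux ∧
    ∀ a b, Sem yes p { s with width := a, aux := b } { t with width := a, aux := b }

/-- On gameboards of width `n`, the program restores the counters, and whatever it does, it can do
with `c` actions. -/
def Steady (n : ℕ) (p : Prog tm) (c : ℕ) : Prop :=
  ∀ s t, s.width = n → s.aux = 0 → Sem yes p s t → t.width = n ∧ t.aux = 0 ∧ Exec yes p c s t

variable {yes} {p q : Prog tm} {m n c d : ℕ} {s t u : St tm}

theorem short_act (a : StackAction tm Reg.Alph) : Short yes (act a) 1 := fun _ _ h => h.exec_act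

theorem short_one : Short yes (1 : Prog tm) 0 := by
  intro s t h
  rw [sem_one.1 h]
  exact exec_one

theorem Short.mul (hp : Short yes p c) (hq : Short yes q d) : Short yes (p * q) (c + d) := by
  intro s t h
  obtain ⟨u, h₁, h₂⟩ := sem_mul.1 h
  exact (hp _ _ h₁).mul (hq _ _ h₂)

theorem Short.add (hp : Short yes p c) (hq : Short yes q d) : Short yes (p + q) (max c d) := by
  intro s t h
  rcases sem_add.1 h with h | h
  · exact ((hp _ _ h).le le_self_add).mono (le_max_left _ _)
  · exact ((hq _ _ h).le le_add_self).mono (le_max_right _ _)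

theorem Short.iSup {ι : Sort*} {p : ι → Prog tm} (hp : ∀ i, Short yes (p i) c) :
    Short yes (⨆ i, p i) c := by
  intro s t h
  obtain ⟨i, h⟩ := sem_iSup.1 h
  exact (hp i _ _ h).le (le_iSup p i)

theorem Short.pow (hp : Short yes p c) (k : ℕ) : Short yes (p ^ k) (k * c) := by
  induction k with
  | zero => rw [pow_zero, zero_mul]; exact short_one
  | succ k ih => rw [pow_succ', Nat.succ_mul, add_comm]; exact hp.mul ih

theorem uncounted_push {k : Reg} {a : k.Alph} (hw : k ≠ .width) (ha : k ≠ .aux) :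
    Uncounted yes (push k a : Prog tm) := by
  intro s t h
  rw [sem_push] at h
  subst h
  refine ⟨?_, ?_, fun a b => ?_⟩
  · cases k <;> simp_all [St.set]
  · cases k <;> simp_all [St.set]
  · rw [sem_push]
    cases k <;> simp_all [St.set, St.get]

theorem uncounted_pop {k : Reg} {a : k.Alph} (hw : k ≠ .width) (ha : k ≠ .aux) :
    Uncounted yes (pop k a : Prog tm) := by
  intro s t h
  obtain ⟨l, hl, rfl⟩ := sem_pop.1 h
  refine ⟨?_, ?_, fun a b => ?_⟩
  · cases k <;> simp_all [St.set]
  · cases k <;> simp_all [St.set]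
  · rw [sem_pop]
    refine ⟨l, ?_, ?_⟩ <;> cases k <;> simp_all [St.set, St.get]

theorem Uncounted.mul (hp : Uncounted yes p) (hq : Uncounted yes q) : Uncounted yes (p * q) := by
  intro s t h
  obtain ⟨u, h₁, h₂⟩ := sem_mul.1 h
  obtain ⟨w₁, a₁, i₁⟩ := hp _ _ h₁
  obtain ⟨w₂, a₂, i₂⟩ := hq _ _ h₂
  exact ⟨w₂.trans w₁, a₂.trans a₁, fun a b => sem_mul.2 ⟨_, i₁ a b, i₂ a b⟩⟩

theorem Uncounted.iSup {ι : Sort*} {p : ι → Prog tm} (hp : ∀ i, Uncounted yes (p i)) :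
    Uncounted yes (⨆ i, p i) := by
  intro s t h
  obtain ⟨i, h⟩ := sem_iSup.1 h
  obtain ⟨w, a, j⟩ := hp i _ _ h
  exact ⟨w, a, fun a b => sem_iSup.2 ⟨i, j a b⟩⟩

theorem uncounted_one : Uncounted yes (1 : Prog tm) := by
  intro s t h
  rw [sem_one.1 h]
  exact ⟨rfl, rfl, fun a b => sem_one.2 rfl⟩

theorem Uncounted.pow (hp : Uncounted yes p) (k : ℕ) : Uncounted yes (p ^ k) := by
  induction k with
  | zero => rw [pow_zero]; exact uncounted_one
  | succ k ih => rw [pow_succ']; exact hp.mul ih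

theorem Uncounted.steady (hp : Uncounted yes p) (hs : Short yes p c) (n : ℕ) :
    Steady yes n p c := by
  intro s t hw ha h
  obtain ⟨hw', ha', -⟩ := hp s t h
  exact ⟨hw'.trans hw, ha'.trans ha, hs s t h⟩

theorem Steady.mul (hp : Steady yes n p c) (hq : Steady yes n q d) :
    Steady yes n (p * q) (c + d) := by
  intro s t hw ha h
  obtain ⟨u, h₁, h₂⟩ := sem_mul.1 h
  obtain ⟨w₁, a₁, e₁⟩ := hp _ _ hw ha h₁
  obtain ⟨w₂, a₂, e₂⟩ := hq _ _ w₁ a₁ h₂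
  exact ⟨w₂, a₂, e₁.mul e₂⟩

theorem Steady.mono (hp : Steady yes n p c) (hcd : c ≤ d) : Steady yes n p d := by
  intro s t hw ha h
  obtain ⟨w, a, e⟩ := hp _ _ hw ha h
  exact ⟨w, a, e.mono hcd⟩

theorem Steady.add (hp : Steady yes n p c) (hq : Steady yes n q c) : Steady yes n (p + q) c := by
  intro s t hw ha h
  rcases sem_add.1 h with h | h
  · obtain ⟨w, a, e⟩ := hp _ _ hw ha h
    exact ⟨w, a, e.le le_self_add⟩
  · obtain ⟨w, a, e⟩ := hq _ _ hw ha h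
    exact ⟨w, a, e.le le_add_self⟩

theorem Steady.iSup {ι : Sort*} {p : ι → Prog tm} (hp : ∀ i, Steady yes n (p i) c) :
    Steady yes n (⨆ i, p i) c := by
  intro s t hw ha h
  obtain ⟨i, h⟩ := sem_iSup.1 h
  obtain ⟨w, a, e⟩ := hp i _ _ hw ha h
  exact ⟨w, a, e.le (le_iSup p i)⟩

theorem steady_one : Steady yes n (1 : Prog tm) 0 := uncounted_one.steady short_one n

theorem Steady.pow (hp : Steady yes n p c) (k : ℕ) : Steady yes n (p ^ k) (k * c) := by
  induction k with
  | zero => rw [pow_zero, zero_mul]; exact steady_one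
  | succ k ih => rw [pow_succ', Nat.succ_mul, add_comm]; exact hp.mul ih

/-- Count a column. -/
def tick : Prog tm := pop .width () * push .aux ()

/-- Check that all columns were counted, and reset the counters. -/
def reset : Prog tm := empty .width * (pop .aux () * push .width ())∗ * empty .aux

/-- Run a program once for each column. -/
def forWidth (q : Prog tm) : Prog tm := (tick * q)∗ * reset

theorem sem_tick :
    Sem yes tick s t ↔ 0 < s.width ∧ t = { s with width := s.width - 1, aux := s.aux + 1 } := by
  simp only [tick, sem_mul, sem_pop, sem_push]
  constructor
  · rintro ⟨_, ⟨l, hl, rfl⟩, rfl⟩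
    have h := congrArg List.length hl
    simp only [St.get, List.length_replicate, List.length_cons] at h
    simp [St.set, St.get, h]
  · rintro ⟨h, rfl⟩
    obtain ⟨k, hk⟩ := Nat.exists_eq_add_of_le' h
    refine ⟨_, ⟨List.replicate k (), ?_, rfl⟩, ?_⟩
    · simp [St.get, hk, List.replicate_succ]
    · simp [St.set, St.get, hk]

theorem short_tick : Short yes (tick : Prog tm) 2 := (short_act _).mul (short_act _)

theorem sem_untick_pow {k : ℕ} : Sem yes ((pop .aux () * push .width ()) ^ k) s t ↔
    k ≤ s.aux ∧ t = { s with width := s.width + k, aux := s.aux - k } := by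
  induction k generalizing s with
  | zero => simp [sem_one]
  | succ k ih =>
    rw [sem_pow_succ]
    simp only [ih]
    simp only [sem_mul, sem_pop, sem_push]
    constructor
    · rintro ⟨_, ⟨_, ⟨l, hl, rfl⟩, rfl⟩, hk, rfl⟩
      have h := congrArg List.length hl
      simp only [St.get, List.length_replicate, List.length_cons] at h
      simp only [St.set] at hk
      refine ⟨by omega, ?_⟩
      ext1 <;> simp [St.set, St.get] <;> omega
    · rintro ⟨h, rfl⟩
      obtain ⟨j, hj⟩ := Nat.exists_eq_add_of_le' (Nat.lt_of_lt_of_le (Nat.succ_pos k) h)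
      refine ⟨_, ⟨_, ⟨List.replicate j (), ?_, rfl⟩, rfl⟩, ?_, ?_⟩
      · simp [St.get, hj, List.replicate_succ]
      · simp [St.set]; omega
      · ext1 <;> simp [St.set, St.get] <;> omega

theorem sem_reset :
    Sem yes reset s t ↔ s.width = 0 ∧ t = { s with width := s.aux, aux := 0 } := by
  simp only [reset, sem_mul, sem_empty, sem_kstar, sem_untick_pow]
  constructor
  · rintro ⟨_, ⟨_, ⟨hw, rfl⟩, k, hk, rfl⟩, ha, rfl⟩
    simp only [St.get, List.replicate_eq_nil_iff] at hw ha
    refine ⟨hw, ?_⟩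
    ext1 <;> simp <;> omega
  · rintro ⟨hw, rfl⟩
    refine ⟨_, ⟨_, ⟨?_, rfl⟩, s.aux, le_rfl, rfl⟩, ?_, ?_⟩
    · simp [St.get, hw]
    · simp [St.get]
    · simp [hw]

theorem exec_reset (h : Sem yes reset s t) (n : ℕ) (hn : s.aux ≤ n) :
    Exec yes reset (2 * n + 2) s t := by
  obtain ⟨hw, rfl⟩ := sem_reset.1 h
  have h₁ : Exec yes (empty .width) 1 s s :=
    Sem.exec_act (sem_empty.2 ⟨by simp [St.get, hw], rfl⟩)
  have h₂ : Sem yes ((pop .aux () * push .width ()) ^ s.aux) s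
      { s with width := s.aux, aux := 0 } := sem_untick_pow.2 ⟨le_rfl, by simp [hw]⟩
  have h₃ : Exec yes (empty .aux) 1 { s with width := s.aux, aux := 0 }
      { s with width := s.aux, aux := 0 } := Sem.exec_act (sem_empty.2 ⟨by simp [St.get], rfl⟩)
  exact ((h₁.mul (((short_act _).mul (short_act _)).pow _ _ _ h₂).kstar).mul h₃).mono (by omega)

/-- A program that ignores the counters behaves alike for all their values, so the ticks can be
separated from the copies of `q`. This is what the last clause of `Uncounted` is for. -/
theorem sem_tick_mul_pow (hq : Uncounted yes q) {k : ℕ} : Sem yes ((tick * q) ^ k) s t ↔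
    k ≤ s.width ∧ ∃ u, Sem yes (q ^ k) s u ∧
      t = { u with width := s.width - k, aux := s.aux + k } := by
  induction k generalizing s with
  | zero =>
    simp only [sem_pow_zero, zero_le, true_and, exists_eq_left, Nat.sub_zero, Nat.add_zero]
  | succ k ih =>
    simp only [sem_pow_succ, sem_mul, sem_tick, ih]
    constructor
    · rintro ⟨s₁, ⟨_, ⟨hw, rfl⟩, h₁⟩, hk, u, h₂, rfl⟩
      obtain ⟨hw₁, ha₁, h₁'⟩ := hq _ _ h₁
      simp only at hw₁ ha₁
      refine ⟨by omega, { u with width := s.width, aux := s.aux }, ⟨_, h₁' s.width s.aux,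
        ((hq.pow k) _ _ h₂).2.2 _ _⟩, ?_⟩
      ext1 <;> simp <;> omega
    · rintro ⟨hk, u, ⟨s₁, h₁, h₂⟩, rfl⟩
      refine ⟨{ s₁ with width := s.width - 1, aux := s.aux + 1 },
        ⟨_, ⟨by omega, rfl⟩, (hq _ _ h₁).2.2 _ _⟩, ?_, { u with width := _, aux := _ },
        ((hq.pow k) _ _ h₂).2.2 _ _, ?_⟩
      · simp only; omega
      · ext1 <;> simp <;> omega

/-- The star may stop anywhere, but `reset` fails unless the counter `width` has been used up; this
leaves exactly `s.width` iterations. Afterwards the counters are back to their old values. -/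
theorem sem_forWidth (hq : Uncounted yes q) (ha : s.aux = 0) :
    Sem yes (forWidth q) s t ↔ Sem yes (q ^ s.width) s t := by
  simp only [forWidth, sem_mul (p := (tick * q)∗), sem_kstar, sem_tick_mul_pow hq, sem_reset]
  constructor
  · rintro ⟨_, ⟨k, hk, u, h, rfl⟩, hw, rfl⟩
    obtain ⟨hw', ha', -⟩ := (hq.pow k) _ _ h
    simp only at hw
    obtain rfl : k = s.width := by omega
    convert h using 1
    ext1 <;> simp <;> omega
  · intro h
    obtain ⟨hw', ha', -⟩ := (hq.pow _) _ _ h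
    refine ⟨_, ⟨s.width, le_rfl, t, h, rfl⟩, by simp, ?_⟩
    ext1 <;> simp <;> omega

theorem steady_forWidth (hq : Uncounted yes q) (hc : Short yes q c) :
    Steady yes n (forWidth q) (n * (c + 4) + 2) := by
  rintro s t rfl ha h
  obtain ⟨hw', ha', -⟩ := (hq.pow _) _ _ ((sem_forWidth hq ha).1 h)
  refine ⟨hw', ha'.trans ha, ?_⟩
  obtain ⟨u, h₁, h₂⟩ := sem_mul.1 h
  obtain ⟨k, h₁⟩ := sem_kstar.1 h₁
  obtain ⟨hk, v, hv, rfl⟩ := (sem_tick_mul_pow hq).1 h₁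
  refine (((short_tick.mul hc).pow _ _ _ h₁).kstar.mul
    (exec_reset h₂ s.width (by simpa [ha] using hk))).mono ?_
  nlinarith

end Tetris

namespace Tetris

variable {tm : FinTM2} {yes : tm.Γ tm.k₁} {p q : Prog tm} {m n c d : ℕ} {s t u : St tm}

/-! ### The tape -/

/-- The store with tape contents `T` and the head at index `i`. -/
def St.tape (s : St tm) (T : List (Option Bool)) (i : ℕ) : St tm :=
  { s with left := (T.take i).reverse, right := T.drop i }

/-- Move the head to the right. -/
def moveRight : Prog tm := ⨆ a, pop .right a * push .left a

/-- Move the head to the left. -/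
def moveLeft : Prog tm := ⨆ a, pop .left a * push .right a

/-- The current gridsquare satisfies `P`. -/
def test (P : Option Bool → Prop) : Prog tm :=
  ⨆ a : { a // P a }, pop .right a.1 * push .right a.1

/-- Overwrite the current gridsquare. -/
def overwrite (b : Option Bool) : Prog tm := ⨆ a, pop .right a * push .right b

/-- Move the head by `k` gridsquares. -/
def moveCols (k : ℤ) : Prog tm := moveRight ^ k.toNat * moveLeft ^ (-k).toNat

/-- Move the head by `k` rows, on a tape with `d` border squares per row. -/
def moveRows (d : ℕ) (k : ℤ) : Prog tm :=
  (forWidth moveRight * moveRight ^ d) ^ k.toNat * (forWidth moveLeft * moveLeft ^ d) ^ (-k).toNat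

/-- Move the head by an offset. -/
def shift (d : ℕ) (v : ℤ × ℤ) : Prog tm := moveRows d v.1 * moveCols v.2

/-- The gridsquare at offset `v` satisfies `P`. -/
def look (d : ℕ) (v : ℤ × ℤ) (P : Option Bool → Prop) : Prog tm :=
  shift d v * test P * shift d (-v)

/-- Overwrite the gridsquare at offset `v`. -/
def write (d : ℕ) (v : ℤ × ℤ) (b : Option Bool) : Prog tm :=
  shift d v * overwrite b * shift d (-v)

theorem uncounted_move (k l : Reg) (e : k.Alph = l.Alph) (hk : k ≠ .width) (hk' : k ≠ .aux)
    (hl : l ≠ .width) (hl' : l ≠ .aux) :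
    Uncounted yes (⨆ a : k.Alph, (pop k a * push l (cast e a) : Prog tm)) :=
  .iSup fun _ => (uncounted_pop hk hk').mul (uncounted_push hl hl')

theorem uncounted_moveRight : Uncounted yes (moveRight : Prog tm) :=
  uncounted_move .right .left rfl (by simp) (by simp) (by simp) (by simp)

theorem uncounted_moveLeft : Uncounted yes (moveLeft : Prog tm) :=
  uncounted_move .left .right rfl (by simp) (by simp) (by simp) (by simp)

theorem short_moveRight : Short yes (moveRight : Prog tm) 2 :=
  .iSup fun _ => (short_act _).mul (short_act _)

theorem short_moveLeft : Short yes (moveLeft : Prog tm) 2 :=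
  .iSup fun _ => (short_act _).mul (short_act _)

theorem sem_moveRight : Sem yes moveRight s t ↔
    ∃ a r, s.right = a :: r ∧ t = { s with left := a :: s.left, right := r } := by
  simp only [moveRight, sem_iSup, sem_mul, sem_pop, sem_push]
  constructor
  · rintro ⟨a, _, ⟨r, h, rfl⟩, rfl⟩
    exact ⟨a, r, h, rfl⟩
  · rintro ⟨a, r, h, rfl⟩
    exact ⟨a, _, ⟨r, h, rfl⟩, rfl⟩

theorem sem_moveLeft : Sem yes moveLeft s t ↔
    ∃ a l, s.left = a :: l ∧ t = { s with left := l, right := a :: s.right } := by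
  simp only [moveLeft, sem_iSup, sem_mul, sem_pop, sem_push]
  constructor
  · rintro ⟨a, _, ⟨r, h, rfl⟩, rfl⟩
    exact ⟨a, r, h, rfl⟩
  · rintro ⟨a, r, h, rfl⟩
    exact ⟨a, _, ⟨r, h, rfl⟩, rfl⟩

variable {T : List (Option Bool)} {i j k : ℕ}

theorem reverse_take_succ (hi : i < T.length) :
    (T.take (i + 1)).reverse = T[i] :: (T.take i).reverse := by
  rw [List.take_succ_eq_append_getElem hi, List.reverse_append]
  rfl

theorem sem_moveRight_tape :
    Sem yes moveRight (s.tape T i) t ↔ i < T.length ∧ t = s.tape T (i + 1) := by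
  rw [sem_moveRight]
  change (∃ a r, T.drop i = a :: r ∧
    t = { s with left := a :: (T.take i).reverse, right := r }) ↔ _
  constructor
  · rintro ⟨a, r, h, rfl⟩
    have hi : i < T.length := by
      by_contra hi
      rw [List.drop_eq_nil_of_le (not_lt.1 hi)] at h
      cases h
    rw [List.drop_eq_getElem_cons hi] at h
    obtain ⟨rfl, rfl⟩ := List.cons.inj h
    exact ⟨hi, by rw [St.tape, reverse_take_succ hi]⟩
  · rintro ⟨hi, rfl⟩
    exact ⟨T[i], T.drop (i + 1), List.drop_eq_getElem_cons hi,
      by rw [St.tape, reverse_take_succ hi]⟩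

/-- For an index beyond the end, `take` and `drop` would show the head at the end of the tape and
the index would be meaningless; hence the bound on `i`. -/
theorem sem_moveLeft_tape (hi : i ≤ T.length) :
    Sem yes moveLeft (s.tape T i) t ↔ 0 < i ∧ t = s.tape T (i - 1) := by
  rw [sem_moveLeft]
  cases i with
  | zero => simp [St.tape]
  | succ i =>
    have hi' : i < T.length := hi
    have hl := reverse_take_succ hi'
    constructor
    · rintro ⟨a, r, h, rfl⟩
      simp only [St.tape, hl, List.cons.injEq] at h
      obtain ⟨rfl, rfl⟩ := h
      simp [St.tape]
    · rintro ⟨-, rfl⟩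
      exact ⟨T[i], (T.take i).reverse, hl, by simp [St.tape]⟩

theorem sem_moveRight_pow (hi : i ≤ T.length) :
    Sem yes (moveRight ^ k) (s.tape T i) t ↔ i + k ≤ T.length ∧ t = s.tape T (i + k) := by
  induction k generalizing i with
  | zero => simp [sem_one, hi]
  | succ k ih =>
    simp only [sem_pow_succ, sem_moveRight_tape]
    constructor
    · rintro ⟨_, ⟨h, rfl⟩, h'⟩
      rw [ih h] at h'
      rwa [add_comm k, ← add_assoc]
    · rintro ⟨h, rfl⟩
      refine ⟨_, ⟨by omega, rfl⟩, (ih (by omega)).2 ⟨by omega, ?_⟩⟩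
      rw [add_comm k, ← add_assoc]

theorem sem_moveLeft_pow (hi : i ≤ T.length) :
    Sem yes (moveLeft ^ k) (s.tape T i) t ↔ k ≤ i ∧ t = s.tape T (i - k) := by
  induction k generalizing i with
  | zero => simp [sem_one]
  | succ k ih =>
    simp only [sem_pow_succ, sem_moveLeft_tape hi]
    constructor
    · rintro ⟨_, ⟨h, rfl⟩, h'⟩
      rw [ih (by omega)] at h'
      exact ⟨by omega, by rw [h'.2]; congr 1; omega⟩
    · rintro ⟨h, rfl⟩
      refine ⟨_, ⟨by omega, rfl⟩, (ih (by omega)).2 ⟨by omega, ?_⟩⟩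
      congr 1; omega

theorem St.tape_width : (s.tape T i).width = s.width := rfl

theorem St.tape_aux : (s.tape T i).aux = s.aux := rfl

theorem sem_rowRight_pow (ha : s.aux = 0) (hi : i ≤ T.length) :
    Sem yes ((forWidth moveRight * moveRight ^ d) ^ k) (s.tape T i) t ↔
      i + k * (s.width + d) ≤ T.length ∧ t = s.tape T (i + k * (s.width + d)) := by
  induction k generalizing i with
  | zero => simp [sem_one, hi]
  | succ k ih =>
    have e : i + (k + 1) * (s.width + d) = i + s.width + d + k * (s.width + d) := by ring
    simp only [sem_pow_succ, sem_mul, sem_forWidth uncounted_moveRight ((s.tape_aux).trans ha),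
      St.tape_width, sem_moveRight_pow hi]
    rw [e]
    constructor
    · rintro ⟨_, ⟨_, ⟨h₁, rfl⟩, h₂⟩, h₃⟩
      obtain ⟨h₄, rfl⟩ := (sem_moveRight_pow h₁).1 h₂
      exact (ih h₄).1 h₃
    · rintro ⟨h, rfl⟩
      have h₁ : i + s.width ≤ T.length := by omega
      have h₂ : i + s.width + d ≤ T.length := by omega
      exact ⟨_, ⟨_, ⟨h₁, rfl⟩, (sem_moveRight_pow h₁).2 ⟨h₂, rfl⟩⟩, (ih h₂).2 ⟨h, rfl⟩⟩

theorem sem_rowLeft_pow (ha : s.aux = 0) (hi : i ≤ T.length) :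
    Sem yes ((forWidth moveLeft * moveLeft ^ d) ^ k) (s.tape T i) t ↔
      k * (s.width + d) ≤ i ∧ t = s.tape T (i - k * (s.width + d)) := by
  induction k generalizing i with
  | zero => simp [sem_one]
  | succ k ih =>
    have e : (k + 1) * (s.width + d) = s.width + d + k * (s.width + d) := by ring
    simp only [sem_pow_succ, sem_mul, sem_forWidth uncounted_moveLeft ((s.tape_aux).trans ha),
      St.tape_width, sem_moveLeft_pow hi]
    rw [e]
    constructor
    · rintro ⟨_, ⟨_, ⟨h₁, rfl⟩, h₂⟩, h₃⟩
      obtain ⟨h₂, rfl⟩ := (sem_moveLeft_pow (by omega)).1 h₂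
      obtain ⟨h₃, rfl⟩ := (ih (by omega)).1 h₃
      exact ⟨by omega, by congr 1; omega⟩
    · rintro ⟨h, rfl⟩
      refine ⟨_, ⟨_, ⟨by omega, rfl⟩, (sem_moveLeft_pow (by omega)).2 ⟨by omega, rfl⟩⟩,
        (ih (by omega)).2 ⟨by omega, ?_⟩⟩
      congr 1; omega

/-- One of `k.toNat` and `(-k).toNat` is zero, so there is no detour, and only the end point has to
lie on the tape. -/
theorem sem_moveCols {k : ℤ} (hi : i ≤ T.length) : Sem yes (moveCols k) (s.tape T i) t ↔
    ∃ j : ℕ, (j : ℤ) = i + k ∧ j ≤ T.length ∧ t = s.tape T j := by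
  rw [moveCols, sem_mul]
  simp only [sem_moveRight_pow hi]
  constructor
  · rintro ⟨_, ⟨h, rfl⟩, h'⟩
    obtain ⟨h', rfl⟩ := (sem_moveLeft_pow h).1 h'
    exact ⟨_, by omega, by omega, rfl⟩
  · rintro ⟨j, hj, hjT, rfl⟩
    have h : i + k.toNat ≤ T.length := by omega
    refine ⟨_, ⟨h, rfl⟩, (sem_moveLeft_pow h).2 ⟨by omega, ?_⟩⟩
    congr 1; omega

theorem sem_moveRows {k : ℤ} (ha : s.aux = 0) (hi : i ≤ T.length) :
    Sem yes (moveRows d k) (s.tape T i) t ↔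
      ∃ j : ℕ, (j : ℤ) = i + k * (s.width + d) ∧ j ≤ T.length ∧ t = s.tape T j := by
  rw [moveRows, sem_mul]
  simp only [sem_rowRight_pow ha hi]
  obtain ⟨k, rfl | rfl⟩ := k.eq_nat_or_neg
  · simp only [Int.toNat_natCast, Int.toNat_neg_natCast, sem_pow_zero]
    constructor
    · rintro ⟨_, ⟨h, rfl⟩, rfl⟩
      exact ⟨_, by push_cast; ring, h, rfl⟩
    · rintro ⟨j, hj, hjT, rfl⟩
      obtain rfl : j = i + k * (s.width + d) := by exact_mod_cast hj
      exact ⟨_, ⟨hjT, rfl⟩, rfl⟩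
  · simp only [neg_neg, Int.toNat_natCast, Int.toNat_neg_natCast, zero_mul, add_zero]
    constructor
    · rintro ⟨_, ⟨h, rfl⟩, h'⟩
      obtain ⟨hk, rfl⟩ := (sem_rowLeft_pow ha h).1 h'
      refine ⟨_, ?_, by omega, rfl⟩
      rw [Nat.cast_sub hk]; push_cast; ring
    · rintro ⟨j, hj, hjT, rfl⟩
      have hj' : i = j + k * (s.width + d) := by zify; linarith
      refine ⟨_, ⟨hi, rfl⟩, (sem_rowLeft_pow ha hi).2 ⟨by omega, ?_⟩⟩
      congr 1; omega

/-- The index that the offset `v` leads to from index `i`. -/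
def target (w : ℕ) (i : ℕ) (v : ℤ × ℤ) : ℤ := i + v.1 * w + v.2

/-- Row moves and column moves along the offset `v` from index `i` stay on the tape. -/
def Within (w len i : ℕ) (v : ℤ × ℤ) : Prop :=
  0 ≤ target w i (v.1, 0) ∧ target w i (v.1, 0) ≤ len ∧ 0 ≤ target w i v ∧ target w i v ≤ len ∧
    0 ≤ target w i (0, v.2) ∧ target w i (0, v.2) ≤ len

theorem sem_shift {v : ℤ × ℤ} (ha : s.aux = 0) (hi : i ≤ T.length)
    (hv : Within (s.width + d) T.length i v) :
    Sem yes (shift d v) (s.tape T i) t ↔ t = s.tape T (target (s.width + d) i v).toNat := by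
  obtain ⟨h₁, h₂, h₃, h₄, -, -⟩ := hv
  simp only [target, Nat.cast_add] at h₁ h₂ h₃ h₄ ⊢
  rw [shift, sem_mul]
  simp only [sem_moveRows ha hi]
  constructor
  · rintro ⟨_, ⟨j, hj, hjT, rfl⟩, h⟩
    obtain ⟨j', hj', -, rfl⟩ := (sem_moveCols hjT).1 h
    congr 1; omega
  · rintro rfl
    have hj : (i + v.1 * (s.width + d) : ℤ).toNat ≤ T.length := by omega
    exact ⟨_, ⟨(i + v.1 * (s.width + d) : ℤ).toNat, by omega, hj, rfl⟩,
      (sem_moveCols hj).2 ⟨_, by omega, by omega, rfl⟩⟩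

theorem target_neg {w : ℕ} {v : ℤ × ℤ} (h : 0 ≤ target w i v) :
    target w (target w i v).toNat (-v) = i := by
  rw [target, Int.toNat_of_nonneg h, target]
  simp only [Prod.fst_neg, Prod.snd_neg]
  ring

/-- The way back undoes the rows first, so its corner is reached by the offset `(0, v.2)` from the
old index. The last two bounds in `Within` are there for this corner. -/
theorem Within.neg {w len : ℕ} {v : ℤ × ℤ} (hi : i ≤ len) (hv : Within w len i v) :
    Within w len (target w i v).toNat (-v) := by
  obtain ⟨h₁, h₂, h₃, h₄, h₅, h₆⟩ := hv
  refine ⟨?_, ?_, by rw [target_neg h₃]; positivity, by rw [target_neg h₃]; exact_mod_cast hi,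
    ?_, ?_⟩
  all_goals
    rw [target, Int.toNat_of_nonneg h₃]
    simp only [target, Prod.fst_neg, Prod.snd_neg] at *
    linarith

theorem sem_test {P : Option Bool → Prop} :
    Sem yes (test P) (s.tape T i) t ↔ (∃ a, T[i]? = some a ∧ P a) ∧ t = s.tape T i := by
  have hd : (s.tape T i).right = T.drop i := rfl
  have h0 : T[i]? = (T.drop i)[0]? := by simp
  simp only [test, sem_iSup, sem_mul, sem_pop, sem_push, St.get, hd, h0]
  constructor
  · rintro ⟨⟨a, ha⟩, _, ⟨r, h, rfl⟩, rfl⟩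
    refine ⟨⟨a, by rw [h]; rfl, ha⟩, ?_⟩
    simp [St.tape, St.set, h]
  · rintro ⟨⟨a, h, ha⟩, rfl⟩
    cases hr : T.drop i with
    | nil => simp [hr] at h
    | cons b r =>
      obtain rfl : b = a := by simpa [hr] using h
      exact ⟨⟨b, ha⟩, _, ⟨r, rfl, rfl⟩, by simp [St.tape, St.set, hr]⟩

theorem sem_overwrite {b : Option Bool} :
    Sem yes (overwrite b) (s.tape T i) t ↔ i < T.length ∧ t = s.tape (T.set i b) i := by
  simp only [overwrite, sem_iSup, sem_mul, sem_pop, sem_push]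
  have key : i < T.length → ∃ a r, T.drop i = a :: r ∧ (T.set i b).drop i = b :: r := by
    intro hi
    refine ⟨T[i], T.drop (i + 1), by simp, ?_⟩
    rw [List.drop_eq_getElem_cons (by simpa using hi), List.getElem_set_self,
      List.drop_set_of_lt (Nat.lt_succ_self i)]
  constructor
  · rintro ⟨a, _, ⟨r, h, rfl⟩, rfl⟩
    have h : T.drop i = a :: r := h
    have hi : i < T.length := by
      by_contra hi
      simp [List.drop_eq_nil_of_le (not_lt.1 hi)] at h
    obtain ⟨a', r', h₁, h₂⟩ := key hi
    rw [h] at h₁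
    obtain ⟨rfl, rfl⟩ := List.cons.inj h₁
    refine ⟨hi, ?_⟩
    simp [St.tape, St.set, St.get, h₂, List.take_set_of_le]
  · rintro ⟨hi, rfl⟩
    obtain ⟨a, r, h₁, h₂⟩ := key hi
    exact ⟨a, _, ⟨r, h₁, rfl⟩, by simp [St.tape, St.set, St.get, h₂, List.take_set_of_le]⟩

/-- The head comes back to where it was, so inspections of several gridsquares can be composed
without bookkeeping. -/
theorem sem_look {v : ℤ × ℤ} {P : Option Bool → Prop} (ha : s.aux = 0) (hi : i ≤ T.length)
    (hv : Within (s.width + d) T.length i v) :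
    Sem yes (look d v P) (s.tape T i) t ↔
      (∃ a, T[(target (s.width + d) i v).toNat]? = some a ∧ P a) ∧ t = s.tape T i := by
  have hj : (target (s.width + d) i v).toNat ≤ T.length := by have := hv.2.2.2.1; omega
  simp only [look, sem_mul, sem_shift ha hi hv, exists_eq_left, sem_test]
  constructor
  · rintro ⟨_, ⟨h, rfl⟩, h'⟩
    rw [sem_shift ha hj (hv.neg hi), target_neg hv.2.2.1] at h'
    exact ⟨h, h'⟩
  · rintro ⟨h, rfl⟩
    refine ⟨_, ⟨h, rfl⟩, ?_⟩
    rw [sem_shift ha hj (hv.neg hi), target_neg hv.2.2.1]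
    rfl

theorem sem_write {v : ℤ × ℤ} {b : Option Bool} (ha : s.aux = 0) (hi : i ≤ T.length)
    (hv : Within (s.width + d) T.length i v)
    (hlt : target (s.width + d) i v < T.length) :
    Sem yes (write d v b) (s.tape T i) t ↔
      t = s.tape (T.set (target (s.width + d) i v).toNat b) i := by
  have hlen (j : ℕ) : (T.set j b).length = T.length := List.length_set
  have h0 := hv.2.2.1
  have hj : (target (s.width + d) i v).toNat < T.length := by omega
  have hn := hv.neg hi
  rw [← hlen (target (s.width + d) i v).toNat] at hn
  simp only [write, sem_mul, sem_shift ha hi hv, exists_eq_left, sem_overwrite, hj, true_and]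
  rw [sem_shift ha (by rw [hlen]; exact hj.le) hn, target_neg h0]
  rfl

/-- A bound on the length of a move by the offset `v`. -/
def shiftCost (d n : ℕ) (v : ℤ × ℤ) : ℕ :=
  v.1.natAbs * (n * 6 + 2 + d * 2) + v.2.natAbs * 2

theorem steady_moveRows (k : ℤ) :
    Steady yes n (moveRows d k : Prog tm) (k.natAbs * (n * 6 + 2 + d * 2)) := by
  have h₁ := (((steady_forWidth uncounted_moveRight short_moveRight).mul
    ((uncounted_moveRight.steady short_moveRight n).pow d)).pow k.toNat).mul
      (((steady_forWidth uncounted_moveLeft short_moveLeft).mul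
    ((uncounted_moveLeft.steady (yes := yes) (tm := tm) short_moveLeft n).pow d)).pow (-k).toNat)
  refine h₁.mono (le_of_eq ?_)
  rw [← add_mul]
  congr 1
  omega

theorem steady_moveCols (k : ℤ) : Steady yes n (moveCols k : Prog tm) (k.natAbs * 2) := by
  have h₁ := ((uncounted_moveRight.steady (yes := yes) (tm := tm) short_moveRight n).pow
    k.toNat).mul ((uncounted_moveLeft.steady short_moveLeft n).pow (-k).toNat)
  refine h₁.mono (le_of_eq ?_)
  rw [← add_mul]
  congr 1
  omega

theorem steady_shift (v : ℤ × ℤ) : Steady yes n (shift d v : Prog tm) (shiftCost d n v) :=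
  (steady_moveRows v.1).mul (steady_moveCols v.2)

theorem steady_look (v : ℤ × ℤ) (P : Option Bool → Prop) :
    Steady yes n (look d v P : Prog tm) (2 * shiftCost d n v + 2) := by
  have h : Uncounted yes (test P : Prog tm) :=
    .iSup fun _ => (uncounted_pop (by simp) (by simp)).mul (uncounted_push (by simp) (by simp))
  have h' : Short yes (test P : Prog tm) 2 := .iSup fun _ => (short_act _).mul (short_act _)
  refine (((steady_shift v).mul (h.steady h' n)).mul (steady_shift (-v))).mono (le_of_eq ?_)
  simp only [shiftCost, Prod.fst_neg, Prod.snd_neg, Int.natAbs_neg]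
  ring

theorem steady_write (v : ℤ × ℤ) (b : Option Bool) :
    Steady yes n (write d v b : Prog tm) (2 * shiftCost d n v + 2) := by
  have h : Uncounted yes (overwrite b : Prog tm) :=
    .iSup fun _ => (uncounted_pop (by simp) (by simp)).mul (uncounted_push (by simp) (by simp))
  have h' : Short yes (overwrite b : Prog tm) 2 := .iSup fun _ => (short_act _).mul (short_act _)
  refine (((steady_shift v).mul (h.steady h' n)).mul (steady_shift (-v))).mono (le_of_eq ?_)
  simp only [shiftCost, Prod.fst_neg, Prod.snd_neg, Int.natAbs_neg]
  ring

end Tetris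

theorem List.getElem?_flatten_of_uniform {α : Type*} {w : ℕ} (L : List (List α))
    (hL : ∀ l ∈ L, l.length = w) (a : ℕ) {b : ℕ} (hb : b < w) :
    L.flatten[a * w + b]? = L[a]?.bind (·[b]?) := by
  induction L generalizing a with
  | nil => simp
  | cons l L ih =>
    rw [List.forall_mem_cons] at hL
    cases a with
    | zero =>
      rw [zero_mul, zero_add, List.flatten_cons, List.getElem?_append_left (by omega)]
      rfl
    | succ a =>
      rw [List.flatten_cons, List.getElem?_append_right (by rw [hL.1]; nlinarith), hL.1,
        show (a + 1) * w + b - w = a * w + b by rw [Nat.succ_mul]; omega, ih hL.2]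
      rfl

namespace Tetris

/-! ### The gameboard on the tape -/

/-- A row, followed by `d` border squares. -/
def padRow (d : ℕ) (r : List Bool) : List (Option Bool) := r.map some ++ List.replicate d none

/-- A border of `d` rows below or above a gameboard of width `n`. -/
def padding (d n : ℕ) : List (Option Bool) := List.replicate (d * (n + d)) none

namespace Gameboard

variable (B : Gameboard) (d : ℕ)

/-- The tape that represents the gameboard. -/
def cells : List (Option Bool) :=
  padding d B.width ++ (B.rows.map (padRow d)).flatten ++ padding d B.width

/-- The gridsquare in row `a` and column `b`, counted from `0`. -/
def square (a b : ℕ) : Option Bool := (B.rows[a]?).bind (·[b]?)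

/-- The index of a gridsquare on the tape. -/
def index (s : ℤ × ℤ) : ℤ := (d + s.1 - 1) * (B.width + d : ℕ) + (s.2 - 1)

theorem square_eq_none_of_height_le {a b : ℕ} (h : B.height ≤ a) : B.square a b = none := by
  rw [square, List.getElem?_eq_none h]
  rfl

theorem square_eq_none_of_width_le {a b : ℕ} (h : B.width ≤ b) : B.square a b = none := by
  rw [square]
  cases hr : B.rows[a]? with
  | none => rfl
  | some r =>
    refine List.getElem?_eq_none ?_
    rw [B.length_of_mem r (List.mem_of_getElem? hr)]
    exact h

theorem filled_iff {s : ℤ × ℤ} :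
    B.Filled s ↔ s.1 < 1 ∨ s.2 < 1 ∨ B.square (s.1 - 1).toNat (s.2 - 1).toNat ≠ some false :=
  Iff.rfl

theorem getElem?_rows_padRow (a : ℕ) {b : ℕ} (ha : a < B.height) (hb : b < B.width + d) :
    (B.rows.map (padRow d)).flatten[a * (B.width + d) + b]? = some (B.square a b) := by
  rw [List.getElem?_flatten_of_uniform _ _ _ hb]
  · rw [List.getElem?_map, square, List.getElem?_eq_getElem ha]
    have hl := B.length_of_mem _ (List.getElem_mem ha)
    simp only [Option.map_some, Option.bind_some, padRow]
    by_cases hb' : b < B.width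
    · rw [List.getElem?_append_left (by simpa [hl] using hb')]
      simp [hl, hb']
    · rw [List.getElem?_append_right (by simpa [hl] using hb')]
      simp only [hl, hb', List.length_map, List.getElem?_replicate, getElem?_neg,
        not_false_eq_true]
      rw [if_pos (by omega)]
  · simp only [List.mem_map]
    rintro _ ⟨r, hr, rfl⟩
    simp [padRow, B.length_of_mem r hr]

theorem length_rows_padRow :
    (B.rows.map (padRow d)).flatten.length = B.height * (B.width + d) := by
  rw [List.length_flatten, List.map_map]
  rw [List.map_congr_left (g := fun _ => B.width + d)
    (fun r hr => by simp [padRow, B.length_of_mem r hr])]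
  simp [height]

theorem length_cells : (B.cells d).length = (B.height + 2 * d) * (B.width + d) := by
  simp only [cells, List.length_append, length_rows_padRow, padding, List.length_replicate]
  ring

theorem getElem?_cells {a b : ℕ} (ha : a < B.height + 2 * d) (hb : b < B.width + d) :
    (B.cells d)[a * (B.width + d) + b]? = some (if a < d then none else B.square (a - d) b) := by
  have hlen : (padding d B.width).length = d * (B.width + d) := by simp [padding]
  have hmul {x y : ℕ} (h : x < y) : x * (B.width + d) + b < y * (B.width + d) := by
    have : (x + 1) * (B.width + d) ≤ y * (B.width + d) := Nat.mul_le_mul_right _ h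
    rw [Nat.succ_mul] at this
    omega
  rw [cells, List.append_assoc]
  by_cases h₁ : a < d
  · rw [List.getElem?_append_left (by rw [hlen]; exact hmul h₁), if_pos h₁, padding,
      List.getElem?_replicate, if_pos (hmul h₁)]
  · obtain ⟨a, rfl⟩ := Nat.exists_eq_add_of_le (not_lt.1 h₁)
    rw [List.getElem?_append_right (by rw [hlen, add_mul]; omega), hlen, if_neg h₁,
      show (d + a) * (B.width + d) + b - d * (B.width + d) = a * (B.width + d) + b by
        rw [add_mul]; omega, Nat.add_sub_cancel_left]
    by_cases h₂ : a < B.height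
    · rw [List.getElem?_append_left (by rw [length_rows_padRow]; exact hmul h₂),
        getElem?_rows_padRow B d a h₂ hb]
    · obtain ⟨a, rfl⟩ := Nat.exists_eq_add_of_le (not_lt.1 h₂)
      rw [List.getElem?_append_right (by rw [length_rows_padRow, add_mul]; omega),
        length_rows_padRow, square_eq_none_of_height_le _ (by omega), padding,
        List.getElem?_replicate, if_pos]
      have := hmul (x := a) (y := d) (by omega)
      rw [add_mul]
      omega

/-- A column to the left of the board is found in the right border of the row below. One row of the
lower border is spent on this, whence `2 - d` for rows but `1 - d` for columns. -/
theorem index_nonneg {s : ℤ × ℤ} (h₁ : 2 - d ≤ s.1) (h₂ : 1 - d ≤ s.2) : 0 ≤ B.index d s := by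
  rw [index]
  push_cast
  nlinarith

theorem index_lt {s : ℤ × ℤ} (h₁ : s.1 ≤ B.height + d) (h₂ : s.2 ≤ B.width + d) :
    B.index d s < (B.cells d).length := by
  rw [index, length_cells]
  push_cast
  nlinarith

theorem target_index {s v : ℤ × ℤ} (h : 0 ≤ B.index d s) :
    target (B.width + d) (B.index d s).toNat v = B.index d (s + v) := by
  rw [target, Int.toNat_of_nonneg h, index, index]
  simp only [Prod.fst_add, Prod.snd_add]
  ring

/-- The offset leads from the gridsquare `s` to one that is at most `d` columns or about `d` rows
outside the gameboard. -/
structure Near (s : ℤ × ℤ) : Prop where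
  row_ge : 2 - d ≤ s.1
  row_le : s.1 ≤ B.height + d
  col_ge : 1 - d ≤ s.2
  col_le : s.2 ≤ B.width + d

variable {B d}

theorem Near.nonneg {s : ℤ × ℤ} (h : B.Near d s) : 0 ≤ B.index d s :=
  B.index_nonneg d h.row_ge h.col_ge

theorem Near.toNat_lt {s : ℤ × ℤ} (h : B.Near d s) : (B.index d s).toNat < (B.cells d).length := by
  have := B.index_lt d h.row_le h.col_le
  have := h.nonneg
  omega

theorem Near.within {s v : ℤ × ℤ} (h : B.Near d s) (h' : B.Near d (s + v)) :
    Within (B.width + d) (B.cells d).length (B.index d s).toNat v := by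
  have h₁ : B.Near d (s + (v.1, 0)) :=
    ⟨h'.row_ge, h'.row_le, by simpa using h.col_ge, by simpa using h.col_le⟩
  have h₂ : B.Near d (s + (0, v.2)) :=
    ⟨by simpa using h.row_ge, by simpa using h.row_le, h'.col_ge, h'.col_le⟩
  simp only [Within, target_index B d h.nonneg]
  exact ⟨h₁.nonneg, (B.index_lt d h₁.row_le h₁.col_le).le, h'.nonneg,
    (B.index_lt d h'.row_le h'.col_le).le, h₂.nonneg, (B.index_lt d h₂.row_le h₂.col_le).le⟩

/-- The tape has border columns on the right only. Walking left from the first column wraps around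
into the border of the row below, which reads as filled, as a gridsquare outside the board should.
So one border serves both sides. -/
theorem Near.exists_cell {s : ℤ × ℤ} (h : B.Near d s) :
    ∃ c, (B.cells d)[(B.index d s).toNat]? = some c ∧ (c = some false ↔ ¬ B.Filled s) := by
  obtain ⟨i, j⟩ := s
  obtain ⟨h₁, h₂, h₃, h₄⟩ := h
  simp only at h₁ h₂ h₃ h₄
  have key : ∀ a b : ℕ, a < B.height + 2 * d → b < B.width + d →
      B.index d (i, j) = (a : ℤ) * (B.width + d : ℕ) + b →
      ((if a < d then none else B.square (a - d) b) = some false ↔ ¬ B.Filled (i, j)) →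
      ∃ c, (B.cells d)[(B.index d (i, j)).toNat]? = some c ∧
        (c = some false ↔ ¬ B.Filled (i, j)) := by
    intro a b ha hb e hc
    refine ⟨_, ?_, hc⟩
    rw [e, ← getElem?_cells B d ha hb]
    congr 1
  by_cases hj : 1 ≤ j
  · obtain ⟨a, ha⟩ := Int.eq_ofNat_of_zero_le (show 0 ≤ d + i - 1 by omega)
    obtain ⟨b, hb⟩ := Int.eq_ofNat_of_zero_le (show 0 ≤ j - 1 by omega)
    refine key a b (by omega) (by omega) (by rw [index, ha, hb]) ?_
    rw [filled_iff]
    simp only [hb, Int.toNat_natCast]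
    split_ifs with had
    · simp only [false_iff, not_not]
      omega
    · rw [show (i - 1).toNat = a - d by omega]
      simp only [ne_eq, not_or, not_lt, not_not]
      constructor
      · exact fun h => ⟨by omega, hj, h⟩
      · exact fun h => h.2.2
  -- For `j ≤ 0` the index belongs to tape row `d + i - 2`, one lower than expected, and to a border
  -- column `B.width + d + j - 1`, which is at least `B.width` because `j ≥ 1 - d`.
  · obtain ⟨a, ha⟩ := Int.eq_ofNat_of_zero_le (show 0 ≤ d + i - 2 by omega)
    obtain ⟨b, hb⟩ := Int.eq_ofNat_of_zero_le (show 0 ≤ (B.width : ℤ) + d + (j - 1) by omega)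
    refine key a b (by omega) (by omega) ?_ ?_
    · rw [index, show (d + (i, j).1 - 1 : ℤ) = a + 1 by simp only; omega]
      push_cast
      linarith
    · rw [square_eq_none_of_width_le _ (by omega)]
      simp only [ite_self, reduceCtorEq, false_iff, not_not]
      exact Or.inr (Or.inl (not_le.1 hj))

/-! ### Filling -/

theorem square_fill (S : List (ℤ × ℤ)) (a b : ℕ) : (B.fill S).square a b =
    (B.square a b).map fun x => x || decide (((a : ℤ) + 1, (b : ℤ) + 1) ∈ S) := by
  simp only [square, fill, List.getElem?_mapIdx]
  cases B.rows[a]? with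
  | none => rfl
  | some r => simp

theorem height_fill (S : List (ℤ × ℤ)) : (B.fill S).height = B.height := by
  simp [height, fill]

theorem width_fill (S : List (ℤ × ℤ)) : (B.fill S).width = B.width := rfl

theorem fill_nil : B.fill [] = B := by
  ext1
  · rfl
  · have h (r : List Bool) : r.mapIdx (fun _ b => b) = r :=
      List.ext_getElem (by simp) (by simp)
    simp only [fill, List.not_mem_nil, decide_false, Bool.or_false, h]
    exact List.ext_getElem (by simp) (by simp)

theorem fill_append (S S' : List (ℤ × ℤ)) : B.fill (S ++ S') = (B.fill S).fill S' := by
  ext1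
  · rfl
  · simp only [fill, List.mapIdx_mapIdx]
    congr 1
    funext i r
    simp only [Function.comp, List.mapIdx_mapIdx]
    congr 1
    funext j b
    simp [Bool.or_assoc]

theorem set_cells {s : ℤ × ℤ} (h₁ : 1 ≤ s.1) (h₂ : s.1 ≤ B.height) (h₃ : 1 ≤ s.2)
    (h₄ : s.2 ≤ B.width) :
    (B.cells d).set (B.index d s).toNat (some true) = (B.fill [s]).cells d := by
  obtain ⟨i, j⟩ := s
  simp only at h₁ h₂ h₃ h₄
  obtain ⟨a, ha⟩ := Int.eq_ofNat_of_zero_le (show 0 ≤ i - 1 by omega)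
  obtain ⟨b, hb⟩ := Int.eq_ofNat_of_zero_le (show 0 ≤ j - 1 by omega)
  obtain rfl : i = a + 1 := by omega
  obtain rfl : j = b + 1 := by omega
  have e : (B.index d (a + 1, b + 1)).toNat = (d + a) * (B.width + d) + b := by
    have : B.index d (a + 1, b + 1) = ((d + a) * (B.width + d) + b : ℕ) := by
      rw [index]; push_cast; ring
    rw [this, Int.toNat_natCast]
  have hw : 0 < B.width + d := by have := B.width_pos; omega
  rw [e]
  refine List.ext_getElem? fun k => ?_
  by_cases hk : k < (B.cells d).length
  · have hk' := hk
    rw [length_cells] at hk'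
    -- Division with remainder by the length of a tape row turns a comparison of tape indices into
    -- one of coordinates.
    have hx : k / (B.width + d) < B.height + 2 * d := Nat.div_lt_of_lt_mul (by rwa [mul_comm])
    have hy : k % (B.width + d) < B.width + d := Nat.mod_lt _ hw
    generalize hx' : k / (B.width + d) = x at hx
    generalize hy' : k % (B.width + d) = y at hy
    obtain rfl : k = x * (B.width + d) + y := by
      rw [← hx', ← hy', mul_comm]; exact (Nat.div_add_mod _ _).symm
    have h2 := (B.fill [((a : ℤ) + 1, (b : ℤ) + 1)]).getElem?_cells d (a := x) (b := y)
      (by rw [height_fill]; exact hx) hy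
    rw [width_fill] at h2
    rw [h2, square_fill]
    by_cases hxy : (d + a) * (B.width + d) + b = x * (B.width + d) + y
    · have hb' : b = y := by
        have := congrArg (· % (B.width + d)) hxy
        simpa [Nat.mul_add_mod', Nat.mod_eq_of_lt hy,
          Nat.mod_eq_of_lt (show b < B.width + d by omega)] using this
      subst hb'
      have ha' : d + a = x := Nat.eq_of_mul_eq_mul_right hw (by omega)
      subst ha'
      rw [List.getElem?_set_self hk, if_neg (by omega), Nat.add_sub_cancel_left]
      have hr : a < B.rows.length := by have := h₂; rw [height] at this; omega
      have hb'' : b < B.rows[a].length := by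
        rw [B.length_of_mem _ (List.getElem_mem hr)]; omega
      simp [square, hr, hb'']
    · rw [List.getElem?_set_ne hxy, getElem?_cells B d hx hy]
      split_ifs with hxd
      · rfl
      · have hne : ¬ (x - d = a ∧ y = b) := by
          rintro ⟨rfl, rfl⟩
          exact hxy (by rw [Nat.add_sub_cancel' (not_lt.1 hxd)])
        have : ¬ (((x - d : ℕ) : ℤ) + 1 = a + 1 ∧ (y : ℤ) + 1 = b + 1) := by
          intro h
          exact hne ⟨by omega, by omega⟩
        simp only [List.mem_singleton, Prod.mk.injEq, this, decide_false, Bool.or_false,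
          Option.map_id_fun', id]
  · rw [List.getElem?_eq_none (by simpa using hk), List.getElem?_eq_none]
    rw [length_cells, height_fill, width_fill, ← length_cells]
    exact not_lt.1 hk

end Gameboard

end Tetris

namespace Tetris

variable {tm : FinTM2} {yes : tm.Γ tm.k₁} {p q : Prog tm} {m n d k : ℕ} {s t u : St tm}

theorem Sem.le (h : Sem yes p s t) (hpq : p ≤ q) : Sem yes q s t :=
  let ⟨w, hw, e⟩ := h
  ⟨w, hpq hw, e⟩

/-! ### Processing a row -/

/-- Run the programs that belong to the gridsquares of a row. -/
def word (c : Bool → Prog tm) (r : List Bool) : Prog tm := (r.map c).prod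

variable {c : Bool → Prog tm} {r r' : List Bool}

theorem word_append : word c (r ++ r') = word c r * word c r' := by
  simp [word]

theorem word_replicate (b : Bool) : word c (List.replicate k b) = c b ^ k := by
  simp [word]

theorem word_cons (b : Bool) : word c (b :: r) = c b * word c r := by
  simp [word]

theorem word_le_kstar : word c r ≤ (⨆ b, c b)∗ := by
  induction r with
  | nil => exact one_le_kstar
  | cons b r ih =>
    rw [word_cons]
    exact (mul_le_mul' (le_iSup c b) ih).trans mul_kstar_le_kstar

theorem pow_le_kstar' (p : Prog tm) (k : ℕ) : p ^ k ≤ p∗ := by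
  rw [Language.kstar_eq_iSup_pow]
  exact le_iSup (fun i => p ^ i) k

theorem exists_sem_word (h : Sem yes (⨆ b, c b)∗ s t) : ∃ r, Sem yes (word c r) s t := by
  obtain ⟨k, hk⟩ := sem_kstar.1 h
  clear h
  induction k generalizing s with
  | zero => exact ⟨[], hk⟩
  | succ k ih =>
    obtain ⟨u, h₁, h₂⟩ := sem_pow_succ.1 hk
    obtain ⟨b, h₁⟩ := sem_iSup.1 h₁
    obtain ⟨r, h₃⟩ := ih h₂
    exact ⟨b :: r, by rw [word_cons]; exact sem_mul.2 ⟨u, h₁, h₃⟩⟩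

/-- The scheme `X` processes exactly the rows that satisfy `P`. -/
structure IsRowScheme (X : (Bool → Prog tm) → Prog tm) (P : List Bool → Prop) : Prop where
  exists_word : ∀ (yes : tm.Γ tm.k₁) (c : Bool → Prog tm) (s t : St tm), Sem yes (X c) s t →
    ∃ r, P r ∧ Sem yes (word c r) s t
  word_le : ∀ (c : Bool → Prog tm) (r : List Bool), P r → word c r ≤ X c

/-- Rows all of whose gridsquares are `b`. -/
def constRow (b : Bool) (c : Bool → Prog tm) : Prog tm := (c b)∗

/-- Rows that start with `b` or `!b`s and contain `b`. -/
def withSquare (b : Bool) (c : Bool → Prog tm) : Prog tm := (c !b)∗ * c b * (⨆ b, c b)∗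

/-- Rows with filled and empty gridsquares. -/
def mixedRow (c : Bool → Prog tm) : Prog tm :=
  c true * withSquare false c + c false * withSquare true c

theorem isRowScheme_constRow (b : Bool) :
    IsRowScheme (tm := tm) (constRow b) fun r => ∀ a ∈ r, a = b where
  exists_word yes c s t h := by
    obtain ⟨k, h⟩ := sem_kstar.1 h
    exact ⟨List.replicate k b, fun a ha => (List.mem_replicate.1 ha).2, by rwa [word_replicate]⟩
  word_le c r hr := by
    rw [List.eq_replicate_of_mem hr, word_replicate]
    exact pow_le_kstar' _ _

theorem isRowScheme_withSquare (b : Bool) :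
    IsRowScheme (tm := tm) (withSquare b) fun r => b ∈ r where
  exists_word yes c s t h := by
    obtain ⟨u, h₁, h₂⟩ := sem_mul.1 h
    obtain ⟨v, h₁, h₃⟩ := sem_mul.1 h₁
    obtain ⟨k, h₁⟩ := sem_kstar.1 h₁
    obtain ⟨r, h₂⟩ := exists_sem_word h₂
    refine ⟨List.replicate k (!b) ++ b :: r, by simp, ?_⟩
    rw [word_append, word_cons, word_replicate]
    exact sem_mul.2 ⟨v, h₁, sem_mul.2 ⟨u, h₃, h₂⟩⟩
  word_le c r hr := by
    obtain ⟨r₁, r₂, rfl, h₁⟩ := List.eq_append_cons_of_mem hr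
    rw [word_append, word_cons, withSquare, mul_assoc,
      List.eq_replicate_of_mem (a := !b) (l := r₁), word_replicate]
    · exact mul_le_mul' (pow_le_kstar' _ _) (mul_le_mul' le_rfl word_le_kstar)
    · intro a ha
      cases a <;> cases b <;> simp_all

theorem isRowScheme_mixedRow :
    IsRowScheme (tm := tm) mixedRow fun r => true ∈ r ∧ false ∈ r where
  exists_word yes c s t h := by
    rcases sem_add.1 h with h | h <;> obtain ⟨u, h₁, h₂⟩ := sem_mul.1 h <;>
      obtain ⟨r, hr, h₂⟩ := (isRowScheme_withSquare _).exists_word _ _ _ _ h₂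
    · exact ⟨true :: r, by simp [hr], by rw [word_cons]; exact sem_mul.2 ⟨u, h₁, h₂⟩⟩
    · exact ⟨false :: r, by simp [hr], by rw [word_cons]; exact sem_mul.2 ⟨u, h₁, h₂⟩⟩
  word_le c r hr := by
    rcases r with _ | ⟨b, r⟩
    · simp at hr
    rw [word_cons]
    cases b
    · exact (mul_le_mul' le_rfl ((isRowScheme_withSquare true).word_le c r (by simpa using hr.1))).trans
        le_add_self
    · exact (mul_le_mul' le_rfl ((isRowScheme_withSquare false).word_le c r (by simpa using hr.2))).trans
        le_self_add

/-- Process a row whose length is the width of the gameboard. -/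
def overRow (X : (Bool → Prog tm) → Prog tm) (c : Bool → Prog tm) : Prog tm :=
  X (fun b => tick * c b) * reset

theorem Uncounted.word (hc : ∀ b, Uncounted yes (c b)) (r : List Bool) :
    Uncounted yes (word c r) := by
  induction r with
  | nil => exact uncounted_one
  | cons b r ih => rw [word_cons]; exact (hc b).mul ih

theorem Short.word (hc : ∀ b, Short yes (c b) k) (r : List Bool) :
    Short yes (word c r) (r.length * k) := by
  induction r with
  | nil => rw [List.length_nil, zero_mul]; exact short_one
  | cons b r ih =>
    rw [word_cons, List.length_cons, Nat.succ_mul, add_comm]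
    exact (hc b).mul ih

theorem sem_word_tick (hc : ∀ b, Uncounted yes (c b)) :
    Sem yes (word (fun b => tick * c b) r) s t ↔
    r.length ≤ s.width ∧ ∃ u, Sem yes (word c r) s u ∧
      t = { u with width := s.width - r.length, aux := s.aux + r.length } := by
  induction r generalizing s with
  | nil =>
    simp only [word, List.map_nil, List.prod_nil, sem_one, List.length_nil, zero_le, true_and,
      exists_eq_left, Nat.sub_zero, Nat.add_zero]
  | cons b r ih =>
    simp only [word_cons, sem_mul, sem_tick, ih, List.length_cons]
    constructor
    · rintro ⟨s₁, ⟨_, ⟨hw, rfl⟩, h₁⟩, hk, u, h₂, rfl⟩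
      obtain ⟨hw₁, ha₁, h₁'⟩ := hc b _ _ h₁
      simp only at hw₁ ha₁
      refine ⟨by omega, { u with width := s.width, aux := s.aux }, ⟨_, h₁' s.width s.aux,
        ((Uncounted.word hc r) _ _ h₂).2.2 _ _⟩, ?_⟩
      ext1 <;> simp <;> omega
    · rintro ⟨hk, u, ⟨s₁, h₁, h₂⟩, rfl⟩
      refine ⟨{ s₁ with width := s.width - 1, aux := s.aux + 1 },
        ⟨_, ⟨by omega, rfl⟩, (hc b _ _ h₁).2.2 _ _⟩, ?_, { u with width := _, aux := _ },
        ((Uncounted.word hc r) _ _ h₂).2.2 _ _, ?_⟩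
      · simp only; omega
      · ext1 <;> simp <;> omega

variable {X : (Bool → Prog tm) → Prog tm} {P : List Bool → Prop}

/-- The scheme alone admits rows of every length; the ticks and the final `reset` leave those that
are as long as the board is wide. A regular language could not check this by itself. -/
theorem sem_overRow (hX : IsRowScheme X P) (hc : ∀ b, Uncounted yes (c b)) (ha : s.aux = 0) :
    Sem yes (overRow X c) s t ↔ ∃ r, P r ∧ r.length = s.width ∧ Sem yes (word c r) s t := by
  simp only [overRow, sem_mul]
  constructor
  · rintro ⟨_, h, h'⟩
    obtain ⟨r, hr, h⟩ := hX.exists_word _ _ _ _ h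
    obtain ⟨hk, u, hu, rfl⟩ := (sem_word_tick hc).1 h
    obtain ⟨hw, rfl⟩ := sem_reset.1 h'
    obtain ⟨hw', ha', -⟩ := (Uncounted.word hc r) _ _ hu
    replace hw : s.width - r.length = 0 := hw
    refine ⟨r, hr, by omega, ?_⟩
    convert hu using 1
    ext1 <;> simp <;> omega
  · rintro ⟨r, hr, hl, h⟩
    obtain ⟨hw', ha', -⟩ := (Uncounted.word hc r) _ _ h
    refine ⟨_, ((sem_word_tick hc).2 ⟨hl.le, t, h, rfl⟩).le (hX.word_le _ _ hr),
      sem_reset.2 ⟨by simp [hl], ?_⟩⟩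
    ext1 <;> simp <;> omega

theorem steady_overRow (hX : IsRowScheme X P) (hc : ∀ b, Uncounted yes (c b))
    (hc' : ∀ b, Short yes (c b) k) : Steady yes n (overRow X c) (n * (k + 4) + 2) := by
  rintro s t rfl ha h
  obtain ⟨r, -, -, h'⟩ := (sem_overRow hX hc ha).1 h
  obtain ⟨hw', ha', -⟩ := (Uncounted.word hc r) _ _ h'
  refine ⟨hw', ha'.trans ha, ?_⟩
  obtain ⟨u, h₁, h₂⟩ := sem_mul.1 h
  obtain ⟨r, hr, h₁⟩ := hX.exists_word _ _ _ _ h₁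
  have e₁ := (Short.word (fun b => short_tick.mul (hc' b)) r _ _ h₁).le (hX.word_le _ _ hr)
  obtain ⟨hk, v, hv, rfl⟩ := (sem_word_tick hc).1 h₁
  refine (e₁.mul (exec_reset h₂ s.width (by simpa [ha] using hk))).mono ?_
  nlinarith

/-! ### Pushing and reading several symbols -/

theorem sem_push_pow_left {a : Option Bool} :
    Sem yes (push .left a ^ k) s t ↔ t = { s with left := List.replicate k a ++ s.left } := by
  induction k generalizing s with
  | zero => simp [sem_one]
  | succ k ih =>
    simp only [sem_pow_succ, sem_push, exists_eq_left, ih]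
    simp [St.set, St.get, List.replicate_succ']

theorem sem_push_pow_right {a : Option Bool} :
    Sem yes (push .right a ^ k) s t ↔ t = { s with right := List.replicate k a ++ s.right } := by
  induction k generalizing s with
  | zero => simp [sem_one]
  | succ k ih =>
    simp only [sem_pow_succ, sem_push, exists_eq_left, ih]
    simp [St.set, St.get, List.replicate_succ']

/-- Read a symbol of the game. -/
def readSymbol (a : Symbol) : Prog tm := pop .inp a * push .rev a

theorem sem_readSymbol {a : Symbol} : Sem yes (readSymbol a) s t ↔
    ∃ l, s.inp = a :: l ∧ t = { s with inp := l, rev := a :: s.rev } := by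
  simp only [readSymbol, sem_mul, sem_pop, sem_push]
  constructor
  · rintro ⟨_, ⟨l, h, rfl⟩, rfl⟩
    exact ⟨l, h, rfl⟩
  · rintro ⟨l, h, rfl⟩
    exact ⟨_, ⟨l, h, rfl⟩, rfl⟩

/-- The string that describes a row. -/
def rowEncode (r : List Bool) : List Symbol := r.map Symbol.square ++ [Symbol.endOfRow]

/-- Read a gridsquare of the initial gameboard. -/
def readSquare (b : Bool) : Prog tm := readSymbol (.square b) * push .left (some b)

/-- Read a row of the initial gameboard. -/
def readRow (d : ℕ) (X : (Bool → Prog tm) → Prog tm) : Prog tm :=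
  overRow X readSquare * readSymbol .endOfRow * push .left none ^ d

theorem uncounted_readSquare (b : Bool) : Uncounted yes (readSquare b : Prog tm) :=
  ((uncounted_pop (by simp) (by simp)).mul (uncounted_push (by simp) (by simp))).mul
    (uncounted_push (by simp) (by simp))

theorem short_readSquare (b : Bool) : Short yes (readSquare b : Prog tm) 3 :=
  ((short_act _).mul (short_act _)).mul (short_act _)

theorem sem_word_readSquare : Sem yes (word readSquare r) s t ↔
    ∃ l, s.inp = r.map Symbol.square ++ l ∧ t = { s with
      inp := l
      rev := (r.map Symbol.square).reverse ++ s.rev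
      left := (r.map some).reverse ++ s.left } := by
  induction r generalizing s with
  | nil =>
    simp only [word, List.map_nil, List.prod_nil, sem_one, List.nil_append, List.reverse_nil]
    exact ⟨fun h => ⟨_, rfl, h⟩, by rintro ⟨l, rfl, rfl⟩; rfl⟩
  | cons b r ih =>
    simp only [word_cons, readSquare, sem_mul, sem_readSymbol, sem_push, ih]
    constructor
    · rintro ⟨_, ⟨_, ⟨l, h, rfl⟩, rfl⟩, l', h', rfl⟩
      refine ⟨l', ?_, ?_⟩
      · rw [h]; exact congrArg _ h'
      · simp [St.set, St.get]
    · rintro ⟨l, h, rfl⟩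
      refine ⟨_, ⟨_, ⟨_, h, rfl⟩, rfl⟩, l, rfl, ?_⟩
      simp [St.set, St.get]

theorem sem_readRow (hX : IsRowScheme X P) (ha : s.aux = 0) : Sem yes (readRow d X) s t ↔
    ∃ r l, P r ∧ r.length = s.width ∧ s.inp = rowEncode r ++ l ∧ t = { s with
      inp := l
      rev := (rowEncode r).reverse ++ s.rev
      left := (padRow d r).reverse ++ s.left } := by
  simp only [readRow, sem_mul, sem_overRow hX uncounted_readSquare ha, sem_word_readSquare,
    sem_readSymbol, sem_push_pow_left]
  constructor
  · rintro ⟨_, ⟨_, ⟨r, hr, hl, l, h, rfl⟩, l', h', rfl⟩, rfl⟩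
    refine ⟨r, l', hr, hl, ?_, ?_⟩
    · simp only at h'
      simp [h, h', rowEncode]
    · simp [rowEncode, padRow]
  · rintro ⟨r, l, hr, hl, h, rfl⟩
    refine ⟨_, ⟨_, ⟨r, hr, hl, _, ?_, rfl⟩, l, rfl, rfl⟩, ?_⟩
    · simp [h, rowEncode]
    · simp [rowEncode, padRow]

theorem steady_readRow (hX : IsRowScheme X P) :
    Steady yes n (readRow d X) (n * (3 + 4) + 2 + 2 + d * 1) :=
  ((steady_overRow hX uncounted_readSquare short_readSquare).mul
    (((uncounted_pop (by simp) (by simp)).mul (uncounted_push (by simp) (by simp))).steady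
      ((short_act _).mul (short_act _)) n)).mul
    (((uncounted_push (by simp) (by simp)).steady (short_act _) n).pow d)

theorem sem_readRow_pow (hX : IsRowScheme X P) (ha : s.aux = 0) :
    Sem yes (readRow d X ^ k) s t ↔
    ∃ (rs : List (List Bool)) (l : List Symbol), rs.length = k ∧ (∀ r ∈ rs, P r ∧ r.length = s.width) ∧
      s.inp = rs.flatMap rowEncode ++ l ∧ t = { s with
        inp := l
        rev := (rs.flatMap rowEncode).reverse ++ s.rev
        left := (rs.map (padRow d)).flatten.reverse ++ s.left } := by
  induction k generalizing s with
  | zero =>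
    simp only [sem_pow_zero]
    constructor
    · rintro rfl
      exact ⟨[], t.inp, by simp⟩
    · rintro ⟨rs, l, hrs, -, h, rfl⟩
      obtain rfl := List.length_eq_zero_iff.1 hrs
      simp only [List.flatMap_nil, List.nil_append] at h
      subst h
      rfl
  | succ k ih =>
    simp only [sem_pow_succ, sem_readRow hX ha]
    constructor
    · rintro ⟨_, ⟨r, l, hr, hl, h, rfl⟩, h'⟩
      obtain ⟨rs, l', hk, hrs, e, rfl⟩ := (ih (by exact ha)).1 h'
      replace e : l = rs.flatMap rowEncode ++ l' := e
      refine ⟨r :: rs, l', by simp [hk], ?_, ?_, ?_⟩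
      · exact List.forall_mem_cons.2 ⟨⟨hr, hl⟩, hrs⟩
      · simp [h, e]
      · simp
    · rintro ⟨_ | ⟨r, rs⟩, l, hk, hrs, h, rfl⟩
      · simp at hk
      rw [List.forall_mem_cons] at hrs
      refine ⟨_, ⟨r, rs.flatMap rowEncode ++ l, hrs.1.1, hrs.1.2, by simp [h], rfl⟩,
        (ih (by exact ha)).2 ⟨rs, l, by simpa using hk, hrs.2, rfl, by simp⟩⟩

end Tetris

namespace Tetris

variable {tm : FinTM2} {yes : tm.Γ tm.k₁} {p q : Prog tm} {m n d k : ℕ} {s t u : St tm}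

theorem Steady.exec_kstar {c : ℕ} (hp : Steady yes n p c) (hw : s.width = n) (ha : s.aux = 0)
    (h : Sem yes (p ^ k) s t) : Exec yes p∗ (k * c) s t :=
  ((hp.pow k) _ _ hw ha h).2.2.kstar

/-! ### Reading the initial gameboard -/

/-- The number of gridsquares on the tape below the top of the gameboard. -/
def Gameboard.lower (d : ℕ) (B : Gameboard) : ℕ := (d + B.height) * (B.width + d)

/-- The store between the trajectories: the gameboard `B` is on the tape, with the head above it,
and the given strings are on the stacks of symbols. -/
def St.home (c : tm.Cfg) (d : ℕ) (B : Gameboard) (inp rev out : List Symbol) : St tm where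
  inp := inp
  rev := rev
  out := out
  left := (padding d B.width ++ (B.rows.map (padRow d)).flatten).reverse
  right := padding d B.width
  width := B.width
  aux := 0
  full := 0
  ori := []
  cfg := c

theorem St.home_eq_tape (c : tm.Cfg) (B : Gameboard) (inp rev out : List Symbol) :
    St.home c d B inp rev out =
      (St.home c d B inp rev out).tape (B.cells d) (B.lower d) := by
  have h : (padding d B.width ++ (B.rows.map (padRow d)).flatten).length = B.lower d := by
    rw [List.length_append, B.length_rows_padRow d, padding, List.length_replicate,
      Gameboard.lower, add_mul]
  ext1 <;> try rfl
  · rw [St.tape, Gameboard.cells, ← h, List.take_left]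
    rfl
  · rw [St.tape, Gameboard.cells, ← h, List.drop_left]
    rfl

/-- Move a symbol from the stack `rev` to the stack `inp`. -/
def unread : Prog tm := ⨆ a : Symbol, pop .rev a * push .inp a

/-- Move everything from the stack `rev` to the stack `inp`. -/
def pour : Prog tm := unread∗ * empty .rev

/-- Guess the width of the gameboard. -/
def guessWidth : Prog tm := push .width () * (push .width ())∗

/-- Put a row of border squares on the stack `left`. -/
def padLeft (d : ℕ) : Prog tm := forWidth (push .left none) * push .left none ^ d

/-- Put a row of border squares on the stack `right`. -/
def padRight (d : ℕ) : Prog tm := forWidth (push .right none) * push .right none ^ d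

/-- Check that something was read. -/
def checkRead : Prog tm := ⨆ a, pop .rev a * push .rev a

/-- Read a legal gameboard. -/
def readBoard (d : ℕ) : Prog tm :=
  pour * guessWidth * padLeft d ^ d * (readRow d mixedRow)∗ * (readRow d (constRow false))∗ *
    checkRead * padRight d ^ d

theorem sem_pour_pow : Sem yes (unread ^ k) s t ↔
    k ≤ s.rev.length ∧ t = { s with
      inp := (s.rev.take k).reverse ++ s.inp
      rev := s.rev.drop k } := by
  induction k generalizing s with
  | zero => simp [sem_one]
  | succ k ih =>
    simp only [sem_pow_succ, ih]
    simp only [unread, sem_iSup, sem_mul, sem_pop, sem_push]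
    constructor
    · rintro ⟨_, ⟨a, _, ⟨l, h, rfl⟩, rfl⟩, hk, rfl⟩
      replace h : s.rev = a :: l := h
      replace hk : k ≤ l.length := hk
      rw [h]
      exact ⟨Nat.succ_le_succ hk, by simp [St.set, St.get]⟩
    · rintro ⟨hk, rfl⟩
      cases h : s.rev with
      | nil => simp [h] at hk
      | cons a l =>
        refine ⟨_, ⟨a, _, ⟨l, h, rfl⟩, rfl⟩, ?_, ?_⟩
        · rw [h] at hk
          exact Nat.le_of_succ_le_succ hk
        · simp [St.set, St.get]

theorem sem_pour : Sem yes pour s t ↔ t = { s with inp := s.rev.reverse ++ s.inp, rev := [] } := by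
  simp only [pour, sem_mul, sem_kstar, sem_pour_pow, sem_empty]
  constructor
  · rintro ⟨_, ⟨k, hk, rfl⟩, h, rfl⟩
    replace h : s.rev.drop k = [] := h
    rw [List.drop_eq_nil_iff] at h
    simp [List.take_of_length_le h, h]
  · rintro rfl
    exact ⟨_, ⟨s.rev.length, le_rfl, rfl⟩, by simp [St.get], by simp⟩

theorem exec_pour (h : Sem yes pour s t) : Exec yes pour (s.rev.length * 2 + 1) s t := by
  obtain ⟨u, h₁, h₂⟩ := sem_mul.1 h
  obtain ⟨k, h₁⟩ := sem_kstar.1 h₁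
  have hs : Short yes (unread : Prog tm) 2 := .iSup fun _ => (short_act _).mul (short_act _)
  have e := (hs.pow k _ _ h₁).kstar
  exact (e.mono (Nat.mul_le_mul_right _ (sem_pour_pow.1 h₁).1)).mul h₂.exec_act

theorem sem_guessWidth_pow : Sem yes (push .width () ^ k) s t ↔
    t = { s with width := s.width + k } := by
  induction k generalizing s with
  | zero => simp [sem_one]
  | succ k ih =>
    simp only [sem_pow_succ, sem_push, exists_eq_left, ih]
    rw [show (s.set .width (() :: s.get .width)) = { s with width := s.width + 1 } by
      simp [St.set, St.get]]
    simp only [add_assoc, add_comm 1]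

theorem sem_guessWidth : Sem yes guessWidth s t ↔
    ∃ k, t = { s with width := s.width + (k + 1) } := by
  simp only [← sem_guessWidth_pow (yes := yes), sem_pow_succ]
  rw [guessWidth, sem_mul]
  constructor
  · rintro ⟨u, h₁, h₂⟩
    obtain ⟨k, h₂⟩ := sem_kstar.1 h₂
    exact ⟨k, u, h₁, h₂⟩
  · rintro ⟨k, u, h₁, h₂⟩
    exact ⟨u, h₁, sem_kstar.2 ⟨k, h₂⟩⟩

theorem exec_guessWidth :
    Exec yes guessWidth (k + 1) s { s with width := s.width + (k + 1) } := by
  obtain ⟨u, h₁, h₂⟩ := sem_pow_succ.1 (sem_guessWidth_pow.2 rfl :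
    Sem yes (push .width () ^ (k + 1)) s _)
  refine (h₁.exec_act.mul ((short_act _).pow _ _ _ h₂).kstar).mono (by omega)

theorem sem_padLeft_pow (ha : s.aux = 0) : Sem yes (padLeft d ^ k) s t ↔
    t = { s with left := List.replicate (k * (s.width + d)) none ++ s.left } := by
  induction k generalizing s with
  | zero => simp [sem_one]
  | succ k ih =>
    have hu : Uncounted yes (push .left none : Prog tm) := uncounted_push (by simp) (by simp)
    rw [sem_pow_succ, padLeft]
    simp only [sem_mul, sem_forWidth hu ha, sem_push_pow_left, exists_eq_left]
    rw [← padLeft, ih (by exact ha)]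
    simp only [← List.append_assoc, List.replicate_append_replicate]
    rw [show k * (s.width + d) + (d + s.width) = (k + 1) * (s.width + d) by ring]

theorem sem_padRight_pow (ha : s.aux = 0) : Sem yes (padRight d ^ k) s t ↔
    t = { s with right := List.replicate (k * (s.width + d)) none ++ s.right } := by
  induction k generalizing s with
  | zero => simp [sem_one]
  | succ k ih =>
    have hu : Uncounted yes (push .right none : Prog tm) := uncounted_push (by simp) (by simp)
    rw [sem_pow_succ, padRight]
    simp only [sem_mul, sem_forWidth hu ha, sem_push_pow_right, exists_eq_left]
    rw [← padRight, ih (by exact ha)]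
    simp only [← List.append_assoc, List.replicate_append_replicate]
    rw [show k * (s.width + d) + (d + s.width) = (k + 1) * (s.width + d) by ring]

theorem steady_padLeft : Steady yes n (padLeft d : Prog tm) (n * 5 + 2 + d * 1) :=
  (steady_forWidth (uncounted_push (by simp) (by simp)) (short_act _)).mul
    (((uncounted_push (by simp) (by simp)).steady (short_act _) n).pow d)

theorem steady_padRight : Steady yes n (padRight d : Prog tm) (n * 5 + 2 + d * 1) :=
  (steady_forWidth (uncounted_push (by simp) (by simp)) (short_act _)).mul
    (((uncounted_push (by simp) (by simp)).steady (short_act _) n).pow d)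

theorem sem_checkRead : Sem yes checkRead s t ↔ s.rev ≠ [] ∧ t = s := by
  simp only [checkRead, sem_iSup, sem_mul, sem_pop, sem_push]
  constructor
  · rintro ⟨a, _, ⟨l, h, rfl⟩, rfl⟩
    replace h : s.rev = a :: l := h
    simp [St.set, St.get, h]
    rw [← h]
  · rintro ⟨h, rfl⟩
    cases ht : t.rev with
    | nil => exact absurd ht h
    | cons a l =>
      refine ⟨a, _, ⟨l, ht, rfl⟩, ?_⟩
      simp [St.set, St.get]
      rw [← ht]

theorem Gameboard.encode_eq (B : Gameboard) : B.encode = B.rows.flatMap rowEncode := rfl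

/-- The lower rows of a legal gameboard have filled and empty gridsquares, and the upper ones are
empty. -/
theorem Gameboard.legal_iff (B : Gameboard) : B.Legal ↔
    ∃ rs rs', B.rows = rs ++ rs' ∧ (∀ r ∈ rs, true ∈ r ∧ false ∈ r) ∧
      ∀ r ∈ rs', ∀ a ∈ r, a = false := by
  constructor
  · rintro ⟨h₁, h₂⟩
    refine ⟨B.rows.takeWhile fun r => true ∈ r, B.rows.dropWhile fun r => true ∈ r,
      List.takeWhile_append_dropWhile.symm, fun r hr => ⟨by simpa using List.mem_takeWhile_imp hr,
        h₁ r (List.takeWhile_subset _ hr)⟩, ?_⟩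
    have h₃ := h₂.sublist (List.dropWhile_sublist fun r => decide (true ∈ r))
    intro r hr
    have h₄ : true ∉ r := by
      cases h : B.rows.dropWhile (fun r => decide (true ∈ r)) with
      | nil => simp [h] at hr
      | cons r' l =>
        have h₅ : true ∉ r' := by
          have := List.head_dropWhile_not (fun r => decide (true ∈ r)) (by rw [h]; simp :
            B.rows.dropWhile (fun r => decide (true ∈ r)) ≠ [])
          simpa [h] using this
        rw [h] at hr h₃
        rcases List.mem_cons.1 hr with rfl | hr
        · exact h₅
        · exact fun h => h₅ ((List.pairwise_cons.1 h₃).1 r hr h)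
    intro a ha
    cases a
    · rfl
    · exact absurd ha h₄
  · rintro ⟨rs, rs', h, h₁, h₂⟩
    have h₃ : ∀ r ∈ rs', true ∉ r := fun r hr hr' => by simpa using h₂ r hr true hr'
    refine ⟨fun r hr => ?_, ?_⟩
    · have hr' := hr
      rw [h] at hr'
      rcases List.mem_append.1 hr' with hr' | hr'
      · exact (h₁ r hr').2
      · have hl := B.length_of_mem r hr
        cases r with
        | nil => have := B.width_pos; simp at hl; omega
        | cons a r => rw [← h₂ _ hr' a (by simp)]; simp
    · rw [h, List.pairwise_append]
      exact ⟨List.pairwise_of_forall_mem_list fun r hr r' _ _ => (h₁ r hr).1,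
        List.pairwise_of_forall_mem_list fun r _ r' hr' h => absurd h (h₃ r' hr'),
        fun r hr r' _ _ => (h₁ r hr).1⟩

/-- The store at the beginning. -/
def St.start (c : tm.Cfg) (x : List Symbol) : St tm where
  inp := []
  rev := x.reverse
  out := []
  left := []
  right := []
  width := 0
  aux := 0
  full := 0
  ori := []
  cfg := c

variable {c : tm.Cfg} {x : List Symbol}

/-- Wrong guesses of the width are ruled out by the `reset` after each row. `guessWidth` pushes at
least once and `checkRead` requires at least one row, so the board is not degenerate, and
`Gameboard.legal_iff` makes legality a regular condition on the sequence of rows. Nothing is claimed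
yet about the remaining input `l`; `play` will force it to consist of pieces. -/
theorem sem_readBoard (h : Sem yes (readBoard d) (St.start c x) t) :
    ∃ (B : Gameboard) (l : List Symbol), B.Legal ∧ x = B.encode ++ l ∧
      t = St.home c d B l B.encode.reverse [] := by
  simp only [readBoard, sem_mul, sem_kstar] at h
  obtain ⟨s₆, ⟨s₅, ⟨s₄, ⟨s₃, ⟨s₂, ⟨s₁, h₁, h₂⟩, h₃⟩, k₁, h₄⟩, k₂, h₅⟩, h₆⟩, h₇⟩ := h
  rw [sem_pour] at h₁
  subst h₁
  obtain ⟨n, rfl⟩ := sem_guessWidth.1 h₂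
  rw [sem_padLeft_pow (by rfl)] at h₃
  subst h₃
  obtain ⟨rs, l, -, hrs, e, rfl⟩ := (sem_readRow_pow isRowScheme_mixedRow (by rfl)).1 h₄
  obtain ⟨rs', l', -, hrs', e', rfl⟩ :=
    (sem_readRow_pow (isRowScheme_constRow false) (by rfl)).1 h₅
  obtain ⟨hne, rfl⟩ := sem_checkRead.1 h₆
  rw [sem_padRight_pow (by rfl)] at h₇
  subst h₇
  simp only [St.start, List.reverse_reverse, List.append_nil, zero_add] at e e' hrs hrs' hne ⊢
  refine ⟨⟨n + 1, rs ++ rs', by simp, ?_, ?_⟩, l', ?_, ?_, ?_⟩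
  · intro h
    simp only [List.append_eq_nil_iff] at h
    exact hne (by simp [h.1, h.2])
  · intro r hr
    rcases List.mem_append.1 hr with hr | hr
    exacts [(hrs r hr).2, (hrs' r hr).2]
  · rw [Gameboard.legal_iff]
    exact ⟨rs, rs', rfl, fun r hr => (hrs r hr).1, fun r hr => (hrs' r hr).1⟩
  · simp [e, e', Gameboard.encode_eq]
  · simp [St.home, padding, Gameboard.encode_eq]

/-- A bound on the time for reading a gameboard. -/
def readCost (d n m l : ℕ) : ℕ :=
  l * 2 + 1 + n + d * (n * 5 + 2 + d * 1) + m * (n * (3 + 4) + 2 + 2 + d * 1) +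
    m * (n * (3 + 4) + 2 + 2 + d * 1) + 2 + d * (n * 5 + 2 + d * 1)

theorem exec_readBoard {B : Gameboard} (hB : B.Legal) (l : List Symbol) :
    Exec yes (readBoard d) (readCost d B.width B.height (B.encode ++ l).length)
      (St.start c (B.encode ++ l)) (St.home c d B l B.encode.reverse []) := by
  obtain ⟨rs, rs', e, h₁, h₂⟩ := B.legal_iff.1 hB
  obtain ⟨n, hn⟩ := Nat.exists_eq_add_of_le' B.width_pos
  have hl := B.length_of_mem
  rw [e] at hl
  have hm : B.height = rs.length + rs'.length := by rw [Gameboard.height, e, List.length_append]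
  have hrs : ∀ r ∈ rs, (true ∈ r ∧ false ∈ r) ∧ r.length = 0 + (n + 1) := fun r hr =>
    ⟨h₁ r hr, by rw [hl r (by simp [hr]), hn, zero_add]⟩
  have hrs' : ∀ r ∈ rs', (∀ a ∈ r, a = false) ∧ r.length = 0 + (n + 1) := fun r hr =>
    ⟨h₂ r hr, by rw [hl r (by simp [hr]), hn, zero_add]⟩
  have hinp : (St.start c (B.encode ++ l)).rev.reverse ++ (St.start c (B.encode ++ l)).inp =
      rs.flatMap rowEncode ++ (rs'.flatMap rowEncode ++ l) := by
    simp [St.start, Gameboard.encode_eq, e]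
  -- Every row contributes at least its end mark, so the test `checkRead` succeeds because the board
  -- has a row.
  have hrev : (rs'.flatMap rowEncode).reverse ++ ((rs.flatMap rowEncode).reverse ++ []) ≠ [] := by
    have h₃ : ∀ L : List (List Bool), L.flatMap rowEncode = [] → L = [] := by
      rintro (_ | ⟨r, L⟩) h
      · rfl
      · simp [rowEncode] at h
    intro h
    simp only [List.append_eq_nil_iff, List.reverse_eq_nil_iff] at h
    refine B.rows_ne_nil ?_
    rw [e, h₃ _ h.1, h₃ _ h.2.1]
    rfl
  have hc : Short yes (checkRead : Prog tm) 2 := .iSup fun _ => (short_act _).mul (short_act _)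
  have e₁ := exec_pour (yes := yes) (s := St.start c (B.encode ++ l)) (sem_pour.2 rfl)
  have e₂ := e₁.mul (exec_guessWidth (k := n))
  have e₃ := e₂.mul ((steady_padLeft.pow d) _ _ rfl rfl ((sem_padLeft_pow (d := d) rfl).2 rfl)).2.2
  have e₄ := e₃.mul ((steady_readRow isRowScheme_mixedRow).exec_kstar rfl rfl
    ((sem_readRow_pow (d := d) isRowScheme_mixedRow rfl).2 ⟨rs, _, rfl, hrs, hinp, rfl⟩))
  have e₅ := e₄.mul ((steady_readRow (isRowScheme_constRow false)).exec_kstar rfl rfl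
    ((sem_readRow_pow (d := d) (isRowScheme_constRow false) rfl).2 ⟨rs', l, rfl, hrs', rfl, rfl⟩))
  have e₆ := e₅.mul (hc _ _ (sem_checkRead.2 ⟨hrev, rfl⟩))
  have e₇ := e₆.mul
    ((steady_padRight.pow d) _ _ rfl rfl ((sem_padRight_pow (d := d) rfl).2 rfl)).2.2
  have h₃ : rs.length ≤ B.height := by omega
  have h₄ : rs'.length ≤ B.height := by omega
  have e₈ := e₇.mono (n := readCost d B.width B.height (B.encode ++ l).length) (by
    simp only [St.start, List.length_reverse, zero_add, readCost, hn]
    gcongr)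
  convert e₈ using 1
  · rfl
  · simp [St.home, St.start, padding, Gameboard.encode_eq, e, hn]

end Tetris

namespace Tetris

variable {tm : FinTM2} (yes : tm.Γ tm.k₁)

/-! ### Programs that use linear time -/

/-- The program is steady, with a bound that is linear in the width of the gameboard. -/
def Linear (p : Prog tm) : Prop := ∃ K, ∀ n, Steady yes n p (K * (n + 1))

variable {yes} {p q : Prog tm} {m n d k : ℕ} {s t u b : St tm}

theorem Linear.mul (hp : Linear yes p) (hq : Linear yes q) : Linear yes (p * q) := by
  obtain ⟨K, hK⟩ := hp
  obtain ⟨L, hL⟩ := hq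
  exact ⟨K + L, fun n => by rw [add_mul]; exact (hK n).mul (hL n)⟩

/-- Finiteness of the index set supplies a common constant; this is why guesses range over patterns,
orientations and piece types only. -/
theorem Linear.iSup {ι : Sort*} [Finite ι] {p : ι → Prog tm} (hp : ∀ i, Linear yes (p i)) :
    Linear yes (⨆ i, p i) := by
  choose K hK using hp
  obtain ⟨M, hM⟩ := (Set.finite_range K).bddAbove
  exact ⟨M, fun n => .iSup fun i =>
    (hK i n).mono (Nat.mul_le_mul_right _ (hM (Set.mem_range_self i)))⟩

theorem Linear.add (hp : Linear yes p) (hq : Linear yes q) : Linear yes (p + q) := by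
  obtain ⟨K, hK⟩ := hp
  obtain ⟨L, hL⟩ := hq
  exact ⟨max K L, fun n => ((hK n).mono (by gcongr; exact le_max_left _ _)).add
    ((hL n).mono (by gcongr; exact le_max_right _ _))⟩

theorem Uncounted.linear (hp : Uncounted yes p) (hs : Short yes p k) : Linear yes p :=
  ⟨k, fun n => (hp.steady hs n).mono (Nat.le_mul_of_pos_right _ n.succ_pos)⟩

theorem linear_one : Linear yes (1 : Prog tm) := uncounted_one.linear short_one

theorem Linear.pow (hp : Linear yes p) (k : ℕ) : Linear yes (p ^ k) := by
  induction k with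
  | zero => rw [pow_zero]; exact linear_one
  | succ k ih => rw [pow_succ]; exact ih.mul hp

theorem Linear.list_prod {ι : Type*} {p : ι → Prog tm} (l : List ι)
    (hp : ∀ i ∈ l, Linear yes (p i)) : Linear yes (l.map p).prod := by
  induction l with
  | nil => exact linear_one
  | cons i l ih =>
    rw [List.map_cons, List.prod_cons]
    exact (hp i (by simp)).mul (ih fun j hj => hp j (by simp [hj]))

theorem linear_of_le {c : ℕ → ℕ} (K : ℕ) (h : ∀ n, Steady yes n p (c n))
    (hc : ∀ n, c n ≤ K * (n + 1)) : Linear yes p :=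
  ⟨K, fun n => (h n).mono (hc n)⟩

theorem linear_push {r : Reg} {a : r.Alph} (hw : r ≠ .width) (ha : r ≠ .aux) :
    Linear yes (push r a : Prog tm) := (uncounted_push hw ha).linear (short_act _)

theorem linear_pop {r : Reg} {a : r.Alph} (hw : r ≠ .width) (ha : r ≠ .aux) :
    Linear yes (pop r a : Prog tm) := (uncounted_pop hw ha).linear (short_act _)

theorem linear_forWidth (hq : Uncounted yes q) (hs : Short yes q k) : Linear yes (forWidth q) :=
  linear_of_le (k + 6) (fun _ => steady_forWidth hq hs) fun n => by nlinarith

theorem linear_overRow {X : (Bool → Prog tm) → Prog tm} {P : List Bool → Prop}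
    {c : Bool → Prog tm} (hX : IsRowScheme X P) (hc : ∀ b, Uncounted yes (c b))
    (hc' : ∀ b, Short yes (c b) k) : Linear yes (overRow X c) :=
  linear_of_le (k + 6) (fun _ => steady_overRow hX hc hc') fun n => by nlinarith

theorem shiftCost_le (v : ℤ × ℤ) :
    shiftCost d n v ≤ (v.1.natAbs * (8 + d * 2) + v.2.natAbs * 2) * (n + 1) := by
  have : n * 6 + 2 + d * 2 ≤ (8 + d * 2) * (n + 1) := by nlinarith
  rw [shiftCost, add_mul, mul_assoc]
  exact Nat.add_le_add (Nat.mul_le_mul_left _ this) (Nat.le_mul_of_pos_right _ n.succ_pos)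

theorem linear_shift (v : ℤ × ℤ) : Linear yes (shift d v : Prog tm) :=
  linear_of_le _ (fun _ => steady_shift v) fun _ => shiftCost_le v

theorem linear_look (v : ℤ × ℤ) (P : Option Bool → Prop) : Linear yes (look d v P : Prog tm) :=
  linear_of_le (2 * (v.1.natAbs * (8 + d * 2) + v.2.natAbs * 2) + 2) (fun _ => steady_look v P)
    fun n => by
      have := shiftCost_le (d := d) (n := n) v
      rw [add_mul, mul_assoc]
      gcongr
      exact Nat.le_mul_of_pos_right _ n.succ_pos

theorem linear_write (v : ℤ × ℤ) (a : Option Bool) : Linear yes (write d v a : Prog tm) :=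
  linear_of_le (2 * (v.1.natAbs * (8 + d * 2) + v.2.natAbs * 2) + 2) (fun _ => steady_write v a)
    fun n => by
      have := shiftCost_le (d := d) (n := n) v
      rw [add_mul, mul_assoc]
      gcongr
      exact Nat.le_mul_of_pos_right _ n.succ_pos

/-! ### Looking at the gameboard -/

/-- The store with the gameboard `B` on the tape and the head at the gridsquare `x`. -/
def St.on (b : St tm) (d : ℕ) (B : Gameboard) (x : ℤ × ℤ) : St tm :=
  b.tape (B.cells d) (B.index d x).toNat

/-- The counters of columns agree with the gameboard. -/
structure St.Ready (b : St tm) (B : Gameboard) : Prop where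
  width : b.width = B.width
  aux : b.aux = 0

variable {B : Gameboard} {x v : ℤ × ℤ}

theorem sem_shift_on (hb : b.Ready B) (hx : B.Near d x) (hv : B.Near d (x + v)) :
    Sem yes (shift d v) (b.on d B x) t ↔ t = b.on d B (x + v) := by
  rw [St.on, sem_shift hb.aux hx.toNat_lt.le (by rw [hb.width]; exact hx.within hv), hb.width,
    B.target_index d hx.nonneg]
  rfl

theorem sem_look_on (hb : b.Ready B) (hx : B.Near d x) (hv : B.Near d (x + v))
    (Q : Option Bool → Prop) (f : Prop) (hQ : ∀ c, (c = some false ↔ ¬ B.Filled (x + v)) → (Q c ↔ f)) :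
    Sem yes (look d v Q) (b.on d B x) t ↔ f ∧ t = b.on d B x := by
  rw [St.on, sem_look hb.aux hx.toNat_lt.le (by rw [hb.width]; exact hx.within hv), hb.width,
    B.target_index d hx.nonneg]
  obtain ⟨c, h, hc⟩ := hv.exists_cell
  simp only [h, Option.some.injEq, exists_eq_left', hQ c hc]

/-- The gridsquares at the given offsets are empty. -/
def checkFree (d : ℕ) (l : List (ℤ × ℤ)) : Prog tm := (l.map fun v => look d v (· = some false)).prod

/-- One of the gridsquares at the given offsets is filled. -/
def checkFilled (d : ℕ) (l : List (ℤ × ℤ)) : Prog tm :=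
  ⨆ v : { v // v ∈ l }, look d v.1 (· ≠ some false)

theorem sem_checkFree (hb : b.Ready B) (hx : B.Near d x) {l : List (ℤ × ℤ)}
    (hl : ∀ v ∈ l, B.Near d (x + v)) :
    Sem yes (checkFree d l) (b.on d B x) t ↔ (∀ v ∈ l, ¬ B.Filled (x + v)) ∧ t = b.on d B x := by
  induction l with
  | nil => simp [checkFree, sem_one]
  | cons v l ih =>
    rw [List.forall_mem_cons] at hl
    rw [checkFree, List.map_cons, List.prod_cons, ← checkFree, sem_mul]
    simp only [sem_look_on hb hx hl.1 _ _ fun c hc => hc, List.forall_mem_cons, and_assoc]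
    constructor
    · rintro ⟨_, h, rfl, h'⟩
      exact ⟨h, (ih hl.2).1 h'⟩
    · rintro ⟨h, h'⟩
      exact ⟨_, h, rfl, (ih hl.2).2 h'⟩

/-- The program guesses which of the gridsquares is filled and verifies that one. -/
theorem sem_checkFilled (hb : b.Ready B) (hx : B.Near d x) {l : List (ℤ × ℤ)}
    (hl : ∀ v ∈ l, B.Near d (x + v)) :
    Sem yes (checkFilled d l) (b.on d B x) t ↔ (∃ v ∈ l, B.Filled (x + v)) ∧ t = b.on d B x := by
  rw [checkFilled, sem_iSup]
  constructor
  · rintro ⟨⟨v, hv⟩, h⟩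
    rw [sem_look_on hb hx (hl v hv) _ _ fun c hc => (not_congr hc).trans not_not] at h
    exact ⟨⟨v, hv, h.1⟩, h.2⟩
  · rintro ⟨⟨v, hv, h⟩, rfl⟩
    exact ⟨⟨v, hv⟩, (sem_look_on hb hx (hl v hv) _ _ fun c hc => (not_congr hc).trans not_not).2
      ⟨h, rfl⟩⟩

theorem linear_checkFree (l : List (ℤ × ℤ)) : Linear yes (checkFree d l : Prog tm) :=
  .list_prod l fun _ _ => linear_look _ _

theorem linear_checkFilled (l : List (ℤ × ℤ)) : Linear yes (checkFilled d l : Prog tm) :=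
  have : Finite { v // v ∈ l } := l.finite_toSet
  .iSup fun _ => linear_look _ _

/-- Fill the gridsquares at the given offsets. -/
def fillSquares (d : ℕ) (l : List (ℤ × ℤ)) : Prog tm := (l.map fun v => write d v (some true)).prod

theorem St.Ready.fill (hb : b.Ready B) (S : List (ℤ × ℤ)) : b.Ready (B.fill S) := ⟨hb.width, hb.aux⟩

theorem Gameboard.Near.fill (hx : B.Near d x) (S : List (ℤ × ℤ)) : (B.fill S).Near d x :=
  ⟨hx.row_ge, by rw [height_fill]; exact hx.row_le, hx.col_ge, hx.col_le⟩

/-- The gridsquare belongs to the gameboard. -/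
structure Gameboard.Inside (B : Gameboard) (x : ℤ × ℤ) : Prop where
  row_ge : 1 ≤ x.1
  row_le : x.1 ≤ B.height
  col_ge : 1 ≤ x.2
  col_le : x.2 ≤ B.width

theorem Gameboard.Inside.fill (hx : B.Inside x) (S : List (ℤ × ℤ)) : (B.fill S).Inside x :=
  ⟨hx.row_ge, by rw [height_fill]; exact hx.row_le, hx.col_ge, hx.col_le⟩

theorem Gameboard.inside_of_not_filled (h : ¬ B.Filled x) : B.Inside x := by
  rw [filled_iff] at h
  simp only [not_or, not_lt, not_not] at h
  obtain ⟨h₁, h₂, h₃⟩ := h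
  refine ⟨h₁, ?_, h₂, ?_⟩
  · by_contra h
    rw [square_eq_none_of_height_le _ (by omega)] at h₃
    cases h₃
  · by_contra h
    rw [square_eq_none_of_width_le _ (by omega)] at h₃
    cases h₃

theorem Gameboard.Inside.near (hx : B.Inside x) (hd : 1 ≤ d) : B.Near d x := by
  obtain ⟨h₁, h₂, h₃, h₄⟩ := hx
  constructor <;> omega

/-- The induction lets the board vary, since each write replaces it; width and height stay, so the
remaining offsets still lead inside. -/
theorem sem_fillSquares (hb : b.Ready B) (hd : 1 ≤ d) (hx : B.Near d x) {l : List (ℤ × ℤ)}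
    (hl : ∀ v ∈ l, B.Inside (x + v)) :
    Sem yes (fillSquares d l) (b.on d B x) t ↔
      t = b.on d (B.fill (l.map fun v => x + v)) x := by
  induction l generalizing B with
  | nil => simp [fillSquares, sem_one, Gameboard.fill_nil]
  | cons v l ih =>
    rw [List.forall_mem_cons] at hl
    have hv := hl.1
    have hn := hv.near hd
    have hw : Sem yes (write d v (some true)) (b.on d B x) = fun t =>
        t = b.on d (B.fill [x + v]) x := by
      funext t
      rw [St.on, sem_write hb.aux hx.toNat_lt.le (by rw [hb.width]; exact hx.within hn), hb.width,
        B.target_index d hx.nonneg, Gameboard.set_cells hv.row_ge hv.row_le hv.col_ge hv.col_le]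
      · rfl
      · rw [hb.width, B.target_index d hx.nonneg]
        have := hn.toNat_lt
        have := hn.nonneg
        omega
    rw [fillSquares, List.map_cons, List.prod_cons, ← fillSquares, sem_mul, hw]
    simp only [exists_eq_left]
    rw [ih (hb.fill _) (hx.fill _) fun v hv => (hl.2 v hv).fill _, ← Gameboard.fill_append]
    rfl

theorem linear_fillSquares (l : List (ℤ × ℤ)) : Linear yes (fillSquares d l : Prog tm) :=
  .list_prod l fun _ _ => linear_write _ _

/-! ### The initial position -/

/-- Move right by half the width of the gameboard. -/
def halfRight : Prog tm := (tick * tick * moveRight)∗ * (1 + tick) * reset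

theorem sem_half_pow {T : List (Option Bool)} {i : ℕ} (hi : i ≤ T.length) :
    Sem yes ((tick * tick * moveRight) ^ k) (s.tape T i) t ↔
      2 * k ≤ s.width ∧ i + k ≤ T.length ∧
        t = { s with width := s.width - 2 * k, aux := s.aux + 2 * k }.tape T (i + k) := by
  induction k generalizing s i with
  | zero => simp [sem_one, hi]
  | succ k ih =>
    simp only [sem_pow_succ, sem_mul, sem_tick]
    have e (s : St tm) (a c a' c' : ℕ) : ({ ({ s.tape T i with width := a, aux := c } : St tm) with
      width := a', aux := c' } : St tm) = { s with width := a', aux := c' }.tape T i := rfl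
    constructor
    · rintro ⟨_, ⟨_, ⟨_, ⟨h₁, rfl⟩, h₂, rfl⟩, h₃⟩, h₄⟩
      replace h₁ : 0 < s.width := h₁
      replace h₂ : 0 < s.width - 1 := h₂
      rw [e] at h₃
      obtain ⟨hi', rfl⟩ := sem_moveRight_tape.1 h₃
      obtain ⟨h₅, h₆, rfl⟩ := (ih (show i + 1 ≤ T.length from hi')).1 h₄
      replace h₅ : 2 * k ≤ s.width - 1 - 1 := h₅
      refine ⟨by omega, by omega, ?_⟩
      rw [add_comm k 1, ← add_assoc]
      ext1 <;> simp [St.tape] <;> omega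
    · rintro ⟨h₁, h₂, rfl⟩
      have h₃ : 0 < s.width := by omega
      have h₄ : 0 < s.width - 1 := by omega
      have h₅ : i < T.length := by omega
      have h₆ : 2 * k ≤ s.width - 1 - 1 := by omega
      refine ⟨_, ⟨_, ⟨_, ⟨h₃, rfl⟩, h₄, rfl⟩, ?_⟩, (ih (s := { s with
          width := s.width - 1 - 1, aux := s.aux + 1 + 1 }) (show i + 1 ≤ T.length from h₅)).2
            ⟨h₆, by omega, ?_⟩⟩
      · rw [e]
        exact sem_moveRight_tape.2 ⟨h₅, rfl⟩
      · rw [add_comm k 1, ← add_assoc]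
        ext1 <;> simp [St.tape] <;> omega

/-- Each iteration counts two columns and moves once; the optional extra tick absorbs an odd column,
and `reset` forces all columns to be counted. The result is the rounded-down half of the width. -/
theorem sem_halfRight {T : List (Option Bool)} {i : ℕ} (ha : s.aux = 0) (hi : i ≤ T.length) :
    Sem yes halfRight (s.tape T i) t ↔
      i + s.width / 2 ≤ T.length ∧ t = s.tape T (i + s.width / 2) := by
  simp only [halfRight, sem_mul, sem_kstar, sem_add, sem_one, sem_reset, sem_tick,
    sem_half_pow hi]
  constructor
  · rintro ⟨_, ⟨_, ⟨k, h₁, h₂, rfl⟩, rfl | ⟨h, rfl⟩⟩, h₃, rfl⟩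
    · replace h₃ : s.width - 2 * k = 0 := h₃
      obtain rfl : k = s.width / 2 := by omega
      refine ⟨h₂, ?_⟩
      ext1 <;> simp [St.tape] <;> omega
    · replace h₃ : s.width - 2 * k - 1 = 0 := h₃
      replace h : 0 < s.width - 2 * k := h
      obtain rfl : k = s.width / 2 := by omega
      refine ⟨h₂, ?_⟩
      ext1 <;> simp [St.tape] <;> omega
  · rintro ⟨h₂, rfl⟩
    rcases Nat.even_or_odd' s.width with ⟨j, hj | hj⟩
    · have hk : s.width / 2 = j := by omega
      refine ⟨_, ⟨_, ⟨j, by omega, by omega, rfl⟩, Or.inl rfl⟩, ?_, ?_⟩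
      · simp [St.tape, hj]
      · ext1 <;> simp [St.tape, hk] <;> omega
    · have hk : s.width / 2 = j := by omega
      refine ⟨_, ⟨_, ⟨j, by omega, by omega, rfl⟩, Or.inr ⟨?_, rfl⟩⟩, ?_, ?_⟩
      · simp [St.tape, hj]
      · simp [St.tape, hj]
      · ext1 <;> simp [St.tape, hk] <;> omega

/-- Every store can be viewed as a tape, so facts about tapes apply to stores that are not known to
hold a gameboard, as `Steady` requires. -/
theorem St.eq_tape (s : St tm) : s = s.tape (s.left.reverse ++ s.right) s.left.length := by
  have h := List.length_reverse (as := s.left)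
  ext1 <;> try rfl
  · simp only [St.tape]
    rw [← h, List.take_left, List.reverse_reverse]
  · simp only [St.tape]
    rw [← h, List.drop_left]

theorem linear_halfRight : Linear yes (halfRight : Prog tm) := by
  -- Six actions for every two columns, at most two for an odd column, and `2 * n + 2` for the
  -- reset: at most `5 * n + 4` in all.
  refine ⟨8, fun n s t hw ha h => ?_⟩
  have hi : s.left.length ≤ (s.left.reverse ++ s.right).length := by simp
  have h' := h
  rw [s.eq_tape] at h'
  obtain ⟨-, rfl⟩ := (sem_halfRight ha hi).1 h'
  refine ⟨hw, ha, ?_⟩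
  obtain ⟨u, h₁, h₂⟩ := sem_mul.1 h
  obtain ⟨v, h₁, h₃⟩ := sem_mul.1 h₁
  obtain ⟨k, h₁⟩ := sem_kstar.1 h₁
  have h₁' := h₁
  rw [s.eq_tape] at h₁'
  obtain ⟨hk, -, rfl⟩ := (sem_half_pow hi).1 h₁'
  have hu : u.aux ≤ n := by
    rcases sem_add.1 h₃ with h | h
    · rw [sem_one.1 h]
      simp only [St.tape, ha]
      omega
    · obtain ⟨h', rfl⟩ := sem_tick.1 h
      replace h' : 0 < s.width - 2 * k := h'
      change s.aux + 2 * k + 1 ≤ n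
      omega
  refine (((((short_tick.mul short_tick).mul short_moveRight).pow _ _ _ h₁).kstar.mul
    ((short_one.add short_tick) _ _ h₃)).mul (exec_reset h₂ n hu)).mono ?_
  simp only [zero_le, sup_of_le_right]
  omega

end Tetris

namespace Tetris

variable {tm : FinTM2} {yes : tm.Γ tm.k₁} {p q : Prog tm} {m n d k : ℕ} {s t u b : St tm}
  {B : Gameboard}

/-! ### Piece states on the tape -/

/-- The store with the gameboard `B` on the tape, the head at the position of the piece, and the
orientation of the piece on the stack `ori`. -/
def St.piece (b : St tm) (d : ℕ) (B : Gameboard) (P : PieceState) : St tm :=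
  { b with ori := [P.orientation] }.on d B P.position

/-- A gridsquare on or next to the gameboard. -/
structure Gameboard.Around (B : Gameboard) (x : ℤ × ℤ) : Prop where
  row_ge : -1 ≤ x.1
  row_le : x.1 ≤ B.height + 1
  col_ge : 0 ≤ x.2
  col_le : x.2 ≤ B.width + 1

theorem Gameboard.Inside.around {x : ℤ × ℤ} (hx : B.Inside x) : B.Around x := by
  obtain ⟨h₁, h₂, h₃, h₄⟩ := hx
  constructor <;> omega

/-- The tightest side is the bottom: row `-1` lowered by `e` must not fall below `2 - d`, which
gives the margin `3`. -/
theorem Gameboard.Around.near {x v : ℤ × ℤ} {e : ℕ} (hx : B.Around x) (hv : Tetris.Near e v)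
    (he : e + 3 ≤ d) : B.Near d (x + v) := by
  obtain ⟨h₁, h₂, h₃, h₄⟩ := hx
  obtain ⟨h₅, h₆⟩ := hv
  rw [abs_le] at h₅ h₆
  constructor <;> simp only [Prod.fst_add, Prod.snd_add] <;> omega

theorem Gameboard.Around.near_self {x : ℤ × ℤ} (hx : B.Around x) (hd : 3 ≤ d) : B.Near d x := by
  obtain ⟨h₁, h₂, h₃, h₄⟩ := hx
  constructor <;> omega

theorem zero_mem_offsets (t : PieceType) (o : ZMod 4) : (0, 0) ∈ t.offsets o := by
  revert o
  cases t <;> decide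

/-- In every orientation the piece occupies its own position, so a fitting piece is positioned on
the board. This keeps the head of the tape in range and also underlies the count of piece states. -/
theorem Gameboard.Fits.inside {P : PieceState} (h : B.Fits P) : B.Inside P.position := by
  refine inside_of_not_filled ?_
  have := h (P.position + (0, 0)) (List.mem_map.2 ⟨_, zero_mem_offsets _ _, rfl⟩)
  rwa [show ((0, 0) : ℤ × ℤ) = 0 from rfl, add_zero] at this

theorem fits_shift {P : PieceState} {v : ℤ × ℤ} : B.Fits (P.shift v) ↔
    ∀ w ∈ (P.type.offsets P.orientation).map (fun x => v + x), ¬ B.Filled (P.position + w) := by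
  simp only [Gameboard.Fits, PieceState.squares, PieceState.shift, List.forall_mem_map, add_assoc]

theorem fits_iff {P : PieceState} : B.Fits P ↔
    ∀ w ∈ P.type.offsets P.orientation, ¬ B.Filled (P.position + w) := by
  simp only [Gameboard.Fits, PieceState.squares, List.forall_mem_map]

theorem not_fits_shift {P : PieceState} {v : ℤ × ℤ} : ¬ B.Fits (P.shift v) ↔
    ∃ w ∈ (P.type.offsets P.orientation).map (fun x => v + x), B.Filled (P.position + w) := by
  simp only [fits_shift, not_forall, not_not, exists_prop]

/-- The `6` is `1` for the translation, `2` for the reach of a piece from its position and `3` for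
the margin in `Around.near`. -/
theorem near_shift_offsets {P : PieceState} {v : ℤ × ℤ} (hP : B.Around P.position)
    (hv : Near 1 v) (hd : 6 ≤ d) :
    ∀ w ∈ (P.type.offsets P.orientation).map (fun x => v + x), B.Near d (P.position + w) := by
  simp only [List.forall_mem_map]
  intro w hw
  refine hP.near (e := 3) ?_ hd
  obtain ⟨h₁, h₂⟩ := offsets_near _ _ w hw
  obtain ⟨h₃, h₄⟩ := hv
  rw [abs_le] at h₁ h₂ h₃ h₄
  constructor <;> rw [abs_le] <;> simp only [Prod.fst_add, Prod.snd_add] <;> push_cast at * <;> omega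

/-! ### Translations -/

/-- Translate a piece by `v`, recording the move `μ`. -/
def translate (d : ℕ) (l : List (ℤ × ℤ)) (o : ZMod 4) (μ : Move) (v : ℤ × ℤ) : Prog tm :=
  checkFree d (l.map fun x => v + x) * shift d v * push .out (.move μ) * push .ori o

/-- The store with a move recorded. -/
def St.record (b : St tm) (μ : Move) : St tm := { b with out := .move μ :: b.out }

theorem St.Ready.record (hb : b.Ready B) (μ : Move) : (b.record μ).Ready B := ⟨hb.width, hb.aux⟩

theorem sem_pop_ori {P : PieceState} {o : ZMod 4} : Sem yes (pop .ori o) (b.piece d B P) t ↔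
    P.orientation = o ∧ t = { b with ori := [] }.on d B P.position := by
  rw [sem_pop]
  constructor
  · rintro ⟨l, h, rfl⟩
    replace h : [P.orientation] = o :: l := h
    obtain ⟨h', rfl⟩ := List.cons.inj h
    exact ⟨h', rfl⟩
  · rintro ⟨rfl, rfl⟩
    exact ⟨[], rfl, rfl⟩

theorem sem_record {x : ℤ × ℤ} {μ : Move} {o : ZMod 4} (h : b.ori = []) :
    Sem yes (push .out (.move μ) * push .ori o) (b.on d B x) t ↔
      t = { b.record μ with ori := [o] }.on d B x := by
  simp only [sem_mul, sem_push, exists_eq_left]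
  simp [St.set, St.get, St.on, St.tape, St.record, h]

theorem sem_translate {P : PieceState} {μ : Move} {v : ℤ × ℤ} (hb : b.Ready B)
    (hP : B.Around P.position) (hv : Near 1 v) (hd : 6 ≤ d) :
    Sem yes (translate d (P.type.offsets P.orientation) P.orientation μ v)
        ({ b with ori := [] }.on d B P.position) t ↔
      B.Fits (P.shift v) ∧ t = (b.record μ).piece d B (P.shift v) := by
  have hb' : ({ b with ori := [] } : St tm).Ready B := ⟨hb.width, hb.aux⟩
  have hn := hP.near_self (d := d) (by omega)
  rw [translate, mul_assoc, sem_mul]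
  simp only [sem_mul (p := checkFree _ _),
    sem_checkFree hb' hn (near_shift_offsets hP hv hd), ← fits_shift]
  constructor
  · rintro ⟨_, ⟨_, ⟨h, rfl⟩, h'⟩, h''⟩
    rw [sem_shift_on hb' hn (hP.near hv (by omega))] at h'
    subst h'
    rw [sem_record rfl] at h''
    exact ⟨h, h''⟩
  · rintro ⟨h, rfl⟩
    exact ⟨_, ⟨_, ⟨h, rfl⟩, (sem_shift_on hb' hn (hP.near hv (by omega))).2 rfl⟩,
      (sem_record rfl).2 rfl⟩

theorem linear_translate (l : List (ℤ × ℤ)) (o : ZMod 4) (μ : Move) (v : ℤ × ℤ) :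
    Linear yes (translate d l o μ v : Prog tm) :=
  (((linear_checkFree _).mul (linear_shift _)).mul (linear_push (by simp) (by simp))).mul
    (linear_push (by simp) (by simp))

/-! ### Rotations -/

variable (R : RotationModel)

/-- The constant of a rotation model. -/
noncomputable def RotationModel.radius : ℕ := R.isLocal.choose

/-- Locality gives the displacement directly. It gives the orientation through legality: both
rotations are illegal and keep it, or both are legal and change it by the same angle. -/
theorem RotationModel.rotate_congr {P Q : PieceState} {θ : Rotation} {B C : Gameboard}
    (ht : P.type = Q.type) (ho : P.orientation = Q.orientation) (hf : P.fixed = Q.fixed)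
    (hv : ∀ v, Near R.radius v → (B.Filled (P.position + v) ↔ C.Filled (Q.position + v))) :
    (R.rotate P θ B).position - P.position = (R.rotate Q θ C).position - Q.position ∧
      (R.rotate P θ B).orientation = (R.rotate Q θ C).orientation := by
  obtain ⟨h₁, h₂⟩ := R.isLocal.choose_spec.1 P Q θ B C ht ho hf hv
  refine ⟨h₂, ?_⟩
  by_cases h : R.rotate P θ B = P
  · rw [h, h₁.1 h, ho]
  · have h' := mt h₁.2 h
    rw [((R.legal_or_eq P θ B).resolve_left h).2.1, ((R.legal_or_eq Q θ C).resolve_left h').2.1, ho]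

theorem RotationModel.type_rotate (P : PieceState) (θ : Rotation) (B : Gameboard) :
    (R.rotate P θ B).type = P.type := by
  rcases R.legal_or_eq P θ B with h | h
  · rw [h]
  · exact h.1

theorem RotationModel.fixed_rotate (P : PieceState) (θ : Rotation) (B : Gameboard) :
    (R.rotate P θ B).fixed = P.fixed := by
  rcases R.legal_or_eq P θ B with h | h
  · rw [h]
  · exact h.2.2

theorem RotationModel.fits_rotate {P : PieceState} (hP : B.Fits P) (θ : Rotation) :
    B.Fits (R.rotate P θ B) := by
  by_cases h : R.rotate P θ B = P
  · rwa [h]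
  · exact R.fits P θ B h

/-- The offsets at distance at most `e`. -/
noncomputable def nearSquares (e : ℕ) : Finset (ℤ × ℤ) := Finset.Icc (-e : ℤ) e ×ˢ Finset.Icc (-e : ℤ) e

theorem mem_nearSquares {e : ℕ} {v : ℤ × ℤ} : v ∈ nearSquares e ↔ Near e v := by
  simp only [nearSquares, Finset.mem_product, Finset.mem_Icc, Near, abs_le]

/-- The gameboard has the pattern `π` around the gridsquare `x`. -/
def Gameboard.Matches (B : Gameboard) (x : ℤ × ℤ) {e : ℕ} (π : nearSquares e → Bool) : Prop :=
  ∀ v, B.Filled (x + v.1) ↔ π v = true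

/-- Check that the gameboard has the pattern `π`. -/
noncomputable def checkPattern (d : ℕ) {e : ℕ} (π : nearSquares e → Bool) : Prog tm :=
  ((Finset.univ.toList : List (nearSquares e)).map fun v =>
    look d v.1 fun c => (c = some false ↔ π v = false)).prod

theorem sem_checkPattern {x : ℤ × ℤ} {e : ℕ} {π : nearSquares e → Bool} (hb : b.Ready B)
    (hx : B.Around x) (hd : e + 3 ≤ d) :
    Sem yes (checkPattern d π) (b.on d B x) t ↔ B.Matches x π ∧ t = b.on d B x := by
  have key (l : List (nearSquares e)) :
      Sem yes (l.map fun v => look d v.1 fun c => (c = some false ↔ π v = false)).prod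
        (b.on d B x) t ↔ (∀ v ∈ l, B.Filled (x + v.1) ↔ π v = true) ∧ t = b.on d B x := by
    induction l with
    | nil => simp [sem_one]
    | cons v l ih =>
      rw [List.map_cons, List.prod_cons, sem_mul]
      have hv := hx.near (mem_nearSquares.1 v.2) hd
      have hQ (c : Option Bool) (hc : c = some false ↔ ¬ B.Filled (x + v.1)) :
          (c = some false ↔ π v = false) ↔ (B.Filled (x + v.1) ↔ π v = true) := by
        rw [hc]; cases π v <;> simp
      have hs u := sem_look_on (yes := yes) (t := u) hb (hx.near_self (by omega)) hv _ _ hQ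
      simp only [hs, List.forall_mem_cons, and_assoc]
      constructor
      · rintro ⟨_, h, rfl, h'⟩
        exact ⟨h, ih.1 h'⟩
      · rintro ⟨h, h'⟩
        exact ⟨_, h, rfl, ih.2 h'⟩
  rw [checkPattern, key]
  simp [Gameboard.Matches]

open Classical in
/-- The displacement and the new orientation after a rotation, depending on the pattern around the
piece. -/
noncomputable def RotationModel.outcome (t : PieceType) (o : ZMod 4) (θ : Rotation)
    (π : nearSquares R.radius → Bool) : (ℤ × ℤ) × ZMod 4 :=
  if h : ∃ PB : PieceState × Gameboard, PB.1.type = t ∧ PB.1.orientation = o ∧ PB.1.fixed = false ∧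
      PB.2.Matches PB.1.position π then
    ((R.rotate h.choose.1 θ h.choose.2).position - h.choose.1.position,
      (R.rotate h.choose.1 θ h.choose.2).orientation)
  else 0

/-- The table entry was computed from some arbitrarily chosen piece state and board with this
pattern; by `rotate_congr` the choice does not matter. The actual situation shows that such a choice
exists, so the default value `0` is never used here. -/
theorem RotationModel.outcome_eq {P : PieceState} (hP : P.fixed = false) (θ : Rotation)
    {π : nearSquares R.radius → Bool} (hπ : B.Matches P.position π) :
    R.outcome P.type P.orientation θ π =
      ((R.rotate P θ B).position - P.position, (R.rotate P θ B).orientation) := by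
  have h : ∃ PB : PieceState × Gameboard, PB.1.type = P.type ∧ PB.1.orientation = P.orientation ∧
      PB.1.fixed = false ∧ PB.2.Matches PB.1.position π := ⟨⟨P, B⟩, rfl, rfl, hP, hπ⟩
  rw [outcome, dif_pos h]
  obtain ⟨h₁, h₂, h₃, h₄⟩ := h.choose_spec
  have h₅ := R.rotate_congr (θ := θ) h₁ h₂ (h₃.trans hP.symm) fun v hv =>
    (h₄ ⟨v, mem_nearSquares.2 hv⟩).trans (hπ ⟨v, mem_nearSquares.2 hv⟩).symm
  exact Prod.ext h₅.1 h₅.2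

/-- Rotate a piece. -/
noncomputable def turn (d : ℕ) (t : PieceType) (o : ZMod 4) (θ : Rotation) : Prog tm :=
  ⨆ π : nearSquares R.radius → Bool, checkPattern d π * shift d (R.outcome t o θ π).1 *
    push .out (.move (.rotate θ)) * push .ori (R.outcome t o θ π).2

/-- The program guesses the pattern around the piece, verifies it square by square and applies the
table entry. An illegal rotation needs no separate treatment: its entry has displacement zero and
the old orientation, and the attempt is still recorded as a move. -/
theorem sem_turn {P : PieceState} {θ : Rotation} (hb : b.Ready B)
    (hP : B.Fits P) (hf : P.fixed = false) (hd : R.radius + 3 ≤ d) :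
    Sem yes (turn R d P.type P.orientation θ) ({ b with ori := [] }.on d B P.position) t ↔
      t = (b.record (.rotate θ)).piece d B (R.rotate P θ B) := by
  have hb' : ({ b with ori := [] } : St tm).Ready B := ⟨hb.width, hb.aux⟩
  have ha := hP.inside.around
  have hn := ha.near_self (d := d) (by omega)
  have hn' := (R.fits_rotate hP θ).inside.around.near_self (d := d) (by omega)
  simp only [turn, mul_assoc, sem_iSup]
  simp only [sem_mul (p := checkPattern _ _), sem_checkPattern hb' ha hd]
  have key (π : nearSquares R.radius → Bool) (hπ : B.Matches P.position π) :
      Sem yes (shift d (R.outcome P.type P.orientation θ π).1 * (push .out (.move (.rotate θ)) *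
        push .ori (R.outcome P.type P.orientation θ π).2))
          ({ b with ori := [] }.on d B P.position) t ↔
      t = (b.record (.rotate θ)).piece d B (R.rotate P θ B) := by
    rw [R.outcome_eq hf θ hπ, sem_mul]
    simp only
    have e : P.position + ((R.rotate P θ B).position - P.position) = (R.rotate P θ B).position :=
      add_sub_cancel _ _
    simp only [sem_shift_on hb' hn (v := (R.rotate P θ B).position - P.position) (by rwa [e]),
      exists_eq_left, e]
    rw [sem_record rfl]
    rfl
  constructor
  · rintro ⟨π, _, ⟨hπ, rfl⟩, h⟩
    exact (key π hπ).1 h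
  · intro h
    classical
    have hπ : B.Matches P.position (e := R.radius) fun v => decide (B.Filled (P.position + v.1)) :=
      fun v => by simp
    exact ⟨_, _, ⟨hπ, rfl⟩, (key _ hπ).2 h⟩

theorem linear_turn (t : PieceType) (o : ZMod 4) (θ : Rotation) :
    Linear yes (turn R d t o θ : Prog tm) :=
  .iSup fun _ => (((Linear.list_prod _ fun _ _ => linear_look _ _).mul (linear_shift _)).mul
    (linear_push (by simp) (by simp))).mul (linear_push (by simp) (by simp))

/-! ### Moves -/

/-- One move of an unfixed piece, other than fixing it. -/
noncomputable def moveOnce (d : ℕ) (t : PieceType) : Prog tm :=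
  ⨆ o, pop .ori o * (translate d (t.offsets o) o .left (0, -1) +
    translate d (t.offsets o) o .right (0, 1) + translate d (t.offsets o) o .drop (-1, 0) +
    ⨆ θ, turn R d t o θ)

theorem sem_moveOnce {P : PieceState} (hb : b.Ready B) (hP : B.Fits P) (hf : P.fixed = false)
    (hd : R.radius + 6 ≤ d) :
    Sem yes (moveOnce R d P.type) (b.piece d B P) t ↔
      ∃ μ ≠ .fix, LegalMove B P μ ∧ t = (b.record μ).piece d B (nextState R B P μ) := by
  have ha := hP.inside.around
  have hl := sem_translate (yes := yes) (t := t) (μ := .left) (v := (0, -1)) hb ha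
    (by simp [Near]) (show 6 ≤ d by omega)
  have hr := sem_translate (yes := yes) (t := t) (μ := .right) (v := (0, 1)) hb ha
    (by simp [Near]) (show 6 ≤ d by omega)
  have hd' := sem_translate (yes := yes) (t := t) (μ := .drop) (v := (-1, 0)) hb ha
    (by simp [Near]) (show 6 ≤ d by omega)
  have hθ (θ : Rotation) := sem_turn (yes := yes) (t := t) R (θ := θ) hb hP hf
    (show R.radius + 3 ≤ d by omega)
  simp only [moveOnce, sem_iSup, sem_mul, sem_pop_ori, and_assoc, exists_and_left, exists_eq_left',
    exists_eq_left, sem_add, hl, hr, hd', hθ]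
  constructor
  · rintro (((⟨h, rfl⟩ | ⟨h, rfl⟩) | ⟨h, rfl⟩) | ⟨θ, rfl⟩)
    exacts [⟨.left, by simp, ⟨hf, h⟩, rfl⟩, ⟨.right, by simp, ⟨hf, h⟩, rfl⟩,
      ⟨.drop, by simp, ⟨hf, h⟩, rfl⟩, ⟨.rotate θ, by simp, hf, rfl⟩]
  · rintro ⟨θ | _ | _ | _ | _, h, h', rfl⟩
    exacts [Or.inr ⟨θ, rfl⟩, Or.inl (Or.inl (Or.inl ⟨h'.2, rfl⟩)),
      Or.inl (Or.inl (Or.inr ⟨h'.2, rfl⟩)), Or.inl (Or.inr ⟨h'.2, rfl⟩), absurd rfl h]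

theorem linear_moveOnce (t : PieceType) : Linear yes (moveOnce R d t : Prog tm) :=
  .iSup fun _ => (linear_pop (by simp) (by simp)).mul
    ((((linear_translate _ _ _ _).add (linear_translate _ _ _ _)).add
      (linear_translate _ _ _ _)).add (.iSup fun _ => linear_turn R _ _ _))

theorem fits_nextState {P : PieceState} {μ : Move} (hP : B.Fits P) (h : LegalMove B P μ) :
    B.Fits (nextState R B P μ) := by
  cases μ with
  | rotate θ => exact R.fits_rotate hP θ
  | left => exact h.2
  | right => exact h.2
  | drop => exact h.2
  | fix => exact hP

theorem type_nextState (P : PieceState) (μ : Move) : (nextState R B P μ).type = P.type := by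
  cases μ <;> first | rfl | exact R.type_rotate _ _ _

theorem fixed_nextState (P : PieceState) {μ : Move} (hμ : μ ≠ .fix) :
    (nextState R B P μ).fixed = P.fixed := by
  cases μ <;> first | rfl | exact R.fixed_rotate _ _ _ | exact absurd rfl hμ

/-- The type of the piece is a parameter of the program, not part of the store; the induction works
because no move changes it. -/
theorem sem_moveOnce_pow {P : PieceState} (hb : b.Ready B) (hP : B.Fits P) (hf : P.fixed = false)
    (hd : R.radius + 6 ≤ d) :
    Sem yes (moveOnce R d P.type ^ k) (b.piece d B P) t ↔
      ∃ σ : List Move, σ.length = k ∧ .fix ∉ σ ∧ LegalFrom R B P σ ∧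
        t = { b with out := (σ.map Symbol.move).reverse ++ b.out }.piece d B
          (σ.foldl (nextState R B) P) := by
  induction k generalizing b P with
  | zero =>
    rw [sem_pow_zero]
    constructor
    · rintro rfl
      exact ⟨[], rfl, by simp, trivial, rfl⟩
    · rintro ⟨σ, h, -, -, rfl⟩
      obtain rfl := List.length_eq_zero_iff.1 h
      rfl
  | succ k ih =>
    rw [sem_pow_succ]
    simp only [sem_moveOnce R hb hP hf hd]
    constructor
    · rintro ⟨_, ⟨μ, hμ, h, rfl⟩, h'⟩
      rw [← type_nextState R (B := B) P μ] at h'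
      obtain ⟨σ, h₁, h₂, h₃, rfl⟩ := (ih (hb.record μ) (fits_nextState R hP h)
        ((fixed_nextState R P hμ).trans hf)).1 h'
      refine ⟨μ :: σ, by simp [h₁], by simp [h₂, hμ.symm], ⟨h, h₃⟩, ?_⟩
      simp [St.record]
    · rintro ⟨_ | ⟨μ, σ⟩, h₁, h₂, h₃, rfl⟩
      · simp at h₁
      · simp only [List.mem_cons, not_or] at h₂
        refine ⟨_, ⟨μ, Ne.symm h₂.1, h₃.1, rfl⟩, ?_⟩
        rw [← type_nextState R (B := B) P μ]
        refine (ih (hb.record μ) (fits_nextState R hP h₃.1)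
          ((fixed_nextState R P (Ne.symm h₂.1)).trans hf)).2 ⟨σ, by simpa using h₁, h₂.2, h₃.2, ?_⟩
        simp [St.record]

end Tetris

namespace Tetris

variable {tm : FinTM2} {yes : tm.Γ tm.k₁} {p q : Prog tm} {m n d k : ℕ} {s t u b : St tm}
  {B : Gameboard} {r : List Bool} {c : tm.Cfg}

/-! ### Clearing full rows -/

/-- Move the head to the first row. -/
def goHome (d : ℕ) : Prog tm :=
  moveLeft∗ * empty .left * (forWidth moveRight * moveRight ^ d) ^ d

theorem sem_goHome {T : List (Option Bool)} {i : ℕ} (ha : s.aux = 0) (hi : i ≤ T.length)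
    (hT : d * (s.width + d) ≤ T.length) :
    Sem yes (goHome d) (s.tape T i) t ↔ t = s.tape T (d * (s.width + d)) := by
  simp only [goHome, sem_mul (q := _ ^ d), sem_mul (p := moveLeft∗), sem_kstar,
    sem_moveLeft_pow hi, sem_empty]
  have key : Sem yes ((forWidth moveRight * moveRight ^ d) ^ d) (s.tape T 0) t ↔
      t = s.tape T (d * (s.width + d)) := by
    rw [sem_rowRight_pow ha (Nat.zero_le _), zero_add]
    exact and_iff_right hT
  rw [← key]
  constructor
  -- Emptiness of the left stack means that the head is at index `0`, or that the whole tape is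
  -- empty and the index is immaterial.
  · rintro ⟨_, ⟨_, ⟨k, hk, rfl⟩, h, rfl⟩, h'⟩
    replace h : (T.take (i - k)).reverse = [] := h
    rw [List.reverse_eq_nil_iff, List.take_eq_nil_iff] at h
    have : s.tape T (i - k) = s.tape T 0 := by
      rcases h with h | rfl
      · rw [h]
      · simp [St.tape]
    rwa [this] at h'
  · intro h
    refine ⟨_, ⟨_, ⟨i, le_rfl, rfl⟩, ?_, rfl⟩, by rwa [Nat.sub_self]⟩
    simp [St.tape, St.get]

theorem exec_goHome {T : List (Option Bool)} {i : ℕ} (ha : s.aux = 0) (hi : i ≤ T.length)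
    (hT : d * (s.width + d) ≤ T.length) :
    Exec yes (goHome d) (T.length * 2 + 1 + d * (s.width * 6 + 2 + d * 2)) (s.tape T i)
      (s.tape T (d * (s.width + d))) := by
  obtain ⟨u, h₁, h₂⟩ := sem_mul.1 ((sem_goHome (yes := yes) ha hi hT).2 rfl)
  obtain ⟨v, h₀, h₃⟩ := sem_mul.1 h₁
  obtain ⟨k, h₀⟩ := sem_kstar.1 h₀
  obtain ⟨hk, rfl⟩ := (sem_moveLeft_pow hi).1 h₀
  obtain ⟨-, rfl⟩ := sem_empty.1 h₃
  have h₄ := (((steady_forWidth (n := s.width) uncounted_moveRight short_moveRight).mul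
    ((uncounted_moveRight.steady short_moveRight _).pow d)).pow d) (s.tape T (i - k)) _ rfl ha h₂
  refine (((short_moveLeft.pow _ _ _ h₀).kstar.mul h₃.exec_act).mul h₄.2.2).mono ?_
  have : k ≤ T.length := hk.trans hi
  gcongr

/-- Keep a gridsquare. -/
def keepSquare (a : Bool) : Prog tm :=
  pop .right (some a) * push .left (some a) * push .out (.square a)

/-- Keep a row that is not full. -/
def keepRow (d : ℕ) : Prog tm :=
  overRow (withSquare false) keepSquare * (pop .right none * push .left none) ^ d *
    push .out .endOfRow

/-- Drop and count a full row. -/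
def dropRow (d : ℕ) : Prog tm :=
  overRow (constRow true) (fun a => pop .right (some a)) * pop .right none ^ d * push .full ()

theorem uncounted_keepSquare (a : Bool) : Uncounted yes (keepSquare a : Prog tm) :=
  ((uncounted_pop (by simp) (by simp)).mul (uncounted_push (by simp) (by simp))).mul
    (uncounted_push (by simp) (by simp))

theorem short_keepSquare (a : Bool) : Short yes (keepSquare a : Prog tm) 3 :=
  ((short_act _).mul (short_act _)).mul (short_act _)

theorem sem_word_keepSquare : Sem yes (word keepSquare r) s t ↔
    ∃ l, s.right = r.map some ++ l ∧ t = { s with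
      right := l
      left := (r.map some).reverse ++ s.left
      out := (r.map Symbol.square).reverse ++ s.out } := by
  induction r generalizing s with
  | nil =>
    simp only [word, List.map_nil, List.prod_nil, sem_one, List.nil_append, List.reverse_nil]
    exact ⟨fun h => ⟨_, rfl, h⟩, by rintro ⟨l, rfl, rfl⟩; rfl⟩
  | cons a r ih =>
    simp only [word_cons, keepSquare, sem_mul, sem_pop, sem_push, ih]
    constructor
    · rintro ⟨_, ⟨_, ⟨_, ⟨l, h, rfl⟩, rfl⟩, rfl⟩, l', h', rfl⟩
      replace h : s.right = some a :: l := h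
      replace h' : l = r.map some ++ l' := h'
      refine ⟨l', by rw [h, h']; rfl, ?_⟩
      simp [St.set, St.get]
    · rintro ⟨l, h, rfl⟩
      refine ⟨_, ⟨_, ⟨_, ⟨r.map some ++ l, h, rfl⟩, rfl⟩, rfl⟩, l, rfl, ?_⟩
      simp [St.set, St.get]

theorem sem_word_pop : Sem yes (word (fun a => pop .right (some a)) r) s t ↔
    ∃ l, s.right = r.map some ++ l ∧ t = { s with right := l } := by
  induction r generalizing s with
  | nil =>
    simp only [word, List.map_nil, List.prod_nil, sem_one, List.nil_append]
    exact ⟨fun h => ⟨_, rfl, h⟩, by rintro ⟨l, rfl, rfl⟩; rfl⟩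
  | cons a r ih =>
    simp only [word_cons, sem_mul, sem_pop, ih]
    constructor
    · rintro ⟨_, ⟨l, h, rfl⟩, l', h', rfl⟩
      replace h : s.right = some a :: l := h
      replace h' : l = r.map some ++ l' := h'
      exact ⟨l', by rw [h, h']; rfl, rfl⟩
    · rintro ⟨l, h, rfl⟩
      exact ⟨_, ⟨r.map some ++ l, h, rfl⟩, l, rfl, rfl⟩

theorem sem_keepBorder : Sem yes ((pop .right none * push .left none) ^ k) s t ↔
    ∃ l, s.right = List.replicate k none ++ l ∧ t = { s with
      right := l
      left := List.replicate k none ++ s.left } := by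
  induction k generalizing s with
  | zero =>
    simp only [sem_pow_zero, List.replicate_zero, List.nil_append]
    exact ⟨fun h => ⟨_, rfl, h⟩, by rintro ⟨l, rfl, rfl⟩; rfl⟩
  | succ k ih =>
    simp only [sem_pow_succ, sem_mul, sem_pop, sem_push, ih]
    constructor
    · rintro ⟨_, ⟨_, ⟨l, h, rfl⟩, rfl⟩, l', h', rfl⟩
      replace h : s.right = none :: l := h
      replace h' : l = List.replicate k none ++ l' := h'
      refine ⟨l', by rw [h, h']; rfl, ?_⟩
      simp [St.set, St.get, List.replicate_succ']
    · rintro ⟨l, h, rfl⟩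
      refine ⟨_, ⟨_, ⟨List.replicate k none ++ l, by rwa [List.replicate_succ] at h, rfl⟩, rfl⟩, l, rfl, ?_⟩
      simp [St.set, St.get, List.replicate_succ']

theorem sem_dropBorder : Sem yes (pop .right none ^ k) s t ↔
    ∃ l, s.right = List.replicate k none ++ l ∧ t = { s with right := l } := by
  induction k generalizing s with
  | zero =>
    simp only [sem_pow_zero, List.replicate_zero, List.nil_append]
    exact ⟨fun h => ⟨_, rfl, h⟩, by rintro ⟨l, rfl, rfl⟩; rfl⟩
  | succ k ih =>
    simp only [sem_pow_succ, sem_pop, ih]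
    constructor
    · rintro ⟨_, ⟨l, h, rfl⟩, l', h', rfl⟩
      replace h : s.right = none :: l := h
      replace h' : l = List.replicate k none ++ l' := h'
      exact ⟨l', by rw [h, h']; rfl, rfl⟩
    · rintro ⟨l, h, rfl⟩
      exact ⟨_, ⟨List.replicate k none ++ l, by rwa [List.replicate_succ] at h, rfl⟩, l, rfl, rfl⟩

theorem sem_keepRow (ha : s.aux = 0) : Sem yes (keepRow d) s t ↔
    ∃ r l, false ∈ r ∧ r.length = s.width ∧ s.right = padRow d r ++ l ∧ t = { s with
      right := l
      left := (padRow d r).reverse ++ s.left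
      out := (rowEncode r).reverse ++ s.out } := by
  simp only [keepRow, sem_mul (q := push _ _), sem_mul (q := _ ^ d),
    sem_overRow (isRowScheme_withSquare false) uncounted_keepSquare ha, sem_word_keepSquare,
    sem_keepBorder, sem_push]
  constructor
  · rintro ⟨_, ⟨_, ⟨r, hr, hl, l, h, rfl⟩, l', h', rfl⟩, rfl⟩
    replace h' : l = List.replicate d none ++ l' := h'
    refine ⟨r, l', hr, hl, by rw [h, h']; simp [padRow], ?_⟩
    simp [rowEncode, padRow, St.set, St.get]
  · rintro ⟨r, l, hr, hl, h, rfl⟩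
    refine ⟨_, ⟨_, ⟨r, hr, hl, List.replicate d none ++ l, by simp [h, padRow], rfl⟩, l, rfl,
      rfl⟩, ?_⟩
    simp [rowEncode, padRow, St.set, St.get]

theorem sem_dropRow (ha : s.aux = 0) : Sem yes (dropRow d) s t ↔
    ∃ r l, false ∉ r ∧ r.length = s.width ∧ s.right = padRow d r ++ l ∧
      t = { s with right := l, full := s.full + 1 } := by
  have hr (r : List Bool) : (∀ a ∈ r, a = true) ↔ false ∉ r := by
    constructor
    · intro h h'
      cases h _ h'
    · intro h a ha
      cases a
      · exact absurd ha h
      · rfl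
  simp only [dropRow, sem_mul (q := push _ _), sem_mul (q := _ ^ d),
    sem_overRow (isRowScheme_constRow true)
      (fun a => uncounted_pop (yes := yes) (k := .right) (a := some a) (by simp) (by simp)) ha,
    sem_word_pop, sem_dropBorder, sem_push, hr]
  constructor
  · rintro ⟨_, ⟨_, ⟨r, hr, hl, l, h, rfl⟩, l', h', rfl⟩, rfl⟩
    replace h' : l = List.replicate d none ++ l' := h'
    refine ⟨r, l', hr, hl, by rw [h, h']; simp [padRow], ?_⟩
    simp [St.set, St.get]
  · rintro ⟨r, l, hr, hl, h, rfl⟩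
    refine ⟨_, ⟨_, ⟨r, hr, hl, List.replicate d none ++ l, by simp [h, padRow], rfl⟩, l, rfl,
      rfl⟩, ?_⟩
    simp [St.set, St.get]

theorem linear_keepRow : Linear yes (keepRow d : Prog tm) :=
  ((linear_overRow (isRowScheme_withSquare false) uncounted_keepSquare short_keepSquare).mul
    (((linear_pop (by simp) (by simp)).mul (linear_push (by simp) (by simp))).pow d)).mul
    (linear_push (by simp) (by simp))

theorem linear_dropRow : Linear yes (dropRow d : Prog tm) :=
  ((linear_overRow (isRowScheme_constRow true) (fun _ => uncounted_pop (by simp) (by simp))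
    (fun _ => short_act _)).mul ((linear_pop (by simp) (by simp)).pow d)).mul
    (linear_push (by simp) (by simp))

theorem sem_rows_pow (ha : s.aux = 0) : Sem yes ((keepRow d + dropRow d) ^ k) s t ↔
    ∃ (rs : List (List Bool)) (l : List (Option Bool)), rs.length = k ∧
      (∀ r ∈ rs, r.length = s.width) ∧ s.right = (rs.map (padRow d)).flatten ++ l ∧ t = { s with
        right := l
        left := ((rs.filter (false ∈ ·)).map (padRow d)).flatten.reverse ++ s.left
        out := ((rs.filter (false ∈ ·)).flatMap rowEncode).reverse ++ s.out
        full := s.full + rs.countP (false ∉ ·) } := by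
  induction k generalizing s with
  | zero =>
    rw [sem_pow_zero]
    constructor
    · rintro rfl
      exact ⟨[], t.right, by simp⟩
    · rintro ⟨rs, l, hrs, -, h, rfl⟩
      obtain rfl := List.length_eq_zero_iff.1 hrs
      simp only [List.map_nil, List.flatten_nil, List.nil_append] at h
      subst h
      rfl
  | succ k ih =>
    simp only [sem_pow_succ, sem_add, sem_keepRow ha, sem_dropRow ha]
    constructor
    · rintro ⟨_, ⟨r, l, hr, hl, h, rfl⟩ | ⟨r, l, hr, hl, h, rfl⟩, h'⟩ <;>
        obtain ⟨rs, l', hk, hrs, e, rfl⟩ := (ih (by exact ha)).1 h' <;>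
        replace e : l = (rs.map (padRow d)).flatten ++ l' := e <;>
        refine ⟨r :: rs, l', by simp [hk], List.forall_mem_cons.2 ⟨hl, hrs⟩, by simp [h, e], ?_⟩
      · simp [hr]
      · simp [hr]
        omega
    · rintro ⟨_ | ⟨r, rs⟩, l, hk, hrs, h, rfl⟩
      · simp at hk
      rw [List.forall_mem_cons] at hrs
      have hk' : rs.length = k := by simpa using hk
      by_cases hr : false ∈ r
      · refine ⟨_, Or.inl ⟨r, (rs.map (padRow d)).flatten ++ l, hr, hrs.1, by simp [h], rfl⟩,
          (ih (by exact ha)).2 ⟨rs, l, hk', hrs.2, rfl, ?_⟩⟩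
        simp [hr]
      · refine ⟨_, Or.inr ⟨r, (rs.map (padRow d)).flatten ++ l, hr, hrs.1, by simp [h], rfl⟩,
          (ih (by exact ha)).2 ⟨rs, l, hk', hrs.2, rfl, ?_⟩⟩
        simp [hr]
        omega

/-- The rows on the tape end at the first border square that does not belong to a row. -/
theorem padRow_flatten_inj (hn : 0 < n) {rs rs' : List (List Bool)} {l l' : List (Option Bool)}
    (hrs : ∀ r ∈ rs, r.length = n) (hrs' : ∀ r ∈ rs', r.length = n)
    (h : (rs.map (padRow d)).flatten ++ none :: l = (rs'.map (padRow d)).flatten ++ none :: l') :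
    rs = rs' ∧ l = l' := by
  have key : ∀ (r : List Bool) (x y : List (Option Bool)), r.length = n →
      padRow d r ++ x ≠ none :: y := by
    rintro (_ | ⟨a, r⟩) x y hr h
    · simp at hr; omega
    · simp [padRow] at h
  induction rs generalizing rs' with
  | nil =>
    cases rs' with
    | nil => simpa using h
    | cons r rs' =>
      refine absurd h.symm ?_
      simpa using key r _ _ (hrs' r (by simp))
  | cons r rs ih =>
    cases rs' with
    | nil =>
      refine absurd h ?_
      simpa using key r _ _ (hrs r (by simp))
    | cons r' rs' =>
      rw [List.forall_mem_cons] at hrs hrs'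
      simp only [List.map_cons, List.flatten_cons, List.append_assoc] at h
      obtain ⟨h₁, h₂⟩ := List.append_inj h (by simp [padRow, hrs.1, hrs'.1])
      obtain ⟨h₁, -⟩ := List.append_inj h₁ (by simp [hrs.1, hrs'.1])
      obtain ⟨rfl, h₃⟩ := ih hrs.2 hrs'.2 h₂
      exact ⟨by rw [List.map_injective_iff.2 (Option.some_injective _) h₁], h₃⟩

/-- Put an empty row on top. -/
def newRow (d : ℕ) : Prog tm :=
  pop .full () * forWidth (push .left (some false) * push .out (.square false)) *
    push .left none ^ d * push .out .endOfRow

theorem sem_push_square_pow : Sem yes ((push .left (some false) * push .out (.square false)) ^ k) s t ↔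
    t = { s with
      left := List.replicate k (some false) ++ s.left
      out := List.replicate k (Symbol.square false) ++ s.out } := by
  induction k generalizing s with
  | zero => simp [sem_one]
  | succ k ih =>
    simp only [sem_pow_succ, sem_mul, sem_push, exists_eq_left, ih]
    simp [St.set, St.get, List.replicate_succ']

theorem sem_newRow (ha : s.aux = 0) : Sem yes (newRow d) s t ↔ 0 < s.full ∧ t = { s with
    full := s.full - 1
    left := (padRow d (List.replicate s.width false)).reverse ++ s.left
    out := (rowEncode (List.replicate s.width false)).reverse ++ s.out } := by
  have hu : Uncounted yes (push .left (some false) * push .out (.square false) : Prog tm) :=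
    (uncounted_push (by simp) (by simp)).mul (uncounted_push (by simp) (by simp))
  simp only [newRow, sem_mul (q := push _ _), sem_mul (q := _ ^ d), sem_mul (p := pop _ _), sem_pop]
  constructor
  · rintro ⟨_, ⟨_, ⟨_, ⟨l, h, rfl⟩, h₁⟩, h₂⟩, h₃⟩
    have hf := congrArg List.length h
    simp only [St.get, List.length_replicate, List.length_cons] at hf
    rw [sem_forWidth hu (by exact ha), sem_push_square_pow] at h₁
    subst h₁
    rw [sem_push_pow_left] at h₂
    subst h₂
    rw [sem_push] at h₃
    subst h₃
    refine ⟨by omega, ?_⟩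
    simp [St.set, St.get, padRow, rowEncode, hf]
  · rintro ⟨h, rfl⟩
    obtain ⟨j, hj⟩ := Nat.exists_eq_add_of_le' h
    refine ⟨_, ⟨_, ⟨_, ⟨List.replicate j (), ?_, rfl⟩,
      (sem_forWidth hu (by exact ha)).2 (sem_push_square_pow.2 rfl)⟩, sem_push_pow_left.2 rfl⟩,
      sem_push.2 ?_⟩
    · simp [St.get, hj, List.replicate_succ]
    · simp [St.set, St.get, padRow, rowEncode, hj]

theorem linear_newRow : Linear yes (newRow d : Prog tm) :=
  (((linear_pop (by simp) (by simp)).mul (linear_forWidth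
    ((uncounted_push (by simp) (by simp)).mul (uncounted_push (by simp) (by simp)))
    ((short_act _).mul (short_act _)))).mul ((linear_push (by simp) (by simp)).pow d)).mul
    (linear_push (by simp) (by simp))

theorem sem_newRow_pow (ha : s.aux = 0) : Sem yes (newRow d ^ k) s t ↔ k ≤ s.full ∧ t = { s with
    full := s.full - k
    left := ((List.replicate k (List.replicate s.width false)).map (padRow d)).flatten.reverse ++
      s.left
    out := ((List.replicate k (List.replicate s.width false)).flatMap rowEncode).reverse ++
      s.out } := by
  induction k generalizing s with
  | zero => simp [sem_one]
  | succ k ih =>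
    simp only [sem_pow_succ, sem_newRow ha]
    constructor
    · rintro ⟨_, ⟨h, rfl⟩, h'⟩
      obtain ⟨hk, rfl⟩ := (ih (by exact ha)).1 h'
      replace hk : k ≤ s.full - 1 := hk
      refine ⟨by omega, ?_⟩
      simp [List.replicate_succ]
      omega
    · rintro ⟨h, rfl⟩
      refine ⟨_, ⟨by omega, rfl⟩, (ih (by exact ha)).2 ⟨by simp only; omega, ?_⟩⟩
      simp [List.replicate_succ]
      omega

/-- Clear the full rows, writing the new gameboard on the stack `out`. -/
def sweep (d : ℕ) : Prog tm :=
  (keepRow d + dropRow d)∗ * (pop .right none * push .right none) * (newRow d)∗ * empty .full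

theorem padding_ne_nil (hd : 0 < d) : ∃ l, padding d n = none :: l := by
  have h : 0 < d * (n + d) := by positivity
  obtain ⟨j, hj⟩ := Nat.exists_eq_add_of_le' h
  exact ⟨List.replicate j none, by rw [padding, hj]; rfl⟩

theorem tape_first {inp rev out : List Symbol} :
    (St.home c d B inp rev out).tape (B.cells d) (d * (B.width + d)) =
      { St.home c d B inp rev out with
        left := padding d B.width
        right := (B.rows.map (padRow d)).flatten ++ padding d B.width } := by
  have h : (padding d B.width).length = d * (B.width + d) := by simp [padding]
  simp only [St.tape, Gameboard.cells, List.append_assoc]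
  rw [← h, List.take_left, List.drop_left]
  simp [padding]

theorem sem_checkBorder : Sem yes (pop .right none * push .right none) s t ↔
    (∃ l, s.right = none :: l) ∧ t = s := by
  simp only [sem_mul, sem_pop, sem_push]
  constructor
  · rintro ⟨_, ⟨l, h, rfl⟩, rfl⟩
    replace h : s.right = none :: l := h
    refine ⟨⟨l, h⟩, ?_⟩
    simp [St.set, St.get]
    rw [← h]
  · rintro ⟨⟨l, h⟩, rfl⟩
    refine ⟨_, ⟨l, h, rfl⟩, ?_⟩
    simp [St.set, St.get]
    rw [← h]

variable {inp rev out : List Symbol}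

/-- The number `j` of new rows is a variable because a run of `sweep` first guesses it and only
later proves it equal to the number of full rows. -/
theorem home_clear {j : ℕ} (hj : j = B.rows.countP (false ∉ ·)) :
    St.home c d B.clear inp rev (B.clear.encode.reverse ++ out) = { St.home c d B inp rev out with
      left := ((List.replicate j (List.replicate B.width false)).map (padRow d)).flatten.reverse ++
        (((B.rows.filter (false ∈ ·)).map (padRow d)).flatten.reverse ++ padding d B.width)
      out := ((List.replicate j (List.replicate B.width false)).flatMap rowEncode).reverse ++
        (((B.rows.filter (false ∈ ·)).flatMap rowEncode).reverse ++ out) } := by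
  subst hj
  simp [St.home, Gameboard.encode_eq, Gameboard.clear, padding]

/-- Three guesses are forced. The kept and dropped rows exhaust the board because a border square
must follow where a row would start (`padRow_flatten_inj`), and the number of new rows equals that
of dropped ones because the counter `full` must be empty at the end. -/
theorem eq_of_sem_sweep (hd : 0 < d)
    (h : Sem yes (sweep d) ((St.home c d B inp rev out).tape (B.cells d) (d * (B.width + d))) t) :
    t = St.home c d B.clear inp rev (B.clear.encode.reverse ++ out) := by
  obtain ⟨l₀, hl₀⟩ := padding_ne_nil (n := B.width) hd
  rw [tape_first] at h
  simp only [sweep, sem_mul (q := empty _), sem_mul (q := (newRow d)∗),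
    sem_mul (q := pop _ _ * push _ _), sem_kstar, sem_checkBorder, sem_empty] at h
  obtain ⟨_, ⟨_, ⟨_, ⟨k, h₁⟩, ⟨l₁, hl₁⟩, rfl⟩, j, h₂⟩, h₃, rfl⟩ := h
  obtain ⟨rs, l, -, hrs, h, rfl⟩ := (sem_rows_pow (by rfl)).1 h₁
  replace hl₁ : l = none :: l₁ := hl₁
  subst hl₁
  replace h : (B.rows.map (padRow d)).flatten ++ padding d B.width =
    (rs.map (padRow d)).flatten ++ none :: l₁ := h
  rw [hl₀] at h
  obtain ⟨rfl, rfl⟩ := padRow_flatten_inj B.width_pos B.length_of_mem hrs h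
  obtain ⟨hj, rfl⟩ := (sem_newRow_pow (by rfl)).1 h₂
  replace hj : j ≤ 0 + B.rows.countP (false ∉ ·) := hj
  replace h₃ : List.replicate (0 + B.rows.countP (false ∉ ·) - j) () = [] := h₃
  rw [List.replicate_eq_nil_iff] at h₃
  rw [home_clear (j := j) (by omega)]
  ext1 <;> try rfl
  · exact hl₀.symm
  · exact h₃

theorem exec_sweep (hd : 0 < d) {K : ℕ} (h₁ : Steady yes B.width (keepRow d + dropRow d) K)
    (h₂ : Steady yes B.width (newRow d) K) :
    Exec yes (sweep d) (2 * (B.height * K) + 3)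
      ((St.home c d B inp rev out).tape (B.cells d) (d * (B.width + d)))
      (St.home c d B.clear inp rev (B.clear.encode.reverse ++ out)) := by
  obtain ⟨l₀, hl₀⟩ := padding_ne_nil (n := B.width) hd
  have hs : Short yes (pop .right none * push .right none : Prog tm) 2 :=
    (short_act _).mul (short_act _)
  have hc : B.rows.countP (false ∉ ·) ≤ B.height := List.countP_le_length
  have e₁ := h₁.exec_kstar (s := { St.home c d B inp rev out with
        left := padding d B.width
        right := (B.rows.map (padRow d)).flatten ++ padding d B.width }) rfl rfl
    ((sem_rows_pow rfl).2 ⟨B.rows, padding d B.width, rfl, B.length_of_mem, rfl, rfl⟩)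
  have e₂ := e₁.mul (hs _ _ (sem_checkBorder.2 ⟨⟨l₀, hl₀⟩, rfl⟩))
  have e₃ := e₂.mul (h₂.exec_kstar rfl rfl ((sem_newRow_pow rfl).2 ⟨(Nat.zero_add _).ge, rfl⟩))
  have e₄ := e₃.mul (sem_empty (k := .full).2 ⟨by simp [St.get, St.home], rfl⟩).exec_act
  rw [tape_first, home_clear rfl]
  have e₅ := e₄.mono (n := 2 * (B.height * K) + 3) (by
    have : B.rows.countP (false ∉ ·) * K ≤ B.height * K := Nat.mul_le_mul_right _ hc
    have : B.rows.length * K = B.height * K := rfl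
    omega)
  convert e₅ using 1
  · rfl
  · simp [St.home]

end Tetris

namespace Tetris

variable {tm : FinTM2} {yes : tm.Γ tm.k₁} {p q : Prog tm} {m n d k : ℕ} {s u b : St tm}
  {B : Gameboard} {c : tm.Cfg} {inp rev out : List Symbol} {t : PieceType}

/-! ### One trajectory -/

/-- Go to the initial position of a piece. -/
def start (d : ℕ) (t : PieceType) : Prog tm :=
  shift d (-1 - t.top, -1) * halfRight * push .ori 0

theorem PieceType.top_nonneg (t : PieceType) : 0 ≤ t.top := by cases t <;> decide

theorem PieceType.top_le (t : PieceType) : t.top ≤ 1 := by cases t <;> decide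

theorem Gameboard.height_pos (B : Gameboard) : 0 < B.height :=
  List.length_pos_iff.2 B.rows_ne_nil

/-- The initial position may lie off the board: column `⌊1 / 2⌋ = 0` for width one, or row `0` when
a piece with `top = 1` meets a board of height one. The piece is then blocked, but the program still
has to look. -/
theorem around_initialState (B : Gameboard) (t : PieceType) :
    B.Around (initialState B t).position := by
  have := t.top_nonneg
  have := t.top_le
  have := B.height_pos
  constructor <;> simp only [initialState] <;> omega

theorem St.home_eq_on : St.home c d B inp rev out =
    (St.home c d B inp rev out).on d B (B.height + 1, 1) := by
  rw [St.on, show (B.index d (B.height + 1, 1)).toNat = B.lower d from ?_]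
  · exact St.home_eq_tape c B inp rev out
  · have : B.index d (B.height + 1, 1) = (B.lower d : ℤ) := by
      rw [Gameboard.index, Gameboard.lower]
      push_cast
      ring
    rw [this, Int.toNat_natCast]

theorem St.ready_home : (St.home c d B inp rev out).Ready B := ⟨rfl, rfl⟩

/-- Between trajectories the head stands just above the first column, at `(B.height + 1, 1)`. The
shift leads to column `0` of the right row, and half the width is added from there. -/
theorem sem_start (hd : 6 ≤ d) : Sem yes (start d t) (St.home c d B inp rev out) u ↔
    u = (St.home c d B inp rev out).piece d B (initialState B t) := by
  have h₁ : B.Near d ((B.height : ℤ) + 1, 1) := by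
    have := B.width_pos
    constructor <;> simp only <;> omega
  have e : (((B.height : ℤ) + 1, 1) + (-1 - t.top, -1) : ℤ × ℤ) = ((B.height : ℤ) - t.top, 0) := by
    ext
    · simp only [Prod.fst_add]; ring
    · simp
  have h₂ : B.Near d ((B.height : ℤ) - t.top, 0) := by
    have := t.top_nonneg
    have := t.top_le
    constructor <;> simp only <;> omega
  have h₃ := (around_initialState B t).near_self (d := d) (by omega)
  have e' : (B.index d ((B.height : ℤ) - t.top, 0)).toNat + B.width / 2 =
      (B.index d (initialState B t).position).toNat := by
    have h₄ : B.index d (initialState B t).position =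
        B.index d ((B.height : ℤ) - t.top, 0) + (B.width / 2 : ℕ) := by
      simp only [Gameboard.index, initialState]
      ring
    have := h₂.nonneg
    omega
  rw [start, St.home_eq_on, sem_mul]
  simp only [sem_mul (p := shift _ _), sem_shift_on St.ready_home h₁ (e ▸ h₂), exists_eq_left, e]
  rw [St.on]
  simp only [sem_halfRight (s := St.home c d B inp rev out) rfl h₂.toNat_lt.le]
  change (∃ v, (_ + B.width / 2 ≤ _ ∧ v = St.tape _ _ (_ + B.width / 2)) ∧ _) ↔ _
  rw [e']
  simp only [h₃.toNat_lt.le, true_and, exists_eq_left, sem_push]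
  rfl

theorem linear_start : Linear yes (start d t : Prog tm) :=
  ((linear_shift _).mul linear_halfRight).mul (linear_push (by simp) (by simp))

/-- Fix the piece. -/
def fixPiece (d : ℕ) (t : PieceType) : Prog tm :=
  ⨆ o, pop .ori o * checkFilled d ((t.offsets o).map fun x => (-1, 0) + x) *
    push .out (.move .fix) * fillSquares d (t.offsets o)

theorem sem_fixPiece {P : PieceState} (hb : b.Ready B) (hP : B.Fits P) (hd : 6 ≤ d)
    (ht : P.type = t) : Sem yes (fixPiece d t) (b.piece d B P) u ↔ ¬ B.Fits (P.shift (-1, 0)) ∧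
      u = { b.record .fix with ori := [] }.on d (B.fill P.squares) P.position := by
  subst ht
  have hb' : ({ b with ori := [] } : St tm).Ready B := ⟨hb.width, hb.aux⟩
  have hb'' : ({ b.record .fix with ori := [] } : St tm).Ready B := ⟨hb.width, hb.aux⟩
  have ha := hP.inside.around
  have hn := ha.near_self (d := d) (by omega)
  have hc u := sem_checkFilled (yes := yes) (t := u) hb' hn
    (near_shift_offsets (v := (-1, 0)) ha (by simp [Near]) hd)
  simp only [fixPiece, sem_iSup, sem_mul (q := fillSquares _ _), sem_mul (q := push _ _),
    sem_mul (q := checkFilled _ _), sem_pop_ori, and_assoc, exists_and_left, exists_eq_left',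
    exists_eq_left, hc,
    ← not_fits_shift, sem_push]
  have e : ({ b with ori := [] }.on d B P.position).set .out
      (.move .fix :: ({ b with ori := [] }.on d B P.position).get .out) =
      { b.record .fix with ori := [] }.on d B P.position := rfl
  rw [e, sem_fillSquares hb'' (by omega) hn fun v hv =>
    Gameboard.inside_of_not_filled (fits_iff.1 hP v hv)]
  rfl

theorem linear_fixPiece : Linear yes (fixPiece d t : Prog tm) :=
  .iSup fun _ => (((linear_pop (by simp) (by simp)).mul (linear_checkFilled _)).mul
    (linear_push (by simp) (by simp))).mul (linear_fillSquares _)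

theorem sem_readSymbol_home {a : Symbol} : Sem yes (readSymbol a) (St.home c d B inp rev out) u ↔
    ∃ l, inp = a :: l ∧ u = St.home c d B l (a :: rev) out := sem_readSymbol

theorem sem_checkFree_initial (hd : 6 ≤ d) : Sem yes (checkFree d (t.offsets 0))
    ((St.home c d B inp rev out).piece d B (initialState B t)) u ↔
      B.Fits (initialState B t) ∧
        u = (St.home c d B inp rev out).piece d B (initialState B t) := by
  have ha := around_initialState B t
  exact (sem_checkFree (b := { St.home c d B inp rev out with ori := [0] }) ⟨rfl, rfl⟩
    (ha.near_self (by omega)) fun v hv => ha.near (offsets_near _ _ v hv) (by omega)).trans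
      (and_congr (fits_iff (P := initialState B t)).symm Iff.rfl)

theorem sem_checkFilled_initial (hd : 6 ≤ d) : Sem yes (checkFilled d (t.offsets 0))
    ((St.home c d B inp rev out).piece d B (initialState B t)) u ↔
      ¬ B.Fits (initialState B t) ∧
        u = (St.home c d B inp rev out).piece d B (initialState B t) := by
  have ha := around_initialState B t
  refine (sem_checkFilled (b := { St.home c d B inp rev out with ori := [0] }) ⟨rfl, rfl⟩
    (ha.near_self (by omega)) fun v hv => ha.near (offsets_near _ _ v hv) (by omega)).trans
      (and_congr ?_ Iff.rfl)
  rw [fits_iff]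
  simp only [not_forall, not_not, exists_prop]
  rfl

variable (R : RotationModel)

/-- A trajectory of a piece. -/
noncomputable def round (d : ℕ) (t : PieceType) : Prog tm :=
  readSymbol (.piece t) * start d t * checkFree d (t.offsets 0) * (moveOnce R d t)∗ *
    fixPiece d t * goHome d * sweep d

theorem legalFrom_append (B : Gameboard) (P : PieceState) (σ τ : List Move) :
    LegalFrom R B P (σ ++ τ) ↔
      LegalFrom R B P σ ∧ LegalFrom R B (σ.foldl (nextState R B) P) τ := by
  induction σ generalizing P with
  | nil => simp [LegalFrom]
  | cons μ σ ih => simp only [List.cons_append, LegalFrom, ih, List.foldl_cons, and_assoc]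

theorem eq_nil_of_legalFrom_fixed {P : PieceState} (hP : P.fixed = true) {σ : List Move}
    (h : LegalFrom R B P σ) : σ = [] := by
  cases σ with
  | nil => rfl
  | cons μ σ =>
    have : P.fixed = false := by
      cases μ with
      | rotate θ => exact h.1
      | left => exact h.1.1
      | right => exact h.1.1
      | drop => exact h.1.1
      | fix => exact h.1.1
    simp [hP] at this

theorem fixed_foldl {P : PieceState} {σ : List Move} (h : .fix ∉ σ) :
    (σ.foldl (nextState R B) P).fixed = P.fixed := by
  induction σ generalizing P with
  | nil => rfl
  | cons μ σ ih =>
    simp only [List.mem_cons, not_or] at h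
    rw [List.foldl_cons, ih h.2, fixed_nextState R P (Ne.symm h.1)]

theorem type_foldl (P : PieceState) (σ : List Move) :
    (σ.foldl (nextState R B) P).type = P.type := by
  induction σ generalizing P with
  | nil => rfl
  | cons μ σ ih => rw [List.foldl_cons, ih, type_nextState]

theorem fits_foldl {P : PieceState} {σ : List Move} (hP : B.Fits P) (h : LegalFrom R B P σ) :
    B.Fits (σ.foldl (nextState R B) P) := by
  induction σ generalizing P with
  | nil => exact hP
  | cons μ σ ih => exact ih (fits_nextState R hP h.1) h.2

/-- A trajectory consists of other moves and a final fix. -/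
theorem isTrajectory_iff {σ : List Move} : IsTrajectory R B t σ ↔
    ∃ τ, σ = τ ++ [.fix] ∧ .fix ∉ τ ∧ LegalFrom R B (initialState B t) τ ∧
      ¬ B.Fits ((τ.foldl (nextState R B) (initialState B t)).shift (-1, 0)) := by
  constructor
  · rintro ⟨h, h'⟩
    obtain ⟨τ, rfl⟩ := List.getLast?_eq_some_iff.1 h'
    obtain ⟨h₁, h₂⟩ := (legalFrom_append R _ _ _ _).1 h
    refine ⟨τ, rfl, ?_, h₁, h₂.1.2⟩
    intro hm
    obtain ⟨τ₁, τ₂, rfl⟩ := List.append_of_mem hm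
    rw [List.append_assoc, legalFrom_append] at h
    have := eq_nil_of_legalFrom_fixed R rfl h.2.2
    simp at this
  · rintro ⟨τ, rfl, hm, h₁, h₂⟩
    refine ⟨(legalFrom_append R _ _ _ _).2 ⟨h₁, ⟨?_, h₂⟩, trivial⟩, by simp⟩
    rw [fixed_foldl R hm]
    rfl

theorem result_append (τ : List Move) : result R B t (τ ++ [.fix]) =
    (B.fill (τ.foldl (nextState R B) (initialState B t)).squares).clear := by
  rw [result, List.foldl_append]
  rfl

theorem height_clear (B : Gameboard) : B.clear.height = B.height := by
  simp only [Gameboard.height, Gameboard.clear, List.length_append, List.length_replicate]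
  rw [List.countP_eq_length_filter]
  simp only [decide_not]
  exact (List.length_eq_length_filter_add _).symm

theorem height_result (σ : List Move) : (result R B t σ).height = B.height := by
  rw [result, height_clear, Gameboard.height_fill]

theorem width_result (σ : List Move) : (result R B t σ).width = B.width := rfl

/-- Soundness of a round: the guessed moves form a trajectory, and the store is again in the form
`St.home`, now for the resulting board. This makes rounds composable. -/
theorem of_sem_round (hd : R.radius + 6 ≤ d)
    (h : Sem yes (round R d t) (St.home c d B inp rev out) u) :
    ∃ l σ, inp = .piece t :: l ∧ B.Fits (initialState B t) ∧ IsTrajectory R B t σ ∧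
      u = St.home c d (result R B t σ) l (.piece t :: rev)
        ((result R B t σ).encode.reverse ++ ((σ.map Symbol.move).reverse ++ out)) := by
  have hd' : 6 ≤ d := by omega
  obtain ⟨_, h, h₇⟩ := sem_mul.1 h
  obtain ⟨_, h, h₆⟩ := sem_mul.1 h
  obtain ⟨_, h, h₅⟩ := sem_mul.1 h
  obtain ⟨_, h, h₄⟩ := sem_mul.1 h
  obtain ⟨_, h, h₃⟩ := sem_mul.1 h
  obtain ⟨_, h₁, h₂⟩ := sem_mul.1 h
  obtain ⟨l, rfl, rfl⟩ := sem_readSymbol_home.1 h₁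
  -- The constant `d` exceeds the radius by `6`, which covers both the pattern around a rotating
  -- piece and the squares next to a translated one.
  rw [sem_start hd'] at h₂
  subst h₂
  obtain ⟨hf, rfl⟩ := (sem_checkFree_initial hd').1 h₃
  obtain ⟨k, h₄⟩ := sem_kstar.1 h₄
  obtain ⟨τ, -, hm, hτ, rfl⟩ := (sem_moveOnce_pow R St.ready_home hf rfl hd).1 h₄
  have hF := fits_foldl R hf hτ
  have ht := type_foldl R (B := B) (initialState B t) τ
  obtain ⟨hx, rfl⟩ := (sem_fixPiece (b := St.home c d B l (.piece t :: rev)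
    ((τ.map Symbol.move).reverse ++ out)) ⟨rfl, rfl⟩ hF hd' ht).1 h₅
  refine ⟨l, τ ++ [.fix], rfl, hf, (isTrajectory_iff R).2 ⟨τ, rfl, hm, hτ, hx⟩, ?_⟩
  rw [result_append]
  set P := τ.foldl (nextState R B) (initialState B t)
  have hn := (hF.inside.fill P.squares).near (d := d) (by omega)
  have hT : d * (B.width + d) ≤ ((B.fill P.squares).cells d).length := by
    rw [Gameboard.length_cells]
    exact Nat.mul_le_mul_right _ (by omega)
  replace h₆ : Sem yes (goHome d) ((St.home c d (B.fill P.squares) l (.piece t :: rev)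
    (.move .fix :: ((τ.map Symbol.move).reverse ++ out))).tape ((B.fill P.squares).cells d)
      ((B.fill P.squares).index d P.position).toNat) _ := h₆
  rw [sem_goHome rfl hn.toNat_lt.le hT] at h₆
  subst h₆
  rw [eq_of_sem_sweep (B := B.fill P.squares) (by omega) h₇]
  simp

/-- Here `j` counts the moves before the fix, so the trajectory has length `j + 1`. Every summand is
a constant multiple of `w + 1`, `j * (w + 1)` or `(h + 1) * (w + 1)`, and each of these is at most
the product on the right. -/
theorem round_cost_le (k₁ k₂ k₃ k₄ d w h j : ℕ) :
    k₁ * (w + 1) + j * (k₂ * (w + 1)) + k₃ * (w + 1) +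
      ((h + 2 * d) * (w + d) * 2 + 1 + d * (w * 6 + 2 + d * 2)) +
      (2 * (h * (k₄ * (w + 1))) + 3) ≤
    (k₁ + k₂ + k₃ + (2 * ((1 + 2 * d) * (1 + d)) + 1 + d * (8 + d * 2)) + (2 * k₄ + 3)) *
      ((w + 1) * (h + (j + 1) + 1)) := by
  have h₀ : w + 1 ≤ (w + 1) * (h + (j + 1) + 1) := Nat.le_mul_of_pos_right _ (by omega)
  have h₁ : j * (w + 1) ≤ (w + 1) * (h + (j + 1) + 1) := by nlinarith
  have h₂ : (h + 1) * (w + 1) ≤ (w + 1) * (h + (j + 1) + 1) := by nlinarith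
  generalize (w + 1) * (h + (j + 1) + 1) = X at h₀ h₁ h₂
  have e₁ : k₁ * (w + 1) ≤ k₁ * X := Nat.mul_le_mul_left _ h₀
  have e₂ : j * (k₂ * (w + 1)) ≤ k₂ * X := by
    rw [Nat.mul_left_comm]
    exact Nat.mul_le_mul_left _ h₁
  have e₃ : k₃ * (w + 1) ≤ k₃ * X := Nat.mul_le_mul_left _ h₀
  have e₄ : (h + 2 * d) * (w + d) ≤ (1 + 2 * d) * (1 + d) * X :=
    calc (h + 2 * d) * (w + d) ≤ ((1 + 2 * d) * (h + 1)) * ((1 + d) * (w + 1)) :=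
          Nat.mul_le_mul (by nlinarith) (by nlinarith)
      _ = (1 + 2 * d) * (1 + d) * ((h + 1) * (w + 1)) := by ring
      _ ≤ _ := Nat.mul_le_mul_left _ h₂
  have e₅ : d * (w * 6 + 2 + d * 2) ≤ d * (8 + d * 2) * X :=
    calc d * (w * 6 + 2 + d * 2) ≤ d * ((8 + d * 2) * (w + 1)) :=
          Nat.mul_le_mul_left _ (by nlinarith)
      _ = d * (8 + d * 2) * (w + 1) := by ring
      _ ≤ _ := Nat.mul_le_mul_left _ h₀
  have e₆ : h * (k₄ * (w + 1)) ≤ k₄ * X := by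
    rw [Nat.mul_left_comm]
    exact Nat.mul_le_mul_left _ ((Nat.mul_le_mul_right _ (Nat.le_succ h)).trans h₂)
  linarith

theorem exec_round (hd : R.radius + 6 ≤ d) : ∃ K, ∀ (c : tm.Cfg) (B : Gameboard) (t : PieceType)
    (σ : List Move) (l rev out : List Symbol), B.Fits (initialState B t) → IsTrajectory R B t σ →
    Exec yes (round R d t) (K * ((B.width + 1) * (B.height + σ.length + 1)))
      (St.home c d B (.piece t :: l) rev out)
      (St.home c d (result R B t σ) l (.piece t :: rev)
        ((result R B t σ).encode.reverse ++ ((σ.map Symbol.move).reverse ++ out))) := by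
  have hd' : 6 ≤ d := by omega
  have hfirst (t : PieceType) : Linear yes
      (readSymbol (.piece t) * start d t * checkFree d (t.offsets 0) : Prog tm) :=
    (((linear_pop (by simp) (by simp)).mul (linear_push (by simp) (by simp))).mul
      linear_start).mul (linear_checkFree _)
  choose K₁ hK₁ using hfirst
  choose K₂ hK₂ using linear_moveOnce (yes := yes) R (d := d)
  choose K₃ hK₃ using fun t => linear_fixPiece (yes := yes) (t := t) (d := d)
  obtain ⟨K₄, hK₄⟩ := (linear_keepRow (yes := yes) (d := d)).add linear_dropRow
  obtain ⟨K₅, hK₅⟩ := linear_newRow (yes := yes) (d := d)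
  have key (t : PieceType) : ∃ K, ∀ (c : tm.Cfg) (B : Gameboard) (σ : List Move)
      (l rev out : List Symbol), B.Fits (initialState B t) → IsTrajectory R B t σ →
      Exec yes (round R d t) (K * ((B.width + 1) * (B.height + σ.length + 1)))
        (St.home c d B (.piece t :: l) rev out)
        (St.home c d (result R B t σ) l (.piece t :: rev)
          ((result R B t σ).encode.reverse ++ ((σ.map Symbol.move).reverse ++ out))) := by
    refine ⟨K₁ t + K₂ t + K₃ t + (2 * ((1 + 2 * d) * (1 + d)) + 1 + d * (8 + d * 2)) +
      (2 * (K₄ + K₅) + 3), ?_⟩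
    intro c B σ l rev out hf hσ
    obtain ⟨τ, rfl, hm, hτ, hx⟩ := (isTrajectory_iff R).1 hσ
    have hF := fits_foldl R hf hτ
    have ht := type_foldl R (B := B) (initialState B t) τ
    have s₁ : Sem yes (readSymbol (.piece t) * start d t * checkFree d (t.offsets 0) : Prog tm)
        (St.home c d B (.piece t :: l) rev out)
        ((St.home c d B l (.piece t :: rev) out).piece d B (initialState B t)) :=
      sem_mul.2 ⟨_, sem_mul.2 ⟨_, sem_readSymbol_home.2 ⟨l, rfl, rfl⟩, (sem_start hd').2 rfl⟩,
        (sem_checkFree_initial hd').2 ⟨hf, rfl⟩⟩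
    have e₁ := (hK₁ t _ _ _ rfl rfl s₁).2.2
    have e₂ := e₁.mul ((hK₂ t _).exec_kstar rfl rfl
      ((sem_moveOnce_pow R St.ready_home hf rfl hd).2 ⟨τ, rfl, hm, hτ, rfl⟩))
    have s₃ := (sem_fixPiece (yes := yes) (b := St.home c d B l (.piece t :: rev)
      ((τ.map Symbol.move).reverse ++ out)) ⟨rfl, rfl⟩ hF hd' ht).2 ⟨hx, rfl⟩
    have e₃ := e₂.mul (hK₃ t _ _ _ rfl rfl s₃).2.2
    set P := τ.foldl (nextState R B) (initialState B t)
    have hn := (hF.inside.fill P.squares).near (d := d) (by omega)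
    have hT : d * (B.width + d) ≤ ((B.fill P.squares).cells d).length := by
      rw [Gameboard.length_cells]
      exact Nat.mul_le_mul_right _ (by omega)
    have e₄ := exec_goHome (yes := yes) (s := St.home c d (B.fill P.squares) l (.piece t :: rev)
      (.move .fix :: ((τ.map Symbol.move).reverse ++ out))) rfl hn.toNat_lt.le hT
    have e₅ := exec_sweep (yes := yes) (c := c) (B := B.fill P.squares) (inp := l)
      (rev := .piece t :: rev) (out := .move .fix :: ((τ.map Symbol.move).reverse ++ out))
      (d := d) (by omega) (K := (K₄ + K₅) * (B.width + 1))
      ((hK₄ _).mono (by rw [add_mul]; exact Nat.le_add_right _ _))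
      ((hK₅ _).mono (by rw [add_mul]; exact Nat.le_add_left _ _))
    have e₆ := (e₃.mul e₄).mul e₅
    rw [result_append]
    have e₇ := e₆.mono (n := (K₁ t + K₂ t + K₃ t + (2 * ((1 + 2 * d) * (1 + d)) + 1 +
        d * (8 + d * 2)) + (2 * (K₄ + K₅) + 3)) *
        ((B.width + 1) * (B.height + (τ ++ [Move.fix]).length + 1))) (by
      rw [Gameboard.length_cells, Gameboard.height_fill, List.length_append, List.length_singleton]
      exact round_cost_le _ _ _ _ _ _ _ _)
    convert e₇ using 1
    · rfl
    · simp [P]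
  choose K hK using key
  obtain ⟨M, hM⟩ := (Set.finite_range K).bddAbove
  refine ⟨M, fun c B t σ l rev out hf hσ => (hK t c B σ l rev out hf hσ).mono ?_⟩
  gcongr
  exact hM (Set.mem_range_self t)

end Tetris

namespace Tetris

variable {tm : FinTM2} {yes : tm.Γ tm.k₁} {p q : Prog tm} {m n d k : ℕ} {s u b : St tm}
  {B : Gameboard} {c : tm.Cfg} {inp rev out : List Symbol} {t : PieceType}

/-! ### A course of play -/

/-- Read a piece. -/
def readPiece : Prog tm := ⨆ t, readSymbol (.piece t)

/-- Check that the next piece is blocked. -/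
def checkLoss (d : ℕ) : Prog tm :=
  ⨆ t, readSymbol (.piece t) * start d t * checkFilled d (t.offsets 0)

/-- Check that play ends. -/
def checkEnd (d : ℕ) : Prog tm := empty .inp + checkLoss d * (readPiece∗ * empty .inp)

theorem sem_readPiece_pow : Sem yes (readPiece ^ k) s u ↔
    ∃ (ts : List PieceType) (l : List Symbol), ts.length = k ∧ s.inp = ts.map Symbol.piece ++ l ∧
      u = { s with inp := l, rev := (ts.map Symbol.piece).reverse ++ s.rev } := by
  induction k generalizing s with
  | zero =>
    rw [sem_pow_zero]
    constructor
    · rintro rfl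
      exact ⟨[], u.inp, rfl, rfl, rfl⟩
    · rintro ⟨ts, l, h, h', rfl⟩
      obtain rfl := List.length_eq_zero_iff.1 h
      replace h' : s.inp = l := h'
      subst h'
      rfl
  | succ k ih =>
    simp only [sem_pow_succ, ih]
    simp only [readPiece, sem_iSup, sem_readSymbol]
    constructor
    · rintro ⟨_, ⟨t, l, h, rfl⟩, ts, l', hk, h', rfl⟩
      replace h' : l = ts.map Symbol.piece ++ l' := h'
      exact ⟨t :: ts, l', by simp [hk], by simp [h, h'], by simp⟩
    · rintro ⟨_ | ⟨t, ts⟩, l, hk, h, rfl⟩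
      · simp at hk
      · exact ⟨_, ⟨t, _, h, rfl⟩, ts, l, by simpa using hk, rfl, by simp⟩

theorem sem_checkLoss (hd : 6 ≤ d) : Sem yes (checkLoss d) (St.home c d B inp rev out) u ↔
    ∃ t l, inp = .piece t :: l ∧ ¬ B.Fits (initialState B t) ∧
      u = (St.home c d B l (.piece t :: rev) out).piece d B (initialState B t) := by
  simp only [checkLoss, sem_iSup, sem_mul, sem_readSymbol_home]
  constructor
  · rintro ⟨t, _, ⟨_, ⟨l, h, rfl⟩, h'⟩, h''⟩
    rw [sem_start hd] at h'
    subst h'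
    exact ⟨t, l, h, (sem_checkFilled_initial hd).1 h''⟩
  · rintro ⟨t, l, h, h'⟩
    exact ⟨t, _, ⟨_, ⟨l, h, rfl⟩, (sem_start hd).2 rfl⟩, (sem_checkFilled_initial hd).2 h'⟩

theorem linear_checkLoss : Linear yes (checkLoss d : Prog tm) :=
  .iSup fun _ => (((linear_pop (by simp) (by simp)).mul (linear_push (by simp) (by simp))).mul
    linear_start).mul (linear_checkFilled _)

/-- The string of a course of play. -/
def playEncode (S : List (List Move × Gameboard)) : List Symbol :=
  S.flatMap fun p => p.1.map Symbol.move ++ p.2.encode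

/-- The store after a course of play. -/
structure St.Played (u : St tm) (c : tm.Cfg) (rev out : List Symbol) : Prop where
  inp : u.inp = []
  rev : u.rev = rev
  out : u.out = out
  cfg : u.cfg = c

theorem sem_empty_inp : Sem yes (empty .inp) s u ↔ s.inp = [] ∧ u = s := sem_empty

variable (R : RotationModel)

/-- After a loss the remaining pieces are read but not played. The head and the stack `ori` are then
no longer in their home state, so only the parts of the store that matter later are recorded in
`St.Played`. -/
theorem of_sem_checkEnd (hd : 6 ≤ d) (h : Sem yes (checkEnd d) (St.home c d B inp rev out) u) :
    ∃ ts, inp = ts.map Symbol.piece ∧ IsPlay R B ts [] ∧ u.Played c (inp.reverse ++ rev) out := by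
  rcases sem_add.1 h with h | h
  · obtain ⟨hi, rfl⟩ := sem_empty_inp.1 h
    replace hi : inp = [] := hi
    subst hi
    exact ⟨[], rfl, rfl, rfl, rfl, rfl, rfl⟩
  · obtain ⟨_, h₁, h⟩ := sem_mul.1 h
    obtain ⟨_, h₂, h₃⟩ := sem_mul.1 h
    obtain ⟨k, h₂⟩ := sem_kstar.1 h₂
    obtain ⟨t, l, rfl, hf, rfl⟩ := (sem_checkLoss hd).1 h₁
    obtain ⟨ts, l', -, hl, rfl⟩ := sem_readPiece_pow.1 h₂
    obtain ⟨hl', rfl⟩ := sem_empty_inp.1 h₃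
    replace hl' : l' = [] := hl'
    subst hl'
    replace hl : l = ts.map Symbol.piece ++ [] := hl
    rw [List.append_nil] at hl
    subst hl
    refine ⟨t :: ts, rfl, hf, rfl, ?_, rfl, rfl⟩
    simp [St.piece, St.on, St.tape, St.home]

theorem exec_checkEnd (hd : 6 ≤ d) : ∃ K, ∀ (c : tm.Cfg) (B : Gameboard) (ts : List PieceType)
    (rev out : List Symbol), IsPlay R B ts [] →
    ∃ u : St tm, Exec yes (checkEnd d) (K * (B.width + 1) * (ts.length + 1))
        (St.home c d B (ts.map Symbol.piece) rev out) u ∧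
      u.Played c ((ts.map Symbol.piece).reverse ++ rev) out := by
  obtain ⟨K, hK⟩ := linear_checkLoss (yes := yes) (d := d)
  have hs : Short yes (readPiece : Prog tm) 2 := .iSup fun _ => (short_act _).mul (short_act _)
  refine ⟨K + 2, fun c B ts rev out h => ?_⟩
  have h1 : 1 ≤ (K + 2) * (B.width + 1) * (ts.length + 1) := Nat.succ_le_of_lt (by positivity)
  cases ts with
  | nil =>
    exact ⟨_, ((sem_empty_inp.2 ⟨rfl, rfl⟩).exec_act.le le_self_add).mono h1,
      rfl, rfl, rfl, rfl⟩
  | cons t ts =>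
    have h₁ := (sem_checkLoss (yes := yes) (c := c) (inp := (t :: ts).map Symbol.piece)
      (rev := rev) (out := out) hd).2 ⟨t, _, rfl, h, rfl⟩
    have e₁ := (hK _ _ _ rfl rfl h₁).2.2
    have e₂ := (hs.pow _ _ _ (sem_readPiece_pow.2 ⟨ts, [], rfl, (List.append_nil _).symm,
      rfl⟩ : Sem yes (readPiece ^ ts.length) ((St.home c d B (ts.map Symbol.piece)
        (.piece t :: rev) out).piece d B (initialState B t)) _)).kstar
    have e₃ := e₁.mul (e₂.mul (sem_empty_inp.2 ⟨rfl, rfl⟩).exec_act)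
    refine ⟨_, (e₃.le le_add_self).mono ?_, rfl, ?_, rfl, rfl⟩
    · change K * (B.width + 1) + (ts.length * 2 + 1) ≤ (K + 2) * (B.width + 1) * (ts.length + 1 + 1)
      have h₂ : K * (B.width + 1) ≤ K * (B.width + 1) * (ts.length + 2) :=
        Nat.le_mul_of_pos_right _ (by omega)
      nlinarith
    · simp [St.piece, St.on, St.tape, St.home]

/-- Play the whole game. -/
noncomputable def play (d : ℕ) : Prog tm := (⨆ t, round R d t)∗ * checkEnd d

theorem of_sem_play_pow (hd : R.radius + 6 ≤ d)
    (h : Sem yes ((⨆ t, round R d t) ^ k * checkEnd d) (St.home c d B inp rev out) u) :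
    ∃ ts S, inp = ts.map Symbol.piece ∧ IsPlay R B ts S ∧
      u.Played c (inp.reverse ++ rev) ((playEncode S).reverse ++ out) := by
  induction k generalizing B inp rev out with
  | zero =>
    rw [pow_zero, one_mul] at h
    obtain ⟨ts, h₁, h₂, h₃⟩ := of_sem_checkEnd R (by omega) h
    exact ⟨ts, [], h₁, h₂, h₃⟩
  | succ k ih =>
    rw [pow_succ', mul_assoc] at h
    obtain ⟨_, h₁, h₂⟩ := sem_mul.1 h
    obtain ⟨t, h₁⟩ := sem_iSup.1 h₁
    obtain ⟨l, σ, rfl, hf, hσ, rfl⟩ := of_sem_round R hd h₁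
    obtain ⟨ts, S, rfl, hS, hu⟩ := ih h₂
    refine ⟨t :: ts, (σ, result R B t σ) :: S, rfl, ⟨hf, hσ, rfl, hS⟩, ?_⟩
    simpa [playEncode] using hu

/-- Every round has the same bound, since results keep the dimensions of the board and `M` bounds
all trajectories. There are at most `ts.length` rounds, and the additional unit pays for the check
that play ends. -/
theorem exec_play (hd : R.radius + 6 ≤ d) : ∃ K, ∀ (c : tm.Cfg) (B : Gameboard)
    (ts : List PieceType) (S : List (List Move × Gameboard)) (rev out : List Symbol) (M : ℕ),
    IsPlay R B ts S → (∀ p ∈ S, p.1.length ≤ M) →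
    ∃ u : St tm, Exec yes (play R d)
        (K * ((B.width + 1) * (B.height + M + 1)) * (ts.length + 1))
        (St.home c d B (ts.map Symbol.piece) rev out) u ∧
      u.Played c ((ts.map Symbol.piece).reverse ++ rev) ((playEncode S).reverse ++ out) := by
  obtain ⟨K, hK⟩ := exec_round (tm := tm) (yes := yes) R hd
  obtain ⟨K', hK'⟩ := exec_checkEnd (tm := tm) (yes := yes) R (d := d) (by omega)
  refine ⟨K + K', ?_⟩
  have key : ∀ (c : tm.Cfg) (B : Gameboard)
    (ts : List PieceType) (S : List (List Move × Gameboard)) (rev out : List Symbol) (M : ℕ),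
    IsPlay R B ts S → (∀ p ∈ S, p.1.length ≤ M) →
    ∃ u : St tm, Exec yes ((⨆ t, round R d t) ^ S.length * checkEnd d)
        ((K + K') * ((B.width + 1) * (B.height + M + 1)) * (ts.length + 1))
        (St.home c d B (ts.map Symbol.piece) rev out) u ∧
      u.Played c ((ts.map Symbol.piece).reverse ++ rev) ((playEncode S).reverse ++ out) := by
    intro c B ts S rev out M hS hM
    induction S generalizing B ts rev out with
    | nil =>
      obtain ⟨u, hu, hu'⟩ := hK' c B ts rev out hS
      refine ⟨u, ?_, hu'⟩
      rw [List.length_nil, pow_zero, one_mul]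
      refine hu.mono (Nat.mul_le_mul_right _ (Nat.mul_le_mul (Nat.le_add_left _ _) ?_))
      exact Nat.le_mul_of_pos_right _ (by omega)
    | cons a S ih =>
      obtain ⟨σ, B'⟩ := a
      cases ts with
      | nil => cases hS
      | cons t ts =>
        obtain ⟨hf, hσ, rfl, hS⟩ := hS
        rw [List.forall_mem_cons] at hM
        obtain ⟨u, hu, hu'⟩ := ih (result R B t σ) ts (.piece t :: rev)
          ((result R B t σ).encode.reverse ++ ((σ.map Symbol.move).reverse ++ out)) hS hM.2
        rw [height_result, width_result] at hu
        refine ⟨u, ?_, by simpa [playEncode] using hu'⟩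
        have e := ((hK c B t σ (ts.map Symbol.piece) rev out hf hσ).le
          (le_iSup (fun t => round R d t) t)).mul hu
        rw [List.length_cons, pow_succ', mul_assoc]
        refine e.mono ?_
        have h₁ : K * ((B.width + 1) * (B.height + σ.length + 1)) ≤
            (K + K') * ((B.width + 1) * (B.height + M + 1)) := by
          have := hM.1
          gcongr
          omega
        rw [List.length_cons, mul_add _ (ts.length + 1), mul_one]
        omega
  intro c B ts S rev out M hS hM
  obtain ⟨u, hu, hu'⟩ := key c B ts S rev out M hS hM
  refine ⟨u, hu.le (mul_le_mul' (pow_le_kstar' _ _) le_rfl), hu'⟩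

theorem of_sem_play (hd : R.radius + 6 ≤ d)
    (h : Sem yes (play R d) (St.home c d B inp rev out) u) :
    ∃ ts S, inp = ts.map Symbol.piece ∧ IsPlay R B ts S ∧
      u.Played c (inp.reverse ++ rev) ((playEncode S).reverse ++ out) := by
  obtain ⟨v, h₁, h₂⟩ := sem_mul.1 h
  obtain ⟨k, h₁⟩ := sem_kstar.1 h₁
  exact of_sem_play_pow R hd (sem_mul.2 ⟨v, h₁, h₂⟩)

end Tetris

namespace Tetris

variable {tm : FinTM2} {yes : tm.Γ tm.k₁} {p q : Prog tm} {m n d k : ℕ} {s t u : St tm}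

/-! ### Running the machine that checks the objective -/

/-- The store after feeding the string `l` to the machine. -/
def St.feed (s : St tm) (l : List (tm.Γ tm.k₀)) : St tm :=
  { s with cfg := ⟨s.cfg.l, s.cfg.var, Function.update s.cfg.stk tm.k₀ (l ++ s.cfg.stk tm.k₀)⟩ }

theorem sem_feed {a : tm.Γ tm.k₀} : Sem yes (act (.feed a)) s t ↔ t = s.feed [a] := by
  rw [sem_act, StackAction.exec, Option.some_inj]
  refine Iff.trans ?_ (St.toStore_injective.eq_iff (a := t))
  rw [eq_comm]
  rfl

theorem sem_step : Sem yes (act .step) s t ↔ ∃ c, tm.step s.cfg = some c ∧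
    t = { s with cfg := c } := by
  rw [sem_act, StackAction.exec, Option.map_eq_some_iff]
  refine exists_congr fun c => and_congr Iff.rfl ?_
  refine Iff.trans ?_ (St.toStore_injective.eq_iff (a := t))
  rw [eq_comm]
  rfl

theorem sem_accept : Sem yes (act .accept) s t ↔
    (s.cfg.l = none ∧ (s.cfg.stk tm.k₁).head? = some yes) ∧ t = s := by
  rw [sem_act, StackAction.exec]
  split_ifs with h
  · rw [Option.some_inj, St.toStore_injective.eq_iff, eq_comm]
    exact (and_iff_right h).symm
  · simp only [false_iff, not_and]
    exact fun h' => absurd h' h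

/-- Feed the symbols on a stack to the machine. -/
def feedStack (r : Reg) (f : r.Alph → tm.Γ tm.k₀) : Prog tm :=
  (⨆ a, pop r a * act (.feed (f a)))∗ * empty r

theorem St.get_set_self (r : Reg) (l : List r.Alph) : (s.set r l).get r = l := by
  rw [St.get_set, Function.update_self]

theorem St.get_feed (r : Reg) (l : List (tm.Γ tm.k₀)) : (s.feed l).get r = s.get r := by
  cases r <;> rfl

theorem St.set_feed_set (r : Reg) (l : List r.Alph) (l' : List r.Alph) (x y : List (tm.Γ tm.k₀)) :
    (((s.set r l).feed x).set r l').feed y = (s.set r l').feed (y ++ x) := by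
  cases r <;> simp [St.set, St.feed]

theorem St.feed_nil : s.feed [] = s := by
  simp only [St.feed, List.nil_append, Function.update_eq_self]
  rfl

theorem St.set_get (r : Reg) : s.set r (s.get r) = s := by
  cases r <;> simp [St.set, St.get]

theorem sem_feedStack_pow {r : Reg} {f : r.Alph → tm.Γ tm.k₀} :
    Sem yes ((⨆ a, pop r a * act (.feed (f a))) ^ k) s t ↔ k ≤ (s.get r).length ∧
      t = (s.set r ((s.get r).drop k)).feed (((s.get r).take k).reverse.map f) := by
  induction k generalizing s with
  | zero => simp [sem_one, St.feed_nil, St.set_get]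
  | succ k ih =>
    simp only [sem_pow_succ, ih]
    simp only [sem_iSup, sem_mul, sem_pop, sem_feed]
    constructor
    · rintro ⟨_, ⟨a, _, ⟨l, h, rfl⟩, rfl⟩, hk, rfl⟩
      rw [St.get_feed, St.get_set_self] at hk ⊢
      rw [h]
      refine ⟨Nat.succ_le_succ hk, ?_⟩
      rw [St.set_feed_set]
      simp
    · rintro ⟨hk, rfl⟩
      cases h : s.get r with
      | nil => simp [h] at hk
      | cons a l =>
        rw [h] at hk
        refine ⟨_, ⟨a, _, ⟨l, rfl, rfl⟩, rfl⟩, ?_, ?_⟩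
        · rw [St.get_feed, St.get_set_self]
          exact Nat.le_of_succ_le_succ hk
        · rw [St.get_feed, St.get_set_self, St.set_feed_set]
          simp

/-- Feeding pushes on the input stack and thus reverses the order once more; strings that were
collected in reverse arrive in the right order. -/
theorem sem_feedStack {r : Reg} {f : r.Alph → tm.Γ tm.k₀} : Sem yes (feedStack r f) s t ↔
    t = (s.set r []).feed ((s.get r).reverse.map f) := by
  rw [feedStack, sem_mul]
  simp only [sem_kstar, sem_feedStack_pow, sem_empty]
  constructor
  · rintro ⟨_, ⟨k, hk, rfl⟩, h, rfl⟩
    rw [St.get_feed, St.get_set_self, List.drop_eq_nil_iff] at h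
    rw [List.take_of_length_le h, List.drop_eq_nil_of_le h]
  · rintro rfl
    exact ⟨_, ⟨(s.get r).length, le_rfl, rfl⟩, by simp [St.get_feed, St.get_set_self], by simp⟩

theorem exec_feedStack {r : Reg} {f : r.Alph → tm.Γ tm.k₀} (h : Sem yes (feedStack r f) s t) :
    Exec yes (feedStack r f) ((s.get r).length * 2 + 1) s t := by
  obtain ⟨u, h₁, h₂⟩ := sem_mul.1 h
  obtain ⟨k, h₁⟩ := sem_kstar.1 h₁
  have hs : Short yes (⨆ a, pop r a * act (.feed (f a)) : Prog tm) 2 :=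
    .iSup fun _ => (short_act _).mul (short_act _)
  exact ((hs.pow k _ _ h₁).kstar.mono (Nat.mul_le_mul_right _ (sem_feedStack_pow.1 h₁).1)).mul
    h₂.exec_act

theorem sem_step_pow : Sem yes (act .step ^ k) s t ↔
    ∃ c, (flip bind tm.step)^[k] (some s.cfg) = some c ∧ t = { s with cfg := c } := by
  induction k generalizing s with
  | zero =>
    rw [sem_pow_zero]
    constructor
    · rintro rfl
      exact ⟨_, rfl, rfl⟩
    · rintro ⟨c, h, rfl⟩
      obtain rfl := Option.some.inj h
      rfl
  | succ k ih =>
    simp only [sem_pow_succ, sem_step, ih]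
    rw [Function.iterate_succ_apply]
    change _ ↔ ∃ c, (flip bind tm.step)^[k] (tm.step s.cfg) = some c ∧ _
    have hnone : (flip bind tm.step)^[k] none = none := Function.iterate_fixed rfl k
    constructor
    · rintro ⟨_, ⟨c, h, rfl⟩, c', h', rfl⟩
      exact ⟨c', by rw [h]; exact h', rfl⟩
    · rintro ⟨c', h', rfl⟩
      cases h : tm.step s.cfg with
      | none => rw [h, hnone] at h'; cases h'
      | some c => exact ⟨_, ⟨c, rfl, rfl⟩, c', by rw [h] at h'; exact h', rfl⟩

/-- Two halting computations from the same configuration are equal. -/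
theorem eq_of_halted {f : tm.Cfg → Option tm.Cfg} {c a b : tm.Cfg} {i j : ℕ}
    (hi : (flip bind f)^[i] (some c) = some a) (ha : f a = none)
    (hj : (flip bind f)^[j] (some c) = some b) (hb : f b = none) : a = b := by
  have key : ∀ {a b : tm.Cfg} {i j : ℕ}, (flip bind f)^[i] (some c) = some a → f a = none →
      (flip bind f)^[j] (some c) = some b → i ≤ j → a = b := by
    intro a b i j hi ha hj hij
    obtain ⟨k, rfl⟩ := Nat.exists_eq_add_of_le' hij
    rw [Function.iterate_add_apply, hi] at hj
    cases k with
    | zero => exact Option.some.inj hj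
    | succ k =>
      have hnone : (flip bind f)^[k] none = none := Function.iterate_fixed rfl k
      rw [Function.iterate_succ_apply] at hj
      change (flip bind f)^[k] (f a) = some b at hj
      rw [ha, hnone] at hj
      cases hj
  rcases le_total i j with h | h
  · exact key hi ha hj h
  · exact (key hj hb hi h).symm

/-- The initial configuration with empty stacks. -/
def blank (tm : FinTM2) : tm.Cfg := ⟨some tm.main, tm.initialState, fun _ => []⟩

theorem feed_blank (l : List (tm.Γ tm.k₀)) :
    (⟨(blank tm).l, (blank tm).var, Function.update (blank tm).stk tm.k₀ l⟩ : tm.Cfg) =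
      initList tm l := by
  simp only [blank, initList]
  congr 1
  funext j
  by_cases hj : j = tm.k₀
  · subst hj
    simp
  · simp [hj]

/-- Run the machine on the game and the trajectory sequence. -/
def evaluate (f : Symbol ⊕ Symbol → tm.Γ tm.k₀) : Prog tm :=
  feedStack .out (fun a => f (.inr a)) * feedStack .rev (fun a => f (.inl a)) *
    (act .step)∗ * act .accept

/-- The stack `out` is fed before `rev`, so that the game comes to lie on top of the trajectory
sequence, as in `pairEncode`. -/
theorem sem_feedBoth {f : Symbol ⊕ Symbol → tm.Γ tm.k₀} {x y : List Symbol} (hs : s.cfg = blank tm)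
    (hx : s.rev = x.reverse) (hy : s.out = y.reverse) :
    Sem yes (feedStack .out (fun a => f (.inr a)) * feedStack .rev (fun a => f (.inl a))) s t ↔
      t = { s with rev := [], out := [], cfg := initList tm ((pairEncode x y).map f) } := by
  rw [sem_mul]
  simp only [sem_feedStack, exists_eq_left]
  rw [← feed_blank, ← hs]
  simp [St.feed, St.set, St.get, hx, hy, hs, blank, pairEncode, Function.comp_def]

theorem haltList_stk (l : List (tm.Γ tm.k₁)) : (haltList tm l).stk tm.k₁ = l := by
  simp [haltList]

variable {f : Symbol ⊕ Symbol → tm.Γ tm.k₀} {x y : List Symbol} {r : tm.Γ tm.k₁}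

/-- The certificate chooses the number of steps, but acceptance requires a halted configuration, and
by determinism (`eq_of_halted`) there is only one. -/
theorem of_sem_evaluate (hs : s.cfg = blank tm) (hx : s.rev = x.reverse) (hy : s.out = y.reverse)
    (hk : (flip bind tm.step)^[k] (some (initList tm ((pairEncode x y).map f))) =
      some (haltList tm [r])) (h : Sem yes (evaluate f) s t) : r = yes := by
  obtain ⟨_, h, h₃⟩ := sem_mul.1 h
  obtain ⟨_, h₁, h₂⟩ := sem_mul.1 h
  rw [sem_feedBoth hs hx hy] at h₁
  subst h₁
  obtain ⟨j, h₂⟩ := sem_kstar.1 h₂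
  obtain ⟨c, hc, rfl⟩ := sem_step_pow.1 h₂
  obtain ⟨⟨hl, hyes⟩, -⟩ := sem_accept.1 h₃
  have hstep (c : tm.Cfg) (h : c.l = none) : tm.step c = none := by
    obtain ⟨l, v, S⟩ := c
    cases h
    rfl
  obtain rfl := eq_of_halted hc (hstep _ hl) hk (hstep _ rfl)
  replace hyes : ((haltList tm [r]).stk tm.k₁).head? = some yes := hyes
  rw [haltList_stk] at hyes
  exact Option.some.inj hyes

theorem exec_evaluate (hs : s.cfg = blank tm) (hx : s.rev = x.reverse) (hy : s.out = y.reverse)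
    (hk : (flip bind tm.step)^[k] (some (initList tm ((pairEncode x y).map f))) =
      some (haltList tm [yes])) :
    ∃ t, Exec yes (evaluate f) (2 * y.length + 2 * x.length + k + 3) s t := by
  obtain ⟨u, h₁, h₂⟩ := sem_mul.1 ((sem_feedBoth (yes := yes) (f := f) hs hx hy).2 rfl)
  have hu : u.rev = s.rev := by
    rw [sem_feedStack] at h₁
    rw [h₁]
    rfl
  have e := (exec_feedStack h₁).mul (exec_feedStack h₂)
  have e₁ := ((short_act _).pow k _ _ (sem_step_pow.2 ⟨_, hk, rfl⟩ :
    Sem yes (act .step ^ k) { s with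
      rev := [], out := [], cfg := initList tm ((pairEncode x y).map f) } _)).kstar
  have e₂ := (sem_accept.2 ⟨⟨rfl, by rw [haltList_stk]; rfl⟩, rfl⟩ :
    Sem yes (act .accept) { s with rev := [], out := [], cfg := haltList tm [yes] } _).exec_act
  refine ⟨_, ((e.mul e₁).mul e₂).mono ?_⟩
  simp only [St.get, hu, hx, hy, List.length_reverse]
  omega

end Tetris

namespace Tetris

variable {R : RotationModel} {B : Gameboard} {t : PieceType} {σ : List Move} {P Q : PieceState}

/-! ### Counting piece states -/

theorem of_mem_scanl (hσ : .fix ∉ σ) (h : LegalFrom R B P σ) (hP : B.Fits P)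
    (hQ : Q ∈ σ.scanl (nextState R B) P) : B.Fits Q ∧ Q.type = P.type ∧ Q.fixed = P.fixed := by
  induction σ generalizing P with
  | nil =>
    obtain rfl : Q = P := by simpa using hQ
    exact ⟨hP, rfl, rfl⟩
  | cons μ σ ih =>
    rw [List.scanl_cons, List.mem_cons] at hQ
    simp only [List.mem_cons, not_or] at hσ
    obtain rfl | hQ := hQ
    · exact ⟨hP, rfl, rfl⟩
    · obtain ⟨h₁, h₂, h₃⟩ := ih hσ.2 h.2 (fits_nextState R hP h.1) hQ
      exact ⟨h₁, h₂.trans (type_nextState R _ _), h₃.trans (fixed_nextState R _ (Ne.symm hσ.1))⟩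

/-- A gameboard has room for at most four states per gridsquare of an unfixed piece. -/
theorem length_le_of_fits {l : List PieceState} (hl : l.Nodup)
    (h : ∀ Q ∈ l, B.Fits Q ∧ Q.type = t ∧ Q.fixed = false) : l.length ≤ 4 * B.size := by
  let f (Q : PieceState) : ZMod 4 × ℤ × ℤ := (Q.orientation, Q.position)
  -- Type and flag are the same for all states in the list, so orientation and position tell them
  -- apart.
  have hf : (l.map f).Nodup := by
    refine (List.nodup_map_iff_inj_on hl).2 fun Q hQ Q' hQ' hQQ' => ?_
    obtain ⟨h₁, h₂⟩ := Prod.mk.inj hQQ'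
    exact PieceState.ext ((h Q hQ).2.1.trans (h Q' hQ').2.1.symm) h₁ h₂
      ((h Q hQ).2.2.trans (h Q' hQ').2.2.symm)
  have hs : (l.map f).toFinset ⊆
      Finset.univ ×ˢ (Finset.Icc 1 (B.height : ℤ) ×ˢ Finset.Icc 1 (B.width : ℤ)) := by
    intro y hy
    obtain ⟨Q, hQ, rfl⟩ := List.mem_map.1 (List.mem_toFinset.1 hy)
    obtain ⟨h₁, h₂, h₃, h₄⟩ := (h Q hQ).1.inside
    simp only [Finset.mem_product, Finset.mem_univ, Finset.mem_Icc, true_and, f]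
    exact ⟨⟨h₁, h₂⟩, h₃, h₄⟩
  have := Finset.card_le_card hs
  rw [List.toFinset_card_of_nodup hf, List.length_map, Finset.card_product, Finset.card_product,
    Finset.card_univ, ZMod.card, Int.card_Icc, Int.card_Icc] at this
  simpa [Gameboard.size] using this

/-- The count applies to the states before the final fix. There is one more of them than moves
before the fix, hence as many as moves in `σ`. -/
theorem IsTrajectory.length_le (h : IsTrajectory R B t σ) (hB : B.Fits (initialState B t))
    (hσ : (trajectoryStates R B t σ).Nodup) : σ.length ≤ 4 * B.size := by
  obtain ⟨τ, rfl, hτ, hτ', -⟩ := (isTrajectory_iff R).1 h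
  rw [trajectoryStates, List.scanl_append] at hσ
  have := length_le_of_fits (t := t) hσ.of_append_left fun Q hQ => of_mem_scanl hτ hτ' hB hQ
  simpa using this

theorem length_trajectoryStates : (trajectoryStates R B t σ).length = σ.length + 1 := by
  simp [trajectoryStates]

theorem Gameboard.size_result : (result R B t σ).size = B.size := by
  rw [Gameboard.size, Gameboard.size, height_result, width_result]

variable {ts : List PieceType} {S : List (List Move × Gameboard)}

theorem IsPlay.length_move_le (h : IsPlay R B ts S) (hS : ∀ s ∈ playStates R B ts S, s.Nodup) :
    ∀ p ∈ S, p.1.length ≤ 4 * B.size := by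
  induction ts generalizing B S with
  | nil => obtain rfl := h; simp
  | cons t ts ih =>
    rcases S with _ | ⟨⟨σ, B'⟩, S⟩
    · simp
    · obtain ⟨h₁, h₂, rfl, h₄⟩ := h
      rw [playStates, List.forall_mem_cons] at hS
      rw [List.forall_mem_cons]
      refine ⟨h₂.length_le h₁ hS.1, fun p hp => ?_⟩
      rw [← Gameboard.size_result]
      exact ih h₄ hS.2 p hp

theorem IsPlay.length_states_le (h : IsPlay R B ts S)
    (hS : ∀ s ∈ playStates R B ts S, s.Nodup) :
    ∀ s ∈ playStates R B ts S, s.length ≤ 4 * B.size + 1 := by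
  induction ts generalizing B S with
  | nil => obtain rfl := h; simp [playStates]
  | cons t ts ih =>
    rcases S with _ | ⟨⟨σ, B'⟩, S⟩
    · simp [playStates]
    · obtain ⟨h₁, h₂, rfl, h₄⟩ := h
      rw [playStates, List.forall_mem_cons] at hS ⊢
      refine ⟨?_, fun p hp => ?_⟩
      · rw [length_trajectoryStates]
        exact Nat.succ_le_succ (h₂.length_le h₁ hS.1)
      · rw [← Gameboard.size_result]
        exact ih h₄ hS.2 p hp

theorem Gameboard.length_encode : B.encode.length = B.height * (B.width + 1) := by
  rw [encode, List.length_flatMap, List.map_congr_left (g := fun _ => B.width + 1)]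
  · simp [height]
  · intro r hr
    simp [B.length_of_mem r hr]

theorem length_encode_result : (result R B t σ).encode.length = B.encode.length := by
  rw [Gameboard.length_encode, Gameboard.length_encode, height_result, width_result]

theorem IsPlay.length_playEncode_le {M : ℕ} (h : IsPlay R B ts S)
    (hS : ∀ p ∈ S, p.1.length ≤ M) :
    (playEncode S).length ≤ ts.length * (M + B.encode.length) := by
  induction ts generalizing B S with
  | nil => obtain rfl := h; simp [playEncode]
  | cons t ts ih =>
    rcases S with _ | ⟨⟨σ, B'⟩, S⟩
    · simp [playEncode]
    · obtain ⟨h₁, h₂, rfl, h₄⟩ := h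
      rw [List.forall_mem_cons] at hS
      have := ih h₄ hS.2
      rw [length_encode_result] at this
      simp only [playEncode, List.flatMap_cons, List.length_append, List.length_map,
        List.length_cons, length_encode_result, add_mul, one_mul] at this ⊢
      have : σ.length ≤ M := hS.1
      omega

variable {G : Game}

theorem Game.length_encode :
    G.encode.length = G.board.height * (G.board.width + 1) + G.pieces.length := by
  rw [encode, List.length_append, List.length_map, Gameboard.length_encode]

theorem Game.size_le : G.board.size ≤ G.encode.length := by
  rw [Game.length_encode, Gameboard.size, mul_add]
  omega

theorem Game.height_le : G.board.height ≤ G.encode.length := by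
  rw [Game.length_encode, mul_add]
  omega

theorem Game.width_le : G.board.width ≤ G.encode.length := by
  rw [Game.length_encode]
  have := Nat.mul_le_mul_right (G.board.width + 1) (Gameboard.height_pos (B := G.board))
  omega

theorem TrajectorySequence.Acyclic.length_encode_le {S : TrajectorySequence R G} (h : S.Acyclic) :
    S.encode.length ≤ 5 * G.encode.length ^ 2 := by
  have h₁ := IsPlay.length_playEncode_le S.2 (S.2.length_move_le h)
  have h₂ := G.size_le
  have h₃ : G.pieces.length ≤ G.encode.length := by rw [Game.length_encode]; omega
  have h₄ : G.board.encode.length ≤ G.encode.length := by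
    rw [Game.encode, List.length_append]; omega
  calc _ ≤ _ := h₁
    -- The number of pieces, the number of gridsquares and the length of the encoded board are each
    -- bounded by the length of the encoded game.
    _ ≤ G.encode.length * (4 * G.encode.length + G.encode.length) := by gcongr
    _ = _ := by ring

end Tetris

namespace Tetris

section Regular

open Language

variable {tm : FinTM2} {p q : Prog tm} {d : ℕ} {c : Bool → Prog tm}
  {X : (Bool → Prog tm) → Prog tm}

/-! ### The programs are regular languages -/

theorem isRegular_tick : (tick : Prog tm).IsRegular := (isRegular_act _).mul (isRegular_act _)

theorem isRegular_reset : (reset : Prog tm).IsRegular :=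
  ((isRegular_act _).mul ((isRegular_act _).mul (isRegular_act _)).kstar).mul (isRegular_act _)

theorem isRegular_forWidth (hp : p.IsRegular) : (forWidth p).IsRegular :=
  (isRegular_tick.mul hp).kstar.mul isRegular_reset

theorem isRegular_moveRight : (moveRight : Prog tm).IsRegular :=
  .iSup fun _ => (isRegular_act _).mul (isRegular_act _)

theorem isRegular_moveLeft : (moveLeft : Prog tm).IsRegular :=
  .iSup fun _ => (isRegular_act _).mul (isRegular_act _)

theorem isRegular_shift (v : ℤ × ℤ) : (shift d v : Prog tm).IsRegular :=
  ((((isRegular_forWidth isRegular_moveRight).mul (isRegular_moveRight.pow _)).pow _).mul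
    (((isRegular_forWidth isRegular_moveLeft).mul (isRegular_moveLeft.pow _)).pow _)).mul
    ((isRegular_moveRight.pow _).mul (isRegular_moveLeft.pow _))

theorem isRegular_look (v : ℤ × ℤ) (P : Option Bool → Prop) :
    (look d v P : Prog tm).IsRegular :=
  ((isRegular_shift _).mul (.iSup fun _ => (isRegular_act _).mul (isRegular_act _))).mul
    (isRegular_shift _)

theorem isRegular_write (v : ℤ × ℤ) (b : Option Bool) : (write d v b : Prog tm).IsRegular :=
  ((isRegular_shift _).mul (.iSup fun _ => (isRegular_act _).mul (isRegular_act _))).mul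
    (isRegular_shift _)

theorem isRegular_constRow {b : Bool} (hc : ∀ a, (c a).IsRegular) : (constRow b c).IsRegular :=
  (hc _).kstar

theorem isRegular_withSquare {b : Bool} (hc : ∀ a, (c a).IsRegular) :
    (withSquare b c).IsRegular :=
  ((hc _).kstar.mul (hc _)).mul (IsRegular.iSup hc).kstar

theorem isRegular_mixedRow (hc : ∀ a, (c a).IsRegular) : (mixedRow c).IsRegular :=
  ((hc _).mul (isRegular_withSquare hc)).add ((hc _).mul (isRegular_withSquare hc))

theorem isRegular_overRow (hX : ∀ c : Bool → Prog tm, (∀ a, (c a).IsRegular) → (X c).IsRegular)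
    (hc : ∀ a, (c a).IsRegular) : (overRow X c).IsRegular :=
  (hX _ fun a => isRegular_tick.mul (hc a)).mul isRegular_reset

theorem isRegular_readSymbol (a : Symbol) : (readSymbol a : Prog tm).IsRegular :=
  (isRegular_act _).mul (isRegular_act _)

theorem isRegular_readRow
    (hX : ∀ c : Bool → Prog tm, (∀ a, (c a).IsRegular) → (X c).IsRegular) :
    (readRow d X).IsRegular :=
  ((isRegular_overRow hX fun _ => (isRegular_readSymbol _).mul (isRegular_act _)).mul
    (isRegular_readSymbol _)).mul ((isRegular_act _).pow _)

theorem isRegular_readBoard : (readBoard d : Prog tm).IsRegular := by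
  have h : (pour : Prog tm).IsRegular :=
    (IsRegular.iSup fun _ => (isRegular_act _).mul (isRegular_act _)).kstar.mul (isRegular_act _)
  have h' : (checkRead : Prog tm).IsRegular := .iSup fun _ => (isRegular_act _).mul (isRegular_act _)
  exact (((((h.mul ((isRegular_act _).mul (isRegular_act _).kstar)).mul
    (((isRegular_forWidth (isRegular_act _)).mul ((isRegular_act _).pow _)).pow _)).mul
    (isRegular_readRow fun _ hc => isRegular_mixedRow hc).kstar).mul
    (isRegular_readRow fun _ hc => isRegular_constRow hc).kstar).mul h').mul
    (((isRegular_forWidth (isRegular_act _)).mul ((isRegular_act _).pow _)).pow _)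

theorem isRegular_checkFree (l : List (ℤ × ℤ)) : (checkFree d l : Prog tm).IsRegular :=
  .list_prod (fun _ => isRegular_look _ _) _

theorem isRegular_checkFilled (l : List (ℤ × ℤ)) : (checkFilled d l : Prog tm).IsRegular :=
  .iSup fun _ => isRegular_look _ _

theorem isRegular_start (t : PieceType) : (start d t : Prog tm).IsRegular :=
  ((isRegular_shift _).mul ((((isRegular_tick.mul isRegular_tick).mul
    isRegular_moveRight).kstar.mul (isRegular_one.add isRegular_tick)).mul isRegular_reset)).mul
    (isRegular_act _)

theorem isRegular_translate (l : List (ℤ × ℤ)) (o : ZMod 4) (μ : Move) (v : ℤ × ℤ) :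
    (translate d l o μ v : Prog tm).IsRegular :=
  (((isRegular_checkFree _).mul (isRegular_shift _)).mul (isRegular_act _)).mul (isRegular_act _)

variable (R : RotationModel)

theorem isRegular_turn (t : PieceType) (o : ZMod 4) (θ : Rotation) :
    (turn R d t o θ : Prog tm).IsRegular :=
  .iSup fun _ => (((IsRegular.list_prod (fun _ => isRegular_look _ _) _).mul
    (isRegular_shift _)).mul (isRegular_act _)).mul (isRegular_act _)

theorem isRegular_moveOnce (t : PieceType) : (moveOnce R d t : Prog tm).IsRegular :=
  .iSup fun _ => (isRegular_act _).mul ((((isRegular_translate _ _ _ _).add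
    (isRegular_translate _ _ _ _)).add (isRegular_translate _ _ _ _)).add
    (.iSup fun _ => isRegular_turn R _ _ _))

theorem isRegular_fixPiece (t : PieceType) : (fixPiece d t : Prog tm).IsRegular :=
  .iSup fun _ => (((isRegular_act _).mul (isRegular_checkFilled _)).mul (isRegular_act _)).mul
    (.list_prod (fun _ => isRegular_write _ _) _)

theorem isRegular_goHome : (goHome d : Prog tm).IsRegular :=
  (isRegular_moveLeft.kstar.mul (isRegular_act _)).mul
    (((isRegular_forWidth isRegular_moveRight).mul (isRegular_moveRight.pow _)).pow _)

theorem isRegular_sweep : (sweep d : Prog tm).IsRegular := by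
  have h₁ : (keepRow d : Prog tm).IsRegular :=
    ((isRegular_overRow (fun _ hc => isRegular_withSquare hc) fun _ =>
      ((isRegular_act _).mul (isRegular_act _)).mul (isRegular_act _)).mul
      (((isRegular_act _).mul (isRegular_act _)).pow _)).mul (isRegular_act _)
  have h₂ : (dropRow d : Prog tm).IsRegular :=
    ((isRegular_overRow (fun _ hc => isRegular_constRow hc) fun _ => isRegular_act _).mul
      ((isRegular_act _).pow _)).mul (isRegular_act _)
  have h₃ : (newRow d : Prog tm).IsRegular :=
    (((isRegular_act _).mul (isRegular_forWidth ((isRegular_act _).mul (isRegular_act _)))).mul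
      ((isRegular_act _).pow _)).mul (isRegular_act _)
  exact (((h₁.add h₂).kstar.mul ((isRegular_act _).mul (isRegular_act _))).mul h₃.kstar).mul
    (isRegular_act _)

theorem isRegular_round (t : PieceType) : (round R d t : Prog tm).IsRegular :=
  ((((((isRegular_readSymbol _).mul (isRegular_start _)).mul (isRegular_checkFree _)).mul
    (isRegular_moveOnce R _).kstar).mul (isRegular_fixPiece _)).mul isRegular_goHome).mul
    isRegular_sweep

theorem isRegular_play : (play R d : Prog tm).IsRegular := by
  have h : (checkLoss d : Prog tm).IsRegular :=
    .iSup fun _ => ((isRegular_readSymbol _).mul (isRegular_start _)).mul (isRegular_checkFilled _)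
  have h' : (readPiece : Prog tm).IsRegular := .iSup fun _ => isRegular_readSymbol _
  exact (IsRegular.iSup fun _ => isRegular_round R _).kstar.mul
    ((isRegular_act _).add (h.mul (h'.kstar.mul (isRegular_act _))))

theorem isRegular_evaluate (f : Symbol ⊕ Symbol → tm.Γ tm.k₀) :
    (evaluate f : Prog tm).IsRegular := by
  have h (r : Reg) (f : r.Alph → tm.Γ tm.k₀) : (feedStack r f).IsRegular :=
    (IsRegular.iSup fun _ => (isRegular_act _).mul (isRegular_act _)).kstar.mul (isRegular_act _)
  exact (((h _ _).mul (h _ _)).mul (isRegular_act _).kstar).mul (isRegular_act _)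

end Regular

/-! ### The theorem -/

/-- The coefficients are natural numbers, hence nonnegative. -/
theorem eval_mono (q : Polynomial ℕ) : Monotone fun n => q.eval n := by
  intro m n h
  simp only [Polynomial.eval_eq_sum_range]
  exact Finset.sum_le_sum fun i _ => by gcongr

/-- Identifies the initial store of the verifier with `St.start`, where the instance lies reversed
on `rev`; the program therefore begins by pouring it onto `inp`. -/
theorem toStore_start (tm : FinTM2) (x : List Symbol) :
    (St.start (blank tm) x).toStore =
      ⟨Function.update (fun _ => []) Reg.rev (x.map id).reverse, blank tm⟩ := by
  rw [St.toStore, StackStore.mk.injEq]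
  refine ⟨?_, rfl⟩
  funext r
  cases r <;> simp [St.start, St.get]

variable {R : RotationModel} {Φ : Objective R}

theorem inNP_decisionProblem (hcheckable : Φ.Checkable) (hacyclic : Φ.Acyclic) :
    InNP (decisionProblem Φ) := by
  classical
  obtain ⟨T⟩ := hcheckable
  let yes := T.outputAlphabet.invFun true
  let f := T.inputAlphabet.invFun
  let d := R.radius + 6
  obtain ⟨K, hK⟩ := exec_play (yes := yes) R (le_refl (R.radius + 6))
  -- Three groups of summands, for reading, playing and evaluating. They copy the shape of the
  -- respective costs, with width, height, number of gridsquares and number of pieces replaced by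
  -- the length of the input. The machine for the objective receives a string of length at most `n +
  -- 5 * n ^ 2`.
  let q : Polynomial ℕ := (.X * 2 + 1 + .X + (d : Polynomial ℕ) * (.X * 5 + 2 + d * 1) +
    .X * (.X * (3 + 4) + 2 + 2 + d * 1) + .X * (.X * (3 + 4) + 2 + 2 + d * 1) + 2 +
    d * (.X * 5 + 2 + d * 1)) + K * ((.X + 1) * (.X + 4 * .X + 1)) * (.X + 1) +
    (2 * (5 * .X ^ 2) + 2 * .X + T.time.comp (.X + 5 * .X ^ 2) + 3)
  refine inNP_of_stackProgram T.tm Reg.rev id yes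
    (P := readBoard d * play R d * evaluate f)
    ((isRegular_readBoard.mul (isRegular_play R)).mul (isRegular_evaluate _)) _ q ?_ ?_
  · intro x w hw h
    obtain ⟨v, hv⟩ := Option.isSome_iff_exists.1 h
    obtain ⟨t, rfl⟩ := St.toStore_surjective v
    change StackAction.run yes w (some ⟨_, blank T.tm⟩) = _ at hv
    rw [← toStore_start] at hv
    obtain ⟨u, h, h₃⟩ := sem_mul.1 (⟨w, hw, hv⟩ : Sem yes _ _ t)
    obtain ⟨_, h₁, h₂⟩ := sem_mul.1 h
    obtain ⟨B, l, hB, rfl, rfl⟩ := sem_readBoard h₁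
    obtain ⟨ts, S, rfl, hS, hu⟩ := of_sem_play R le_rfl h₂
    let G : Game := ⟨B, hB, ts⟩
    let S' : TrajectorySequence R G := ⟨S, hS⟩
    -- Only now are the two strings known to encode a game and a trajectory sequence of it, so that
    -- the guarantee for the machine `T` applies to them. Acyclicity plays no role in this
    -- direction.
    refine ⟨G, rfl, S', ?_⟩
    have hr : u.rev = G.encode.reverse := by rw [hu.rev, Game.encode, List.reverse_append]
    have ho : u.out = S'.encode.reverse := by rw [hu.out, List.append_nil]; rfl
    have := of_sem_evaluate hu.cfg hr ho (T.outputsFun ⟨G, S'⟩).evals_in_steps h₃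
    exact of_decide_eq_true (T.outputAlphabet.symm.injective this)
  · rintro _ ⟨G, rfl, h⟩
    -- An acyclic sequence is needed for the length of the certificate: it bounds the moves of each
    -- trajectory by `4 * G.board.size`.
    obtain ⟨S, hΦ, hS⟩ := hacyclic G h
    have hm := S.2.length_move_le hS
    have hlen := hS.length_encode_le
    obtain ⟨u, e₂, hu⟩ := hK (blank T.tm) G.board G.pieces S.1 G.board.encode.reverse []
      (4 * G.board.size) S.2 hm
    have e₁ := exec_readBoard (yes := yes) (d := d) (c := blank T.tm) G.legal
      (G.pieces.map Symbol.piece)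
    have hr : u.rev = G.encode.reverse := by rw [hu.rev, Game.encode, List.reverse_append]
    have ho : u.out = S.encode.reverse := by rw [hu.out, List.append_nil]; rfl
    have hT := T.outputsFun ⟨G, S⟩
    have hk := hT.evals_in_steps.trans
      (congrArg (fun b => some (haltList T.tm [T.outputAlphabet.invFun b])) (decide_eq_true hΦ))
    obtain ⟨t, e₃⟩ := exec_evaluate hu.cfg hr ho hk
    obtain ⟨w, hw, hle, hrun⟩ := (e₁.mul e₂).mul e₃
    refine ⟨w, hw, hle.trans ?_, ?_⟩
    · have h₁ := G.size_le
      have h₂ := G.width_le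
      have h₃ := G.height_le
      have h₄ : G.pieces.length ≤ G.encode.length := by rw [Game.length_encode]; omega
      have h₅ : hT.steps ≤ T.time.eval (G.encode.length + 5 * G.encode.length ^ 2) := by
        refine hT.steps_le_m.trans (eval_mono _ ?_)
        simp only [pairEncode, List.length_append, List.length_map]
        omega
      have h₆ : (G.board.encode ++ G.pieces.map Symbol.piece).length = G.encode.length := rfl
      rw [h₆, readCost]
      simp only [q, Polynomial.eval_add, Polynomial.eval_mul, Polynomial.eval_pow,
        Polynomial.eval_X, Polynomial.eval_natCast, Polynomial.eval_ofNat, Polynomial.eval_one,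
        Polynomial.eval_comp, Nat.cast_id]
      gcongr
    · change (StackAction.run yes w (some ⟨_, blank T.tm⟩)).isSome
      rw [← toStore_start]
      exact Option.isSome_iff_exists.2 ⟨_, hrun⟩

end Tetris

theorem mainTheorem8 (R : Tetris.RotationModel) (Φ : Tetris.Objective R)
    (hcheckable : Φ.Checkable) (hacyclic : Φ.Acyclic) :
    InNP (Tetris.decisionProblem Φ) ∧
    (∀ (G : Tetris.Game) (S : Tetris.TrajectorySequence R G), S.Acyclic →
      ∀ s ∈ S.states, s.length ≤ 4 * G.board.size + 1) ∧
    (∃ q : Polynomial ℕ, ∀ (G : Tetris.Game) (S : Tetris.TrajectorySequence R G), S.Acyclic →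
      S.encode.length ≤ q.eval G.encode.length) := by
  refine ⟨Tetris.inNP_decisionProblem hcheckable hacyclic,
    fun G S hS => S.2.length_states_le hS, 5 * .X ^ 2, fun G S hS => ?_⟩
  simpa using hS.length_encode_le
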